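/- Let $n\ge 2$, let $\mathbb M^n$ and $\mathbb M^n_*$ be smooth second countable Riemannian manifolds of dimension $n$ (without boundary, not necessarily connected) with geodesic distances $d,d_*$ and Riemannian volumes $v,v_*$, let $D\subset\mathbb M^n$ be a domain (a nonempty connected open set), and let $p\ge 1$ be real. A curve is a continuous map $\gamma\colon\Delta\to X$ of a bounded (open, half-open or closed) interval $\Delta$ into a manifold $X$. It is locally rectifiable if its closed subcurves have finite length. For a locally rectifiable curve $\gamma$ and $t_0\in\Delta$ let $l_\gamma(t)$ be the signed length of $\gamma$ between $t_0$ and $t$, and $\Delta_\gamma=l_\gamma(\Delta)$. For a family $\Gamma$ of curves in $X$, $\operatorname{adm}\Gamma$ is the set of Borel functions $\rho\colon X\to[0,\infty]$ with $\int_\gamma\rho\,ds\ge1$ (integral with respect to arc length) for every locally rectifiable $\gamma\in\Gamma$, and $M_p(\Gamma)=\inf_{\rho\in\operatorname{adm}\Gamma}\int_X\rho^p\,dv_X$, with $v_X$ the Riemannian volume of $X$ ($M_p(\Gamma)=\infty$ if $\operatorname{adm}\Gamma=\varnothing$). A property holds for $p$-almost every curve if the curves without it form a family of zero $p$-modulus.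 Let $f\colon D\to\mathbb M^n_*$ be continuous, open, discrete (each fibre consists of isolated points) and differentiable almost everywhere. Let $D$ and $f(D)$ be oriented and let $f$ be sense-preserving: the topological degree satisfies $\mu(y,f,G)>0$ for every domain $G$ with compact closure $\overline G\subset D$ and every $y\in f(G)\setminus f(\partial G)$. Denote by $i(x,f)=\mu(f(x),f,G)$ the local topological index, where $G$ is any domain with compact closure $\overline G\subset D$ and $\overline G\cap f^{-1}(f(x))=\{x\}$. Put $$J(x,f)=\limsup_{r\to0}\frac{v_*(f(B(x,r)))}{v(B(x,r))},\qquad l(x,f)=\liminf_{y\to x}\frac{d_*(f(x),f(y))}{d(x,y)},$$ and let $K_{I,p}(x,f)=J(x,f)/l(x,f)^p$ if $J(x,f)\neq0$, $K_{I,p}(x,f)=1$ if $f'(x)=0$, and $K_{I,p}(x,f)=\infty$ otherwise. Suppose that (a) $f\in ACP_p^{-1}$: for $p$-almost every curve $\widetilde\gamma$ in $f(D)$, each lift $\gamma$ of $\widetilde\gamma$ (a curve in $D$ on the same interval with $f\circ\gamma=\widetilde\gamma$) is locally rectifiable, and the function $L^{-1}_{\gamma,f}\colon\Delta_{\widetilde\gamma}\to\Delta_\gamma$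 determined by $L^{-1}_{\gamma,f}(l_{\widetilde\gamma}(t))=l_\gamma(t)$ is absolutely continuous on all closed intervals contained in $\Delta_{\widetilde\gamma}$ (non-locally-rectifiable $\widetilde\gamma$ form a family of zero modulus and are disregarded); (b) $f$ has Luzin's properties $N$ and $N^{-1}$: for $S\subset D$, $v(S)=0$ if and only if $v_*(f(S))=0$. Let $\Gamma$ be a family of curves in $D$, $\Gamma'$ a family of curves in $\mathbb M^n_*$, and $\widetilde m\ge1$ an integer such that for every curve $\beta\colon I\to\mathbb M^n_*$ in $\Gamma'$ there are curves $\alpha_1,\dots,\alpha_{\widetilde m}\in\Gamma$ (not necessarily distinct), $\alpha_j\colon I_j\to D$ with $I_j\subset I$ a subinterval, such that $f\circ\alpha_j=\beta|_{I_j}$ for all $j$, and for every $x\in D$ and every $t\in I$ the relation "$t\in I_j$ and $\alpha_j(t)=x$" holds for at most $i(x,f)$ indices $j$. Then $$M_p(\Gamma')\le\frac1{\widetilde m}\int_D K_{I,p}(x,f)\,\rho^p(x)\,dv(x)\qquad\text{for every }\rho\in\operatorname{adm}\Gamma .$$ -/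

import Mathlib

open Set Filter Topology MeasureTheory Function
open scoped Manifold ContDiff ENNReal Bundle

noncomputable section

namespace RiemModulus

/-! ## Riemannian volume -/

section Volume

variable (n : ℕ) {M : Type*} [TopologicalSpace M] [ChartedSpace (EuclideanSpace ℝ (Fin n)) M]
  [Bundle.RiemannianBundle (fun x : M ↦ TangentSpace (𝓡 n) x)]

/-- The `i`-th coordinate vector field `∂/∂xⁱ` of the preferred chart at `x₀`, at the point with
coordinates `u`. -/
def coordVector (x₀ : M) (u : EuclideanSpace ℝ (Fin n)) (i : Fin n) :
    TangentSpace (𝓡 n) ((extChartAt (𝓡 n) x₀).symm u) :=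
  mfderiv (𝓡 n) (𝓡 n) (extChartAt (𝓡 n) x₀).symm u (EuclideanSpace.single i (1 : ℝ))

/-- The density `√ det (g_ij)` in the coordinates given by the preferred chart at `x₀`. -/
def volumeDensity (x₀ : M) (u : EuclideanSpace ℝ (Fin n)) : ℝ≥0∞ :=
  ENNReal.ofReal (Real.sqrt (Matrix.det (Matrix.of fun i j : Fin n ↦
    (inner ℝ (coordVector n x₀ u i) (coordVector n x₀ u j) : ℝ))))

/-- The measure `A ↦ ∫_{φ (A ∩ U)} √ det (g_ij) dx¹ … dxⁿ`, where `(U, φ)` is the preferred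
chart at `x₀`. -/
def chartVolume [MeasurableSpace M] (x₀ : M) : Measure M :=
  ((volume.restrict (extChartAt (𝓡 n) x₀).target).withDensity (volumeDensity n x₀)).map
    (extChartAt (𝓡 n) x₀).symm

/-- The Riemannian volume. The measures `chartVolume n x₀` agree on the overlaps of the charts,
and their supremum (in the lattice of measures) is the measure that restricts to
`chartVolume n x₀` on the domain of the preferred chart at `x₀`, for every `x₀`. -/
def riemVolume (M : Type*) [TopologicalSpace M] [ChartedSpace (EuclideanSpace ℝ (Fin n)) M]
    [Bundle.RiemannianBundle (fun x : M ↦ TangentSpace (𝓡 n) x)] [MeasurableSpace M] :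
    Measure M :=
  ⨆ x₀ : M, chartVolume n x₀

end Volume

/-! ## Curves, line integrals and the modulus -/

/-- A curve in `X`: a continuous map of a bounded interval (open, closed or half-open) into `X`.
Only the values on `dom` matter. -/
structure Curve (X : Type*) [TopologicalSpace X] where
  toFun : ℝ → X
  dom : Set ℝ
  ordConnected_dom : dom.OrdConnected
  nonempty_dom : dom.Nonempty
  isBounded_dom : Bornology.IsBounded dom
  continuousOn_toFun : ContinuousOn toFun dom

namespace Curve

variable {X Y : Type*}

instance [TopologicalSpace X] : CoeFun (Curve X) fun _ ↦ ℝ → X := ⟨Curve.toFun⟩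

/-- The curve lies in `s`. -/
def LiesIn [TopologicalSpace X] (γ : Curve X) (s : Set X) : Prop := ∀ t ∈ γ.dom, γ t ∈ s

/-- `f ∘ α ⊂ β`: the curve `f ∘ α` is a subcurve of `β`, that is, the restriction of `β` to an
interval contained in the interval of definition of `β`. -/
def LiftsSubcurve [TopologicalSpace X] [TopologicalSpace Y] (f : X → Y)
    (α : Curve X) (β : Curve Y) : Prop :=
  α.dom ⊆ β.dom ∧ ∀ t ∈ α.dom, f (α t) = β t

/-- `α` is a (total) lift of `β`: the equality `f ∘ α = β`. -/
def IsLift [TopologicalSpace X] [TopologicalSpace Y] (f : X → Y)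
    (α : Curve X) (β : Curve Y) : Prop :=
  α.dom = β.dom ∧ ∀ t ∈ α.dom, f (α t) = β t

variable [EMetricSpace X] [EMetricSpace Y]

/-- Every closed subcurve has finite length. -/
def LocallyRectifiable (γ : Curve X) : Prop := LocallyBoundedVariationOn γ γ.dom

/-- The length function `l_γ` of a locally rectifiable curve, normalised by `l_γ(t₀) = 0`:
the length of `γ` between `t₀` and `t`, with a minus sign if `t < t₀`. -/
def lengthFrom (γ : Curve X) (t₀ t : ℝ) : ℝ := variationOnFromTo γ γ.dom t₀ t

/-- The line integral `∫_γ ρ ds` of a locally rectifiable curve with respect to arc length: the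
supremum over the closed subcurves `γ|[a,b]` of `∫_0^{l} ρ(γ⁰(s)) ds`, where `l` is the length
and `γ⁰` is the arc length parametrization of `γ|[a,b]`. -/
def lineIntegral (γ : Curve X) (ρ : X → ℝ≥0∞) : ℝ≥0∞ :=
  ⨆ (a ∈ γ.dom) (b ∈ γ.dom) (_ : a ≤ b),
    ∫⁻ s in Icc 0 (eVariationOn γ (Icc a b)).toReal, ρ (naturalParameterization γ (Icc a b) a s)

end Curve

/-- `ρ ∈ adm Γ`. -/
def Admissible {X : Type*} [EMetricSpace X] [MeasurableSpace X] (Γ : Set (Curve X))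
    (ρ : X → ℝ≥0∞) : Prop :=
  Measurable ρ ∧ ∀ γ ∈ Γ, γ.LocallyRectifiable → 1 ≤ γ.lineIntegral ρ

/-- The `p`-modulus of a family of curves with respect to the measure `v`
(`∞` if there is no admissible function). -/
def modulus {X : Type*} [EMetricSpace X] [MeasurableSpace X] (v : Measure X) (p : ℝ)
    (Γ : Set (Curve X)) : ℝ≥0∞ :=
  ⨅ (ρ : X → ℝ≥0∞) (_ : Admissible Γ ρ), ∫⁻ x, ρ x ^ p ∂v

/-! ## Classes of mappings -/

section Mappings

variable {X Y : Type*} [EMetricSpace X] [EMetricSpace Y]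

/-- The function `L⁻¹_{γ,f}` for a lift `γ` of `β = f ∘ γ`, with the base point `t₀`: it is
determined on `l_β(dom β)` by `L⁻¹(l_β(t)) = l_γ(t)`. -/
def inverseLengthMap (γ : Curve X) (β : Curve Y) (t₀ s : ℝ) : ℝ :=
  γ.lengthFrom t₀ (@invFunOn _ _ ⟨t₀⟩ (β.lengthFrom t₀) β.dom s)

/-- The property required in the class `ACP_p⁻¹` of an individual locally rectifiable curve `β`:
each lift `γ` of `β` in `D` is locally rectifiable, and `L⁻¹_{γ,f}` is absolutely continuous on
every closed interval contained in `l_β(dom β)`. -/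
def HasACLifts (f : X → Y) (D : Set X) (β : Curve Y) : Prop :=
  ∀ γ : Curve X, γ.LiesIn D → γ.IsLift f β →
    γ.LocallyRectifiable ∧
    ∀ t₀ ∈ β.dom, ∀ c d : ℝ, c ≤ d → Icc c d ⊆ β.lengthFrom t₀ '' β.dom →
      AbsolutelyContinuousOnInterval (inverseLengthMap γ β t₀) c d

/-- The class `ACP_p⁻¹` in `D`: `p`-almost every curve `β` in `f(D)` has the property above
(curves that are not locally rectifiable form a family of modulus zero). -/
def ACPInv [MeasurableSpace Y] (vY : Measure Y) (p : ℝ) (f : X → Y) (D : Set X) : Prop :=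
  modulus vY p {β | β.LiesIn (f '' D) ∧ β.LocallyRectifiable ∧ ¬ HasACLifts f D β} = 0

/-- Openness on the open set `D`. -/
def IsOpenMapOn (f : X → Y) (D : Set X) : Prop := ∀ U ⊆ D, IsOpen U → IsOpen (f '' U)

/-- Discreteness: the points of each fibre of `f|_D` are isolated in the fibre. -/
def IsDiscreteMapOn (f : X → Y) (D : Set X) : Prop := ∀ y, IsDiscrete (D ∩ f ⁻¹' {y})

/-- Luzin's property `N` on `D`. -/
def LuzinN [MeasurableSpace X] [MeasurableSpace Y] (vX : Measure X) (vY : Measure Y)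
    (f : X → Y) (D : Set X) : Prop := ∀ S ⊆ D, vX S = 0 → vY (f '' S) = 0

/-- Luzin's property `N⁻¹` on `D`. -/
def LuzinNInv [MeasurableSpace X] [MeasurableSpace Y] (vX : Measure X) (vY : Measure Y)
    (f : X → Y) (D : Set X) : Prop := ∀ S ⊆ D, vY (f '' S) = 0 → vX S = 0

/-- `J(x, f) = limsup_{r → 0} v_*(f(B(x, r))) / v(B(x, r))`. -/
def jacobian [MeasurableSpace X] [MeasurableSpace Y] (vX : Measure X) (vY : Measure Y)
    (f : X → Y) (x : X) : ℝ≥0∞ :=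
  limsup (fun r : ℝ ↦ vY (f '' Metric.eball x (ENNReal.ofReal r)) /
    vX (Metric.eball x (ENNReal.ofReal r))) (𝓝[>] 0)

/-- `l(x, f) = liminf_{y → x} d_*(f(x), f(y)) / d(x, y)`. -/
def minStretch (f : X → Y) (x : X) : ℝ≥0∞ :=
  liminf (fun y ↦ edist (f x) (f y) / edist x y) (𝓝[≠] x)

end Mappings

section InnerDilatation

variable (n : ℕ) {M N : Type*}
  [EMetricSpace M] [ChartedSpace (EuclideanSpace ℝ (Fin n)) M]
  [Bundle.RiemannianBundle (fun x : M ↦ TangentSpace (𝓡 n) x)] [MeasurableSpace M]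
  [EMetricSpace N] [ChartedSpace (EuclideanSpace ℝ (Fin n)) N]
  [Bundle.RiemannianBundle (fun x : N ↦ TangentSpace (𝓡 n) x)] [MeasurableSpace N]

open Classical in
/-- The inner dilatation `K_{I,p}(x, f)` of order `p`: it is `J(x, f) / l(x, f)^p` if
`J(x, f) ≠ 0`, it is `1` if `f'(x) = 0`, and it is `∞` otherwise. -/
def innerDilatation (p : ℝ) (f : M → N) (x : M) : ℝ≥0∞ :=
  if jacobian (riemVolume n M) (riemVolume n N) f x ≠ 0 then
    jacobian (riemVolume n M) (riemVolume n N) f x / minStretch f x ^ p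
  else if MDifferentiableAt (𝓡 n) (𝓡 n) f x ∧ mfderiv (𝓡 n) (𝓡 n) f x = 0 then 1
  else ∞

end InnerDilatation

/-! ## Orientation, degree and local index -/

/-- The linear map `A` is an isomorphism that carries the orientation `o` to `o'`. -/
def PreservesOrientation {n : ℕ} {V W : Type*} [AddCommGroup V] [Module ℝ V]
    [AddCommGroup W] [Module ℝ W] (A : V →ₗ[ℝ] W) (o : Orientation ℝ V (Fin n))
    (o' : Orientation ℝ W (Fin n)) : Prop :=
  ∃ e : V ≃ₗ[ℝ] W, (e : V →ₗ[ℝ] W) = A ∧ Orientation.map (Fin n) e o = o'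

section Degree

variable (n : ℕ) {M N : Type*}
  [TopologicalSpace M] [ChartedSpace (EuclideanSpace ℝ (Fin n)) M]
  [TopologicalSpace N] [ChartedSpace (EuclideanSpace ℝ (Fin n)) N]

/-- A choice of an orientation of each tangent space. -/
abbrev OrientationField (M : Type*) [TopologicalSpace M]
    [ChartedSpace (EuclideanSpace ℝ (Fin n)) M] :=
  (x : M) → Orientation ℝ (TangentSpace (𝓡 n) x) (Fin n)

/-- The field `o` is an orientation of the (open) set `s`: read in a chart, it is locally
constant on `s`. -/
def IsOrientationOn (o : OrientationField n M) (s : Set M) : Prop :=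
  ∀ x₀ ∈ s, ∃ oE : Orientation ℝ (EuclideanSpace ℝ (Fin n)) (Fin n), ∀ᶠ x in 𝓝[s] x₀,
    PreservesOrientation (W := EuclideanSpace ℝ (Fin n))
      (mfderiv (𝓡 n) (𝓡 n) (extChartAt (𝓡 n) x₀) x).toLinearMap (o x) oE

variable {n}

open Classical in
/-- The sign `± 1` of the derivative of `g` at a point where it is invertible. -/
def derivSign (o : OrientationField n M) (o' : OrientationField n N) (g : M → N) (x : M) : ℤ :=
  if PreservesOrientation (mfderiv (𝓡 n) (𝓡 n) g x).toLinearMap (o x) (o' (g x)) then 1 else -1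

/-- `d` is the topological degree `μ(y, f, G)` of `f` at `y ∉ f(∂G)` with respect to the
relatively compact open set `G`: there is a homotopy on the closure of `G`, avoiding `y` on `∂G`,
from `f` to a map that is smooth on `G` and has `y` as a regular value, and `d` is the
(finite) sum of the signs of the derivative of that map over its `y`-points in `G`.
By homotopy invariance and Sard's theorem there is exactly one such `d`. -/
def HasDegree (o : OrientationField n M) (o' : OrientationField n N) (f : M → N) (G : Set M)
    (y : N) (d : ℤ) : Prop :=
  ∃ H : ℝ → M → N,
    ContinuousOn (fun q : ℝ × M ↦ H q.1 q.2) (Icc 0 1 ×ˢ closure G) ∧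
    (∀ x ∈ closure G, H 0 x = f x) ∧
    (∀ t ∈ Icc (0 : ℝ) 1, ∀ x ∈ frontier G, H t x ≠ y) ∧
    ContMDiffOn (𝓡 n) (𝓡 n) ∞ (H 1) G ∧
    (∀ x ∈ G, H 1 x = y → Bijective (mfderiv (𝓡 n) (𝓡 n) (H 1) x)) ∧
    d = ∑ᶠ x ∈ G ∩ H 1 ⁻¹' {y}, derivSign o o' (H 1) x

/-- `G` is a domain (a nonempty connected open set) with compact closure contained in `D`. -/
def IsCompactSubdomain (G D : Set M) : Prop :=
  IsOpen G ∧ IsConnected G ∧ IsCompact (closure G) ∧ closure G ⊆ D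

/-- `f` is sense-preserving in `D`: `μ(y, f, G) > 0` for each domain `G` with compact closure in
`D` and each `y ∈ f(G) \ f(∂G)`. -/
def SensePreserving (o : OrientationField n M) (o' : OrientationField n N) (f : M → N)
    (D : Set M) : Prop :=
  ∀ G, IsCompactSubdomain G D → ∀ y ∈ f '' G \ f '' frontier G, ∀ d : ℤ,
    HasDegree o o' f G y d → 0 < d

/-- `k` is the local topological index `i(x, f)`: the degree `μ(f(x), f, G)` for a domain `G`
with compact closure in `D` such that `closure G ∩ f⁻¹(f(x)) = {x}`. -/
def HasLocalIndex (o : OrientationField n M) (o' : OrientationField n N) (f : M → N)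
    (D : Set M) (x : M) (k : ℤ) : Prop :=
  ∃ G, IsCompactSubdomain G D ∧ closure G ∩ f ⁻¹' {f x} = {x} ∧ HasDegree o o' f G (f x) k

end Degree

end RiemModulus

end

open RiemModulus

open Set Filter Topology MeasureTheory Function
open scoped Manifold ContDiff ENNReal Bundle

noncomputable section

namespace RiemModulus

/-! ### Length functions and metric speed. -/

section ArcLength

variable {X : Type*} [EMetricSpace X]

/-! Given `ρ ∈ adm Γ`, an almost admissible function for `Γ'` is the mean over fibres `g(y) = ((1/m)
∑ (ρ(x)/l(x,f))^p)^(1/p)`, the sum running over the `x ∈ f⁻¹(y)` with `l(x,f) > 0`. Two facts are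
needed: `∫ g^p ≤ (1/m) ∫ K ρ^p`, and `∫_β g ds ≥ 1` for all `β ∈ Γ'` outside families that cost
arbitrarily little.

Energy (`exists_mean_pushforward`). The set `l > 0` splits into countably many disjoint Borel pieces
on which `f` is injective. On such a piece `A ↦ v_*(f(A))` is a measure, absolutely continuous by
property `N`, and its density is at most `J`: a Vitali covering by small balls gives `v_*(f(S)) ≤ q
v(S)` wherever `J < q` (`measure_image_le_of_jacobian_lt`). Hence `∫ g^p ≤ (1/m) ∫ (ρ/l)^p J`, and
`(ρ/l)^p J ≤ K ρ^p` pointwise.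

Length (`Curve.one_le_lineIntegral_of_lifts`). Let `α_1, …, α_m` be the lifts of subcurves of `β`,
all parametrized by the arc length of `β`. The function `L⁻¹` is absolutely continuous, and its
derivative is the metric speed of the lift, hence at most `1/l` almost everywhere
(`ae_ofReal_deriv_le_of_speed_le`). So `1 ≤ ∫_{α_j} ρ ds` is bounded by an integral of
`ρ(α_j)/l(α_j)` along `β` (`lintegral_naturalParameterization_lift_le`). When the points `α_j(t)`
are distinct they are at most `m` points of one fibre, and the power mean inequality gives `∑
ρ(α_j)/l(α_j) ≤ m g(β(t))`. Integrating and dividing by `m` yields the claim.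

Distinctness comes from the index. At a point with invertible derivative `i(x,f) = 1`, since the
degree is the sign of the derivative and `f` preserves sense (`hasLocalIndex_one`), and there `l >
0` too. The remaining points have an image of volume zero: nondifferentiability points by property
`N`, singular points by a theorem of Sard type (`riemVolume_image_compl_hasLocalIndex_one`). Curves
spending positive length in that null image are absorbed by a function infinite on it, and curves
violating `ACP_p⁻¹` by a function of energy below `ε`. -/

theorem eVariationOn_le_of_edist_le {E F : Type*} [PseudoEMetricSpace E] [PseudoEMetricSpace F]
    {f : ℝ → E} {g : ℝ → F} {s : Set ℝ}
    (h : ∀ x ∈ s, ∀ y ∈ s, x ≤ y → edist (f x) (f y) ≤ edist (g x) (g y)) :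
    eVariationOn f s ≤ eVariationOn g s := by
  refine iSup_le fun p ↦ ?_
  refine le_trans (Finset.sum_le_sum fun i _ ↦ ?_) (eVariationOn.sum_le p.2.2.1 p.2.2.2)
  rw [edist_comm, edist_comm (g _)]
  exact h _ (p.2.2.2 _) _ (p.2.2.2 _) (p.2.2.1 i.le_succ)

/-- For a continuous curve of bounded variation the variation over a one-sided interval shrinking to
`x` tends to zero; additivity of the variation turns this into continuity of the length function. -/
theorem continuousOn_variationOnFromTo {γ : ℝ → X} {a b : ℝ}
    (hγ : ContinuousOn γ (Icc a b)) (hbv : BoundedVariationOn γ (Icc a b)) :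
    ContinuousOn (variationOnFromTo γ (Icc a b) a) (Icc a b) := by
  intro x hx
  have hl := hbv.locallyBoundedVariationOn
  have ha : a ∈ Icc a b := ⟨le_rfl, hx.1.trans hx.2⟩
  have h1 := hbv.tendsto_eVariationOn_Icc_zero_left ((hγ x hx).mono (inter_subset_left (t := Iic x)))
  have h2 := hbv.tendsto_eVariationOn_Icc_zero_right x
    ((hγ x hx).mono (inter_subset_left (t := Ici x)))
  have h3 : Tendsto (fun y ↦ (eVariationOn γ (Icc a b ∩ Icc y x)).toReal +
      (eVariationOn γ (Icc a b ∩ Icc x y)).toReal) (𝓝[Icc a b] x) (𝓝 0) := by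
    have := ((ENNReal.tendsto_toReal ENNReal.zero_ne_top).comp h1).add
      ((ENNReal.tendsto_toReal ENNReal.zero_ne_top).comp h2)
    simpa using this
  rw [ContinuousWithinAt, tendsto_iff_dist_tendsto_zero]
  refine squeeze_zero' (Eventually.of_forall fun _ ↦ dist_nonneg) ?_ h3
  filter_upwards [self_mem_nhdsWithin] with y hy
  rw [Real.dist_eq]
  have hnn1 : 0 ≤ (eVariationOn γ (Icc a b ∩ Icc y x)).toReal := ENNReal.toReal_nonneg
  have hnn2 : 0 ≤ (eVariationOn γ (Icc a b ∩ Icc x y)).toReal := ENNReal.toReal_nonneg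
  rcases le_total x y with hxy | hyx
  · have := variationOnFromTo.add hl ha hx hy
    rw [variationOnFromTo.eq_of_le γ _ hxy] at this
    rw [abs_le]; constructor <;> linarith
  · have := variationOnFromTo.add hl ha hy hx
    rw [variationOnFromTo.eq_of_le γ _ hyx] at this
    rw [abs_le]; constructor <;> linarith

/-- For a curve `c` whose length function is the absolutely continuous function `Φ`, the
derivative of `Φ` is bounded almost everywhere by the upper metric speed of `c`. -/
theorem ae_ofReal_deriv_le_of_speed_le {c : ℝ → X} {Φ : ℝ → ℝ} {L : ℝ} (hL : 0 ≤ L)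
    (hmono : MonotoneOn Φ (Icc 0 L)) (hAC : AbsolutelyContinuousOnInterval Φ 0 L)
    (hlen : ∀ s ∈ Icc 0 L, ∀ s' ∈ Icc 0 L, s ≤ s' →
      eVariationOn c (Icc s s') = ENNReal.ofReal (Φ s' - Φ s))
    {κ : ℝ → ℝ≥0∞}
    (hκ : ∀ s ∈ Ioo 0 L, ∀ q : ℝ, κ s < ENNReal.ofReal q →
      ∀ᶠ s' in 𝓝 s, edist (c s) (c s') ≤ ENNReal.ofReal (q * |s' - s|)) :
    ∀ᵐ s, s ∈ Ioo 0 L → ENNReal.ofReal (deriv Φ s) ≤ κ s := by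
  have hd : ∀ s ∈ Icc 0 L, ∀ s' ∈ Icc 0 L, edist (c s) (c s') ≤ ENNReal.ofReal |Φ s' - Φ s| := by
    intro s hs s' hs'
    rcases le_total s s' with h | h
    · rw [abs_of_nonneg (sub_nonneg.2 (hmono hs hs' h)), ← hlen s hs s' hs' h]
      exact eVariationOn.edist_le _ ⟨le_rfl, h⟩ ⟨h, le_rfl⟩
    · rw [abs_of_nonpos (sub_nonpos.2 (hmono hs' hs h)), neg_sub, ← hlen s' hs' s hs h, edist_comm]
      exact eVariationOn.edist_le _ ⟨le_rfl, h⟩ ⟨h, le_rfl⟩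
  have hfin : ∀ s ∈ Icc 0 L, ∀ s' ∈ Icc 0 L, edist (c s) (c s') ≠ ⊤ := fun s hs s' hs' ↦
    ne_top_of_le_ne_top ENNReal.ofReal_ne_top (hd s hs s' hs')
  obtain ⟨u, hu, hudense⟩ : ∃ u : ℕ → ℝ, (∀ n, u n ∈ Icc 0 L) ∧ Icc 0 L ⊆ closure (range u) := by
    obtain ⟨t, ht, htc, htd⟩ :=
      (TopologicalSpace.IsSeparable.of_separableSpace (Icc 0 L)).exists_countable_dense_subset
    have hne : t.Nonempty := by
      by_contra h
      rw [not_nonempty_iff_eq_empty] at h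
      simp only [h, closure_empty, subset_empty_iff] at htd
      exact (nonempty_Icc.2 hL).ne_empty htd
    obtain ⟨u, rfl⟩ := htc.exists_eq_range hne
    exact ⟨u, fun n ↦ ht (mem_range_self n), htd⟩
  set φ : ℕ → ℝ → ℝ := fun n s ↦ (edist (c s) (c (u n))).toReal with hφ
  -- the distance functions to the points of a dense set determine the distance
  have hφd : ∀ n, ∀ s ∈ Icc 0 L, ∀ s' ∈ Icc 0 L,
      ENNReal.ofReal |φ n s' - φ n s| ≤ edist (c s) (c s') := by
    intro n s hs s' hs'
    rw [ENNReal.ofReal_le_iff_le_toReal (hfin s hs s' hs'), abs_le]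
    have h1 := ENNReal.toReal_mono (ENNReal.add_ne_top.2 ⟨hfin s' hs' s hs, hfin s hs _ (hu n)⟩)
      (edist_triangle (c s') (c s) (c (u n)))
    have h2 := ENNReal.toReal_mono (ENNReal.add_ne_top.2 ⟨hfin s hs s' hs', hfin s' hs' _ (hu n)⟩)
      (edist_triangle (c s) (c s') (c (u n)))
    rw [ENNReal.toReal_add (hfin _ hs' _ hs) (hfin _ hs _ (hu n)), edist_comm (c s') (c s)] at h1
    rw [ENNReal.toReal_add (hfin _ hs _ hs') (hfin _ hs' _ (hu n))] at h2
    constructor <;> simp only [hφ] <;> linarith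
  have huIcc : uIcc 0 L = Icc 0 L := uIcc_of_le hL
  have hφΦ : ∀ n, ∀ s ∈ Icc 0 L, ∀ s' ∈ Icc 0 L, |φ n s' - φ n s| ≤ |Φ s' - Φ s| := by
    intro n s hs s' hs'
    exact (ENNReal.ofReal_le_ofReal_iff (abs_nonneg _)).1 ((hφd n s hs s' hs').trans (hd s hs s' hs'))
  have hφAC : ∀ n, AbsolutelyContinuousOnInterval (φ n) 0 L := by
    intro n
    rw [absolutelyContinuousOnInterval_iff] at hAC ⊢
    intro ε hε
    obtain ⟨δ, hδ, H⟩ := hAC ε hε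
    refine ⟨δ, hδ, fun E hE hs ↦ lt_of_le_of_lt (Finset.sum_le_sum fun i hi ↦ ?_) (H E hE hs)⟩
    have := hE.1 i hi
    rw [huIcc] at this
    rw [Real.dist_eq, Real.dist_eq]
    exact hφΦ n _ this.2 _ this.1
  -- `m` plays the role of the metric derivative of `c`. Unlike `κ` it is known to be measurable; it
  -- lies below both `κ` and `Φ'` almost everywhere, and its primitive `ψ` will turn out to dominate
  -- the increments of `Φ`, so that `Φ' ≤ m ≤ κ`.
  set m : ℝ → ℝ≥0∞ := fun s ↦ ⨆ n, ENNReal.ofReal |deriv (φ n) s| with hm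
  have hmmeas : Measurable m :=
    Measurable.iSup fun n ↦ (measurable_deriv (φ n)).abs.ennreal_ofReal
  have hbound : ∀ n s (q : ℝ), s ∈ Ioo 0 L → DifferentiableAt ℝ (φ n) s →
      (∀ᶠ s' in 𝓝 s, |φ n s' - φ n s| ≤ q * |s' - s|) → |deriv (φ n) s| ≤ q := by
    intro n s q hs hdiff hev
    have := hdiff.hasDerivAt.tendsto_slope.abs
    refine le_of_tendsto this ?_
    filter_upwards [hev.filter_mono nhdsWithin_le_nhds, self_mem_nhdsWithin] with s' h1 h2
    rw [slope_def_field, abs_div, div_le_iff₀ (abs_pos.2 (sub_ne_zero.2 h2))]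
    exact h1
  have hmκ : ∀ᵐ s, s ∈ Ioo 0 L → m s ≤ κ s := by
    filter_upwards [ae_all_iff.2 fun n ↦ (hφAC n).ae_differentiableAt] with s hs hsI
    refine iSup_le fun n ↦ ?_
    refine le_of_forall_gt fun q' hq' ↦ ?_
    obtain ⟨q, hq1, hq2⟩ := ENNReal.lt_iff_exists_nnreal_btwn.1 hq'
    refine lt_of_le_of_lt ?_ hq2
    rw [← ENNReal.ofReal_coe_nnreal]
    apply ENNReal.ofReal_le_ofReal
    apply hbound n s q hsI (hs n (by rw [huIcc]; exact Ioo_subset_Icc_self hsI))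
    filter_upwards [hκ s hsI q (by rwa [ENNReal.ofReal_coe_nnreal]), Ioo_mem_nhds hsI.1 hsI.2]
      with s' h1 h2
    rw [← ENNReal.ofReal_le_ofReal_iff (by positivity)]
    exact (hφd n s (Ioo_subset_Icc_self hsI) s' (Ioo_subset_Icc_self h2)).trans h1
  have hmΦ : ∀ᵐ s, s ∈ Ioo 0 L → m s ≤ ENNReal.ofReal (deriv Φ s) := by
    filter_upwards [ae_all_iff.2 fun n ↦ (hφAC n).ae_differentiableAt, hAC.ae_differentiableAt]
      with s hs hsΦ hsI
    have hsI' : s ∈ uIcc 0 L := by rw [huIcc]; exact Ioo_subset_Icc_self hsI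
    refine iSup_le fun n ↦ ENNReal.ofReal_le_ofReal ?_
    have hΦs := (hsΦ hsI').hasDerivAt.tendsto_slope
    refine le_of_tendsto_of_tendsto (hs n hsI').hasDerivAt.tendsto_slope.abs hΦs ?_
    filter_upwards [nhdsWithin_le_nhds (Ioo_mem_nhds hsI.1 hsI.2), self_mem_nhdsWithin] with s' h1 h2
    rw [slope_def_field, slope_def_field, abs_div]
    have h3 := hφΦ n s (Ioo_subset_Icc_self hsI) s' (Ioo_subset_Icc_self h1)
    have h4 : 0 ≤ (Φ s' - Φ s) / (s' - s) := by
      rcases lt_or_gt_of_ne h2 with h | h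
      · exact div_nonneg_of_nonpos (sub_nonpos.2 (hmono (Ioo_subset_Icc_self h1)
          (Ioo_subset_Icc_self hsI) h.le)) (sub_nonpos.2 h.le)
      · exact div_nonneg (sub_nonneg.2 (hmono (Ioo_subset_Icc_self hsI)
          (Ioo_subset_Icc_self h1) h.le)) (sub_nonneg.2 h.le)
    rw [← abs_of_nonneg h4, abs_div]
    gcongr
  set mr : ℝ → ℝ := fun s ↦ (m s).toReal with hmr
  have hIoo : ∀ᵐ s : ℝ, s ∈ Ioc 0 L → s ∈ Ioo 0 L := by
    filter_upwards [Measure.ae_ne volume L] with s hs h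
    exact ⟨h.1, lt_of_le_of_ne h.2 hs⟩
  have hmrint : IntervalIntegrable mr volume 0 L := by
    refine hAC.intervalIntegrable_deriv.mono_fun hmmeas.ennreal_toReal.aestronglyMeasurable ?_
    rw [uIoc_of_le hL]
    refine (ae_restrict_iff' measurableSet_Ioc).2 ?_
    filter_upwards [hmΦ, hIoo] with s h1 h2 h3
    have := ENNReal.toReal_mono ENNReal.ofReal_ne_top (h1 (h2 h3))
    rw [Real.norm_of_nonneg ENNReal.toReal_nonneg]
    refine this.trans ?_
    rw [ENNReal.toReal_ofReal']
    exact max_le (le_abs_self _) (abs_nonneg _)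
  have hmint : ∀ s ∈ Icc 0 L, ∀ s' ∈ Icc 0 L, IntervalIntegrable mr volume s s' := fun s hs s' hs' ↦
    hmrint.mono_set (by rw [huIcc]; exact uIcc_subset_Icc hs hs')
  set ψ : ℝ → ℝ := fun s ↦ ∫ t in (0 : ℝ)..s, mr t with hψ
  have hψsub : ∀ s ∈ Icc 0 L, ∀ s' ∈ Icc 0 L, ψ s' - ψ s = ∫ t in s..s', mr t := by
    intro s hs s' hs'
    have h0 : (0 : ℝ) ∈ Icc 0 L := ⟨le_rfl, hL⟩
    exact intervalIntegral.integral_interval_sub_left (hmint 0 h0 s' hs') (hmint 0 h0 s hs)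
  have hψmono : MonotoneOn ψ (Icc 0 L) := by
    intro s hs s' hs' h
    rw [← sub_nonneg, hψsub s hs s' hs']
    exact intervalIntegral.integral_nonneg h fun _ _ ↦ ENNReal.toReal_nonneg
  have hφψ : ∀ n, ∀ s ∈ Icc 0 L, ∀ s' ∈ Icc 0 L, s ≤ s' → |φ n s' - φ n s| ≤ ψ s' - ψ s := by
    intro n s hs s' hs' h
    have hac : AbsolutelyContinuousOnInterval (φ n) s s' :=
      (hφAC n).mono (by rw [huIcc]; exact uIcc_subset_Icc hs hs')
    rw [← hac.integral_deriv_eq_sub, hψsub s hs s' hs', ← Real.norm_eq_abs]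
    refine intervalIntegral.norm_integral_le_of_norm_le h ?_ (hmint s hs s' hs')
    filter_upwards [hmΦ, hIoo] with t h1 h2 h3
    have ht : t ∈ Ioo 0 L := h2 ⟨hs.1.trans_lt h3.1, h3.2.trans hs'.2⟩
    rw [Real.norm_eq_abs, hmr]
    rw [← ENNReal.ofReal_le_iff_le_toReal
      (ne_top_of_le_ne_top ENNReal.ofReal_ne_top (h1 ht))]
    exact le_iSup (fun n ↦ ENNReal.ofReal |deriv (φ n) t|) n
  have hcψ : ∀ s ∈ Icc 0 L, ∀ s' ∈ Icc 0 L, s ≤ s' → edist (c s) (c s') ≤ edist (ψ s) (ψ s') := by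
    intro s hs s' hs' h
    rw [edist_comm (ψ s), edist_dist, Real.dist_eq,
      abs_of_nonneg (sub_nonneg.2 (hψmono hs hs' h)),
      ENNReal.le_ofReal_iff_toReal_le (hfin s hs s' hs') (sub_nonneg.2 (hψmono hs hs' h))]
    refine le_of_forall_pos_le_add fun ε hε ↦ ?_
    -- With `u n` close to `s'`, the number `φ n s'` is small and `φ n s` is close to the distance
    -- from `c s` to `c s'`; so a bound on increments of the `φ n` bounds this distance.
    have hΦc := hAC.continuousOn
    rw [huIcc] at hΦc
    obtain ⟨δ, hδ, H⟩ := Metric.continuousOn_iff.1 hΦc s' hs' (ε / 2) (by positivity)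
    obtain ⟨_, ⟨n, rfl⟩, hn⟩ := Metric.mem_closure_iff.1 (hudense hs') δ hδ
    have h1 := H (u n) (hu n) (by rwa [dist_comm])
    have h2 : φ n s' ≤ ε / 2 := by
      have := ENNReal.toReal_mono ENNReal.ofReal_ne_top (hd s' hs' (u n) (hu n))
      rw [ENNReal.toReal_ofReal (abs_nonneg _)] at this
      exact this.trans h1.le
    have h3 := ENNReal.toReal_mono (ENNReal.add_ne_top.2 ⟨hfin s hs _ (hu n), hfin _ (hu n) s' hs'⟩)
      (edist_triangle (c s) (c (u n)) (c s'))
    rw [ENNReal.toReal_add (hfin s hs _ (hu n)) (hfin _ (hu n) s' hs'), edist_comm (c (u n))] at h3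
    have h4 := (abs_le.1 (hφψ n s hs s' hs' h)).1
    simp only [hφ] at h2 h4
    linarith
  have hΦψ : ∀ s ∈ Icc 0 L, ∀ s' ∈ Icc 0 L, s ≤ s' → Φ s' - Φ s ≤ ψ s' - ψ s := by
    intro s hs s' hs' h
    have hsub : Icc s s' ⊆ Icc 0 L := Icc_subset_Icc hs.1 hs'.2
    rw [← ENNReal.ofReal_le_ofReal_iff (sub_nonneg.2 (hψmono hs hs' h)), ← hlen s hs s' hs' h]
    -- The left side is the increment of `Φ`; the variation of the monotone function `ψ` is its own
    -- increment.
    calc eVariationOn c (Icc s s') ≤ eVariationOn ψ (Icc s s') :=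
          eVariationOn_le_of_edist_le fun x hx y hy ↦ hcψ x (hsub hx) y (hsub hy)
      _ ≤ _ := by
          have := (hψmono.mono hsub).eVariationOn_eq (a := s) (b := s') ⟨le_rfl, h⟩ ⟨h, le_rfl⟩
          rw [inter_self] at this
          exact this.le
  filter_upwards [hmκ, hmΦ, hAC.ae_differentiableAt, hmrint.ae_hasDerivAt_integral]
    with s h1 h2 h3 h4 hsI
  have hsI' : s ∈ uIcc 0 L := by rw [huIcc]; exact Ioo_subset_Icc_self hsI
  refine le_trans ?_ (h1 hsI)
  rw [ENNReal.ofReal_le_iff_le_toReal (ne_top_of_le_ne_top ENNReal.ofReal_ne_top (h2 hsI))]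
  refine le_of_tendsto_of_tendsto (h3 hsI').hasDerivAt.tendsto_slope
    (h4 hsI' 0 left_mem_uIcc).tendsto_slope ?_
  filter_upwards [nhdsWithin_le_nhds (Ioo_mem_nhds hsI.1 hsI.2), self_mem_nhdsWithin] with s' h5 h6
  rw [slope_def_field, slope_def_field]
  have hs1 := Ioo_subset_Icc_self hsI
  have hs2 := Ioo_subset_Icc_self h5
  rcases lt_or_gt_of_ne h6 with h | h
  · have := hΦψ s' hs2 s hs1 h.le
    exact (div_le_div_right_of_neg (sub_neg.2 h)).2 (by simp only [hψ] at this; linarith)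
  · exact div_le_div_of_nonneg_right (hΦψ s hs1 s' hs2 h.le) (sub_nonneg.2 h.le)

/-- One half of the change of variables formula for absolutely continuous monotone functions. -/
theorem lintegral_Icc_le_lintegral_of_absolutelyContinuous {Φ : ℝ → ℝ} {L : ℝ} (hL : 0 ≤ L)
    (hmono : MonotoneOn Φ (Icc 0 L)) (hAC : AbsolutelyContinuousOnInterval Φ 0 L)
    (h : ℝ → ℝ≥0∞) :
    ∫⁻ x in Icc (Φ 0) (Φ L), h x ≤ ∫⁻ s in Ioo 0 L, ENNReal.ofReal (deriv Φ s) * h (Φ s) := by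
  have huIcc : uIcc 0 L = Icc 0 L := uIcc_of_le hL
  set S : Set ℝ := {s ∈ Ioo 0 L | DifferentiableAt ℝ Φ s} with hS
  have hSm : MeasurableSet S := measurableSet_Ioo.inter (measurableSet_of_differentiableAt ℝ Φ)
  have hSI : S ⊆ Icc 0 L := fun s hs ↦ Ioo_subset_Icc_self hs.1
  have hder : ∀ s ∈ S, HasDerivWithinAt Φ (deriv Φ s) S s := fun s hs ↦
    hs.2.hasDerivAt.hasDerivWithinAt
  have key := fun h : ℝ → ℝ≥0∞ ↦
    lintegral_image_eq_lintegral_deriv_mul_of_monotoneOn hSm hder (hmono.mono hSI) h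
  have hSae : S =ᵐ[volume] Ioc 0 L := by
    refine (LE.le.eventuallyLE (show S ⊆ Ioc 0 L from fun s hs ↦ ⟨hs.1.1, hs.1.2.le⟩)).antisymm ?_
    filter_upwards [hAC.ae_differentiableAt, Measure.ae_ne volume L] with s h1 h2 h3
    exact ⟨⟨h3.1, lt_of_le_of_ne h3.2 h2⟩, h1 (by rw [huIcc]; exact Ioc_subset_Icc_self h3)⟩
  have hpos : ∀ s ∈ Ioo 0 L, 0 ≤ deriv Φ s := fun s hs ↦ by
    have : MonotoneOn Φ (Ioo 0 L) := hmono.mono Ioo_subset_Icc_self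
    rw [← derivWithin_of_isOpen isOpen_Ioo hs]
    exact this.derivWithin_nonneg
  -- Change of variables is exact on the set `S` of differentiability. Absolute continuity enters
  -- here: `∫ Φ' = Φ L - Φ 0` shows that `Φ '' S` fills the whole image interval up to a null set.
  have hvol : volume (Φ '' S) = ENNReal.ofReal (Φ L - Φ 0) := by
    have h1 := key 1
    simp only [Pi.one_apply, lintegral_one, Measure.restrict_apply_univ, mul_one] at h1
    rw [h1, setLIntegral_congr hSae, ← hAC.integral_deriv_eq_sub,
      intervalIntegral.integral_of_le hL, ofReal_integral_eq_lintegral_ofReal]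
    · exact (intervalIntegrable_iff_integrableOn_Ioc_of_le hL).1 hAC.intervalIntegrable_deriv
    · refine (ae_restrict_iff' measurableSet_Ioc).2 ?_
      filter_upwards [Measure.ae_ne volume L] with s h2 h3
      exact hpos s ⟨h3.1, lt_of_le_of_ne h3.2 h2⟩
  have h0 : (0 : ℝ) ∈ Icc 0 L := ⟨le_rfl, hL⟩
  have hL' : L ∈ Icc 0 L := ⟨hL, le_rfl⟩
  have himm : MeasurableSet (Φ '' S) := hSm.image_of_monotoneOn (hmono.mono hSI)
  have himsub : Φ '' S ⊆ Icc (Φ 0) (Φ L) := by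
    rintro _ ⟨s, hs, rfl⟩
    exact ⟨hmono h0 (hSI hs) (hSI hs).1, hmono (hSI hs) hL' (hSI hs).2⟩
  have hae : Φ '' S =ᵐ[volume] Icc (Φ 0) (Φ L) := by
    refine ae_eq_of_subset_of_measure_ge himsub ?_ himm.nullMeasurableSet ?_
    · rw [hvol, Real.volume_Icc]
    · rw [Real.volume_Icc]; exact ENNReal.ofReal_ne_top
  rw [← setLIntegral_congr hae, key h]
  exact lintegral_mono_set fun s hs ↦ hs.1

end ArcLength


/-! ### Line integrals along a single lift. -/

section Lifts

variable {X Y : Type*} [EMetricSpace X] [EMetricSpace Y]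

theorem variationOnFromTo_congr_set (γ : ℝ → X) {s s' : Set ℝ} (hs : s.OrdConnected)
    (hs' : s'.OrdConnected) {a b : ℝ} (ha : a ∈ s) (hb : b ∈ s) (ha' : a ∈ s') (hb' : b ∈ s') :
    variationOnFromTo γ s a b = variationOnFromTo γ s' a b := by
  simp only [variationOnFromTo, inter_eq_right.2 (hs.out ha hb), inter_eq_right.2 (hs.out hb ha),
    inter_eq_right.2 (hs'.out ha' hb'), inter_eq_right.2 (hs'.out hb' ha')]

theorem eVariationOn_Icc_eq_ofReal_variationOnFromTo_sub {γ : ℝ → X} {s : Set ℝ}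
    (hs : s.OrdConnected) (hγ : LocallyBoundedVariationOn γ s) {a t t' : ℝ} (ha : a ∈ s)
    (ht : t ∈ s) (ht' : t' ∈ s) (h : t ≤ t') :
    eVariationOn γ (Icc t t') =
      ENNReal.ofReal (variationOnFromTo γ s a t' - variationOnFromTo γ s a t) := by
  rw [variationOnFromTo.sub_right hγ ha ht' ht, variationOnFromTo.eq_of_le _ _ h,
    ENNReal.ofReal_toReal (hγ t t' ht ht'), inter_eq_right.2 (hs.out ht ht')]

theorem _root_.IsPreconnected.subsingleton_of_isDiscrete {Z : Type*} [TopologicalSpace Z]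
    {s t : Set Z} (hs : IsPreconnected s) (ht : IsDiscrete t) (h : s ⊆ t) : s.Subsingleton := by
  have := (ht.mono h).to_subtype
  have := isPreconnected_iff_preconnectedSpace.1 hs
  have : Subsingleton s := PreconnectedSpace.trivial_of_discrete
  exact subsingleton_coe s |>.1 this

theorem locallyBoundedVariationOn_mono {γ : ℝ → X} {s t : Set ℝ}
    (h : LocallyBoundedVariationOn γ s) (hts : t ⊆ s) : LocallyBoundedVariationOn γ t :=
  fun a b ha hb ↦ (h a b (hts ha) (hts hb)).mono (inter_subset_inter_left _ hts)

/-- A lift under a discrete map is constant where the lifted curve is constant. -/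
theorem Curve.eq_of_variationOnFromTo_eq {f : X → Y} {D : Set X} (hdisc : IsDiscreteMapOn f D)
    {α : Curve X} {β : Curve Y} (hD : α.LiesIn D) (hl : α.LiftsSubcurve f β) {s : Set ℝ}
    (hs : s.OrdConnected) (hβ : LocallyBoundedVariationOn β s) {a t t' : ℝ} (ha : a ∈ s)
    (ht : t ∈ s) (ht' : t' ∈ s) (hta : t ∈ α.dom) (hta' : t' ∈ α.dom)
    (h : variationOnFromTo β s a t = variationOnFromTo β s a t') :
    (α '' uIcc t t').Subsingleton := by
  rw [variationOnFromTo.eq_left_iff hβ ha ht ht', variationOnFromTo.eq_zero_iff hβ ht ht'] at h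
  have hsub : uIcc t t' ⊆ α.dom := α.ordConnected_dom.uIcc_subset hta hta'
  have hsub' : uIcc t t' ⊆ s := hs.uIcc_subset ht ht'
  refine IsPreconnected.subsingleton_of_isDiscrete
    (isPreconnected_uIcc.image _ (α.continuousOn_toFun.mono hsub)) (hdisc (β t)) ?_
  rintro _ ⟨r, hr, rfl⟩
  refine ⟨hD r (hsub hr), ?_⟩
  rw [mem_preimage, hl.2 r (hsub hr), mem_singleton_iff]
  exact edist_eq_zero.1 (h ⟨hsub' hr, hr⟩ ⟨ht, left_mem_uIcc⟩)

/-- The restriction of a curve to a subinterval. -/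
def Curve.restrict (β : Curve Y) (s : Set ℝ) (hs : s.OrdConnected) (hne : s.Nonempty)
    (h : s ⊆ β.dom) : Curve Y where
  toFun := β
  dom := s
  ordConnected_dom := hs
  nonempty_dom := hne
  isBounded_dom := β.isBounded_dom.subset h
  continuousOn_toFun := β.continuousOn_toFun.mono h

/-- Every `q > 1/l(x,f)` acts as a local Lipschitz constant at `f x` for a branch of the inverse.
Points at infinite distance from `x` have quotient zero, so they are excluded near `x`. -/
theorem tendsto_edist_of_speed {f : X → Y} {x : X} {q : ℝ}
    (hq : (minStretch f x)⁻¹ < ENNReal.ofReal q) :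
    ∀ᶠ y in 𝓝 x, edist x y ≤ ENNReal.ofReal q * edist (f x) (f y) := by
  have h1 : (ENNReal.ofReal q)⁻¹ < minStretch f x := ENNReal.inv_lt_iff_inv_lt.1 hq
  have h2 := eventually_lt_of_lt_liminf h1
  rw [eventually_nhdsWithin_iff] at h2
  filter_upwards [h2] with y hy
  by_cases hxy : y = x
  · simp [hxy]
  have h3 := (hy hxy).le
  have hq0 : ENNReal.ofReal q ≠ 0 := (zero_le.trans_lt hq).ne'
  have he0 : edist x y ≠ 0 := fun h ↦ hxy (edist_eq_zero.1 h).symm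
  by_cases hetop : edist x y = ⊤
  · rw [hetop, ENNReal.div_top] at h3
    simp at h3
  rw [ENNReal.le_div_iff_mul_le (Or.inl he0) (Or.inl hetop)] at h3
  calc edist x y = ENNReal.ofReal q * ((ENNReal.ofReal q)⁻¹ * edist x y) := by
        rw [← mul_assoc, ENNReal.mul_inv_cancel hq0 ENNReal.ofReal_ne_top, one_mul]
    _ ≤ _ := by gcongr

/-- The line integral over a closed subcurve of a lift is bounded by an integral over the lifted
curve, both parametrized by the arc length of the lifted curve. -/
theorem lintegral_naturalParameterization_lift_le {f : X → Y} {D : Set X}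
    (hdisc : IsDiscreteMapOn f D) {α : Curve X} {β : Curve Y} (hD : α.LiesIn D)
    (hl : α.LiftsSubcurve f β) (hβ : β.LocallyRectifiable)
    (hAC : HasACLifts f D (β.restrict α.dom α.ordConnected_dom α.nonempty_dom hl.1))
    (ρ : X → ℝ≥0∞) {a b A B : ℝ} (ha : a ∈ α.dom) (hb : b ∈ α.dom) (hab : a ≤ b)
    (hA : A ∈ β.dom) (hB : B ∈ β.dom) (hAa : A ≤ a) (hbB : b ≤ B) :
    ∫⁻ σ in Icc 0 (eVariationOn α (Icc a b)).toReal, ρ (naturalParameterization α (Icc a b) a σ) ≤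
      ∫⁻ s in Ioo (variationOnFromTo β (Icc A B) A a) (variationOnFromTo β (Icc A B) A b),
        (minStretch f (α (@invFunOn _ _ ⟨A⟩ (variationOnFromTo β (Icc A B) A) (Icc A B) s)))⁻¹ *
        ρ (α (@invFunOn _ _ ⟨A⟩ (variationOnFromTo β (Icc A B) A) (Icc A B) s)) := by
  obtain ⟨hαrect, hΦAC⟩ := hAC α hD ⟨rfl, hl.2⟩
  have hIα : Icc a b ⊆ α.dom := α.ordConnected_dom.out ha hb
  have hIβ : Icc a b ⊆ β.dom := hIα.trans hl.1
  have haI : a ∈ Icc a b := ⟨le_rfl, hab⟩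
  have hbI : b ∈ Icc a b := ⟨hab, le_rfl⟩
  have hABβ : Icc A B ⊆ β.dom := β.ordConnected_dom.out hA hB
  have habAB : Icc a b ⊆ Icc A B := Icc_subset_Icc hAa hbB
  have hβI : LocallyBoundedVariationOn β (Icc a b) := locallyBoundedVariationOn_mono hβ hIβ
  have hβd : LocallyBoundedVariationOn β α.dom := locallyBoundedVariationOn_mono hβ hl.1
  have hβAB : LocallyBoundedVariationOn β (Icc A B) := locallyBoundedVariationOn_mono hβ hABβ
  have hαI : LocallyBoundedVariationOn α (Icc a b) := locallyBoundedVariationOn_mono hαrect hIα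
  have hbvβ : BoundedVariationOn β (Icc a b) := by
    simpa only [BoundedVariationOn, inter_self] using hβI a b haI hbI
  set v : ℝ → ℝ := variationOnFromTo β (Icc a b) a with hv
  set w : ℝ → ℝ := variationOnFromTo α (Icc a b) a with hw
  set u : ℝ → ℝ := variationOnFromTo β (Icc A B) A with hu
  set L : ℝ := v b with hLdef
  have hvmono : MonotoneOn v (Icc a b) := variationOnFromTo.monotoneOn hβI haI
  have hwmono : MonotoneOn w (Icc a b) := variationOnFromTo.monotoneOn hαI haI
  have hva : v a = 0 := variationOnFromTo.self _ _ _
  have hwa : w a = 0 := variationOnFromTo.self _ _ _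
  have hL : 0 ≤ L := hva ▸ hvmono haI hbI hab
  have hvcont : ContinuousOn v (Icc a b) :=
    continuousOn_variationOnFromTo (β.continuousOn_toFun.mono hIβ) hbvβ
  have hvim : v '' Icc a b = Icc 0 L := by
    rw [hvcont.image_Icc hab, hvmono.sInf_image_Icc hab, hvmono.sSup_image_Icc hab, hva]
  have hvmem : ∀ t ∈ Icc a b, v t ∈ Icc 0 L := fun t ht ↦ hvim ▸ mem_image_of_mem v ht
  set τ : ℝ → ℝ := @invFunOn _ _ ⟨a⟩ v (Icc a b) with hτ
  have hτmem : ∀ s ∈ Icc 0 L, τ s ∈ Icc a b ∧ v (τ s) = s := by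
    intro s hs
    rw [← hvim] at hs
    exact ⟨invFunOn_mem hs, invFunOn_eq hs⟩
  set c : ℝ → X := fun s ↦ α (τ s) with hc
  have hcv : ∀ t ∈ Icc a b, c (v t) = α t := by
    intro t ht
    obtain ⟨h1, h2⟩ := hτmem (v t) (hvmem t ht)
    exact Curve.eq_of_variationOnFromTo_eq hdisc hD hl ordConnected_Icc hβI haI h1 ht (hIα h1)
      (hIα ht) h2 (mem_image_of_mem _ left_mem_uIcc) (mem_image_of_mem _ right_mem_uIcc)
  set β' := β.restrict α.dom α.ordConnected_dom α.nonempty_dom hl.1 with hβ'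
  set Φ : ℝ → ℝ := inverseLengthMap α β' a with hΦ
  have hβ'len : ∀ t ∈ Icc a b, β'.lengthFrom a t = v t := fun t ht ↦
    variationOnFromTo_congr_set _ α.ordConnected_dom ordConnected_Icc ha (hIα ht) haI ht
  -- The parameter chosen inside `inverseLengthMap` may differ from `t`, but `α` is constant between
  -- the two, so the lengths of `α` agree.
  have hΦv : ∀ t ∈ Icc a b, Φ (v t) = w t := by
    intro t ht
    have hmem : v t ∈ β'.lengthFrom a '' α.dom := ⟨t, hIα ht, hβ'len t ht⟩
    have h1 := invFunOn_mem hmem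
    have h2 := invFunOn_eq hmem
    have hsub : (α '' uIcc _ t).Subsingleton :=
      Curve.eq_of_variationOnFromTo_eq hdisc hD hl α.ordConnected_dom hβd ha h1
      (hIα ht) h1 (hIα ht) (h2.trans (hβ'len t ht).symm)
    have h3 : w t = variationOnFromTo α α.dom a t :=
      (variationOnFromTo_congr_set _ α.ordConnected_dom ordConnected_Icc ha (hIα ht) haI ht).symm
    rw [h3]
    change variationOnFromTo α α.dom a (invFunOn (β'.lengthFrom a) α.dom (v t)) = _
    rw [variationOnFromTo.eq_left_iff hαrect ha h1 (hIα ht),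
      variationOnFromTo.eq_zero_iff hαrect h1 (hIα ht)]
    intro x hx y hy
    rw [edist_eq_zero]
    exact hsub (mem_image_of_mem _ hx.2) (mem_image_of_mem _ hy.2)
  have hΦmono : MonotoneOn Φ (Icc 0 L) := by
    intro s hs s' hs' hss
    rw [← (hτmem s hs).2, ← (hτmem s' hs').2] at hss ⊢
    rw [hΦv _ (hτmem s hs).1, hΦv _ (hτmem s' hs').1]
    rcases le_total (τ s) (τ s') with h | h
    · exact hwmono (hτmem s hs).1 (hτmem s' hs').1 h
    · have h1 := le_antisymm hss (hvmono (hτmem s' hs').1 (hτmem s hs).1 h)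
      rw [← hΦv _ (hτmem s hs).1, ← hΦv _ (hτmem s' hs').1, h1]
  have hAC' : AbsolutelyContinuousOnInterval Φ 0 L := by
    refine hΦAC a ha 0 L hL ?_
    rw [← hvim]
    rintro _ ⟨t, ht, rfl⟩
    exact ⟨t, hIα ht, hβ'len t ht⟩
  -- Variation is invariant under monotone reparametrization, and `c ∘ v = α` on the interval.
  have hlen : ∀ s ∈ Icc 0 L, ∀ s' ∈ Icc 0 L, s ≤ s' →
      eVariationOn c (Icc s s') = ENNReal.ofReal (Φ s' - Φ s) := by
    intro s hs s' hs' hss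
    rcases hss.eq_or_lt with rfl | hlt
    · simp [eVariationOn.subsingleton]
    obtain ⟨h1, h2⟩ := hτmem s hs
    obtain ⟨h3, h4⟩ := hτmem s' hs'
    have hττ : τ s ≤ τ s' := by
      by_contra h
      have := hvmono h3 h1 (not_le.1 h).le
      rw [h2, h4] at this
      exact absurd this (not_le.2 hlt)
    have h5 := eVariationOn.comp_inter_Icc_eq_of_monotoneOn c v hvmono h1 h3
    rw [hvim, h2, h4, inter_eq_right.2 (Icc_subset_Icc hs.1 hs'.2),
      inter_eq_right.2 (Icc_subset_Icc h1.1 h3.2)] at h5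
    rw [← h5]
    have h6 : eVariationOn (c ∘ v) (Icc (τ s) (τ s')) = eVariationOn α (Icc (τ s) (τ s')) :=
      eVariationOn.congr fun t ht ↦ hcv t (Icc_subset_Icc h1.1 h3.2 ht)
    rw [h6, eVariationOn_Icc_eq_ofReal_variationOnFromTo_sub ordConnected_Icc hαI haI h1 h3 hττ]
    change ENNReal.ofReal (w _ - w _) = _
    rw [← hΦv _ h1, ← hΦv _ h3, h2, h4]
  have hΦcont : ContinuousOn Φ (Icc 0 L) := by
    have := hAC'.continuousOn
    rwa [uIcc_of_le hL] at this
  have hccont : ∀ s ∈ Ioo 0 L, ContinuousAt c s := by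
    intro s hs
    have hs' := Ioo_subset_Icc_self hs
    rw [ContinuousAt, tendsto_iff_edist_tendsto_0]
    have h1 : Tendsto (fun s' ↦ ENNReal.ofReal |Φ s' - Φ s|) (𝓝 s) (𝓝 0) := by
      have h2 : ContinuousAt Φ s := hΦcont.continuousAt (Icc_mem_nhds hs.1 hs.2)
      have h3 : Tendsto (fun s' ↦ |Φ s' - Φ s|) (𝓝 s) (𝓝 |Φ s - Φ s|) :=
        (h2.tendsto.sub_const _).abs
      simpa using ENNReal.tendsto_ofReal h3
    refine tendsto_of_tendsto_of_tendsto_of_le_of_le' tendsto_const_nhds h1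
      (Eventually.of_forall fun _ ↦ zero_le) ?_
    filter_upwards [Icc_mem_nhds hs.1 hs.2] with r hr
    rcases le_total r s with h | h
    · rw [abs_of_nonpos (sub_nonpos.2 (hΦmono hr hs' h)), neg_sub, ← hlen r hr s hs' h]
      exact eVariationOn.edist_le _ ⟨le_rfl, h⟩ ⟨h, le_rfl⟩
    · rw [abs_of_nonneg (sub_nonneg.2 (hΦmono hs' hr h)), ← hlen s hs' r hr h]
      exact eVariationOn.edist_le _ ⟨h, le_rfl⟩ ⟨le_rfl, h⟩
  have hfc : ∀ s ∈ Icc 0 L, ∀ s' ∈ Icc 0 L,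
      edist (f (c s)) (f (c s')) ≤ ENNReal.ofReal |s' - s| := by
    have key : ∀ s ∈ Icc 0 L, ∀ s' ∈ Icc 0 L, τ s ≤ τ s' →
        edist (f (c s)) (f (c s')) ≤ ENNReal.ofReal |s' - s| := by
      intro s hs s' hs' h
      obtain ⟨h1, h2⟩ := hτmem s hs
      obtain ⟨h3, h4⟩ := hτmem s' hs'
      rw [hc, hl.2 _ (hIα h1), hl.2 _ (hIα h3)]
      refine (eVariationOn.edist_le (s := Icc (τ s) (τ s')) _ ⟨le_rfl, h⟩ ⟨h, le_rfl⟩).trans ?_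
      rw [eVariationOn_Icc_eq_ofReal_variationOnFromTo_sub ordConnected_Icc hβI haI h1 h3 h]
      change ENNReal.ofReal (v _ - v _) ≤ _
      rw [h2, h4]
      exact ENNReal.ofReal_le_ofReal (le_abs_self _)
    intro s hs s' hs'
    rcases le_total (τ s) (τ s') with h | h
    · exact key s hs s' hs' h
    · rw [edist_comm, abs_sub_comm]
      exact key s' hs' s hs h
  -- Since `f ∘ c` is 1-Lipschitz, the speed of `c` is at most `1/l(c s, f)`.
  have hspeed := ae_ofReal_deriv_le_of_speed_le hL hΦmono hAC' hlen
    (κ := fun s ↦ (minStretch f (c s))⁻¹) (by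
      intro s hs q hq
      filter_upwards [(hccont s hs).eventually (tendsto_edist_of_speed hq),
        Icc_mem_nhds hs.1 hs.2] with r h1 h2
      refine h1.trans ?_
      have hq0 : 0 ≤ q := by
        by_contra h
        rw [ENNReal.ofReal_of_nonpos (not_le.1 h).le] at hq
        exact not_lt_zero hq
      rw [ENNReal.ofReal_mul hq0]
      gcongr
      exact hfc s (Ioo_subset_Icc_self hs) r h2)
  have hΦ0 : Φ 0 = 0 := by rw [← hva, hΦv a haI, hwa, hva]
  have hΦL : Φ L = (eVariationOn α (Icc a b)).toReal := by
    rw [hLdef, hΦv b hbI, hw, variationOnFromTo.eq_of_le _ _ hab, inter_self]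
  -- Passing from base point `a` to base point `A` is a translation of the arc length; it lets lifts
  -- over different subintervals share one parameter.
  have huv : ∀ t ∈ Icc a b, u t = v t + u a := by
    intro t ht
    have h1 : v t = variationOnFromTo β (Icc A B) a t :=
      variationOnFromTo_congr_set _ ordConnected_Icc ordConnected_Icc haI ht (habAB haI) (habAB ht)
    rw [h1, add_comm]
    exact (variationOnFromTo.add hβAB ⟨le_rfl, hAa.trans (hab.trans hbB)⟩ (habAB haI)
      (habAB ht)).symm
  have humono : MonotoneOn u (Icc A B) :=
    variationOnFromTo.monotoneOn hβAB ⟨le_rfl, hAa.trans (hab.trans hbB)⟩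
  calc _ = ∫⁻ σ in Icc (Φ 0) (Φ L), ρ (naturalParameterization α (Icc a b) a σ) := by
        rw [hΦ0, hΦL]
    _ ≤ ∫⁻ s in Ioo 0 L, ENNReal.ofReal (deriv Φ s) *
          ρ (naturalParameterization α (Icc a b) a (Φ s)) :=
        lintegral_Icc_le_lintegral_of_absolutelyContinuous hL hΦmono hAC' _
    _ ≤ ∫⁻ s in Ioo 0 L, (minStretch f (c s))⁻¹ * ρ (c s) := by
        refine lintegral_mono_ae ((ae_restrict_iff' measurableSet_Ioo).2 ?_)
        filter_upwards [hspeed] with s h1 hs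
        obtain ⟨h2, h3⟩ := hτmem s (Ioo_subset_Icc_self hs)
        have h4 : naturalParameterization α (Icc a b) a (Φ s) = c s := by
          rw [← h3, hΦv _ h2, hcv _ h2]
          exact edist_eq_zero.1 (edist_naturalParameterization_eq_zero hαI haI h2)
        rw [h4]
        gcongr
        exact h1 hs
    _ = ∫⁻ s in Ioo (u a) (u b), (minStretch f (c (s - u a)))⁻¹ * ρ (c (s - u a)) := by
        have hpre : (fun s : ℝ ↦ s - u a) ⁻¹' Ioo 0 L = Ioo (u a) (u b) := by
          rw [huv b hbI]
          ext s
          simp only [mem_preimage, mem_Ioo, sub_pos, sub_lt_iff_lt_add, hLdef]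
        rw [← hpre]
        exact ((measurePreserving_sub_right volume (u a)).setLIntegral_comp_preimage_emb
          (MeasurableEquiv.subRight (u a)).measurableEmbedding _ _).symm
    _ = _ := by
        refine setLIntegral_congr_fun measurableSet_Ioo fun s hs ↦ ?_
        have hmem : s ∈ u '' Icc A B := by
          have h1 : s - u a ∈ Icc 0 L := by
            rw [huv b hbI] at hs
            exact ⟨by linarith [hs.1], by linarith [hs.2]⟩
          obtain ⟨h2, h3⟩ := hτmem _ h1
          exact ⟨_, habAB h2, by rw [huv _ h2, h3]; ring⟩
        have h1 := invFunOn_mem hmem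
        have h2 := invFunOn_eq hmem
        set r := @invFunOn _ _ ⟨A⟩ u (Icc A B) s with hr
        have hrI : r ∈ Icc a b := by
          constructor
          · by_contra h
            have := humono h1 (habAB haI) (not_le.1 h).le
            rw [h2] at this
            exact absurd hs.1 (not_lt.2 this)
          · by_contra h
            have := humono (habAB hbI) h1 (not_le.1 h).le
            rw [h2] at this
            exact absurd hs.2 (not_lt.2 this)
        have h3 : s - u a = v r := by rw [← h2, huv r hrI]; ring
        simp only [h3, hcv r hrI]

end Lifts


/-! ### Summation over the lifts. -/

section LiftFamilies

variable {X Y : Type*} [EMetricSpace X] [EMetricSpace Y]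

theorem Curve.lineIntegral_restrict_le (β : Curve Y) (s : Set ℝ) (hs : s.OrdConnected)
    (hne : s.Nonempty) (h : s ⊆ β.dom) (ρ : Y → ℝ≥0∞) :
    (β.restrict s hs hne h).lineIntegral ρ ≤ β.lineIntegral ρ := by
  refine iSup₂_le fun a ha ↦ iSup₂_le fun b hb ↦ iSup_le fun hab ↦ ?_
  exact le_iSup₂_of_le a (h ha) (le_iSup₂_of_le b (h hb) (le_iSup_of_le hab le_rfl))

theorem Curve.lineIntegral_mono {β : Curve Y} {ρ ρ' : Y → ℝ≥0∞} (h : ρ ≤ ρ') :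
    β.lineIntegral ρ ≤ β.lineIntegral ρ' := by
  unfold Curve.lineIntegral
  gcongr
  exact h _

/-- The lower integral is superadditive without measurability, which spares any such discussion for
the integrands along lifts. -/
theorem sum_lintegral_le_lintegral_sum {Ω ι : Type*} [MeasurableSpace Ω] (μ : Measure Ω)
    (s : Finset ι) (F : ι → Ω → ℝ≥0∞) :
    ∑ i ∈ s, ∫⁻ x, F i x ∂μ ≤ ∫⁻ x, ∑ i ∈ s, F i x ∂μ := by
  classical
  induction s using Finset.induction_on with
  | empty => simp
  | insert i s hi ih =>
    simp only [Finset.sum_insert hi]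
    exact (add_le_add_right ih _).trans (le_lintegral_add _ _)

/-- A family of `m` lifts of subcurves of `β`, each of which has `ρ`-length at least one, forces
the `g`-length of `β` to be at least one if `g` dominates the mean of the functions
`ρ / l( · , f)` over the lifts. -/
theorem Curve.one_le_lineIntegral_of_lifts {f : X → Y} {D : Set X} (hdisc : IsDiscreteMapOn f D)
    {m : ℕ} (hm : 1 ≤ m) {α : Fin m → Curve X} {β : Curve Y} (hD : ∀ j, (α j).LiesIn D)
    (hl : ∀ j, (α j).LiftsSubcurve f β) (hβ : β.LocallyRectifiable)
    (hAC : ∀ j, HasACLifts f D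
      (β.restrict (α j).dom (α j).ordConnected_dom (α j).nonempty_dom (hl j).1))
    {ρ : X → ℝ≥0∞} (hρ : ∀ j, 1 ≤ (α j).lineIntegral ρ) {g : Y → ℝ≥0∞} {Z : Set Y}
    (hZ : ∀ a ∈ β.dom, ∀ b ∈ β.dom, a ≤ b →
      ∀ᵐ s, s ∈ Icc 0 (eVariationOn β (Icc a b)).toReal →
        naturalParameterization β (Icc a b) a s ∉ Z)
    (hg : ∀ t ∈ β.dom, β t ∉ Z → ∀ J : Finset (Fin m), (∀ j ∈ J, t ∈ (α j).dom) →
      ∑ j ∈ J, (minStretch f (α j t))⁻¹ * ρ (α j t) ≤ m * g (β t)) :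
    1 ≤ β.lineIntegral g := by
  refine le_of_forall_lt fun c hc ↦ ?_
  obtain ⟨c', hcc', hc'⟩ := exists_between hc
  refine hcc'.trans_le ?_
  -- The line integral is a supremum over closed subcurves, so any `c' < 1` is exceeded on some
  -- closed subcurve of each lift.
  have hex : ∀ j, ∃ a b, a ∈ (α j).dom ∧ b ∈ (α j).dom ∧ a ≤ b ∧
      c' < ∫⁻ s in Icc 0 (eVariationOn (α j) (Icc a b)).toReal,
        ρ (naturalParameterization (α j) (Icc a b) a s) := by
    intro j
    have := hc'.trans_le (hρ j)
    simp only [Curve.lineIntegral, lt_iSup_iff] at this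
    obtain ⟨a, ha, b, hb, hab, h⟩ := this
    exact ⟨a, b, ha, hb, hab, h⟩
  choose a b ha hb hab hint using hex
  have : Nonempty (Fin m) := ⟨⟨0, hm⟩⟩
  -- `[A, B]` is the hull of the finitely many intervals `[a j, b j]`; the arc length of `β` on it
  -- is the common parameter.
  obtain ⟨jA, hjA⟩ := Finite.exists_min a
  obtain ⟨jB, hjB⟩ := Finite.exists_max b
  set A := a jA with hAdef
  set B := b jB with hBdef
  have hA : A ∈ β.dom := (hl jA).1 (ha jA)
  have hB : B ∈ β.dom := (hl jB).1 (hb jB)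
  have hAB : A ≤ B := (hab jA).trans (hjB jA)
  have hABβ : Icc A B ⊆ β.dom := β.ordConnected_dom.out hA hB
  have hβAB : LocallyBoundedVariationOn β (Icc A B) := locallyBoundedVariationOn_mono hβ hABβ
  have hAI : A ∈ Icc A B := ⟨le_rfl, hAB⟩
  have hBI : B ∈ Icc A B := ⟨hAB, le_rfl⟩
  have hbv : BoundedVariationOn β (Icc A B) := by
    simpa only [BoundedVariationOn, inter_self] using hβAB A B hAI hBI
  set u : ℝ → ℝ := variationOnFromTo β (Icc A B) A with hu
  have humono : MonotoneOn u (Icc A B) := variationOnFromTo.monotoneOn hβAB hAI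
  have huA : u A = 0 := variationOnFromTo.self _ _ _
  have huB : u B = (eVariationOn β (Icc A B)).toReal := by
    rw [hu, variationOnFromTo.eq_of_le _ _ hAB, inter_self]
  have huim : u '' Icc A B = Icc 0 (u B) := by
    rw [(continuousOn_variationOnFromTo (β.continuousOn_toFun.mono hABβ) hbv).image_Icc hAB,
      humono.sInf_image_Icc hAB, humono.sSup_image_Icc hAB, huA]
  have haI : ∀ j, a j ∈ Icc A B := fun j ↦ ⟨hjA j, (hab j).trans (hjB j)⟩
  have hbI : ∀ j, b j ∈ Icc A B := fun j ↦ ⟨(hjA j).trans (hab j), hjB j⟩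
  set τ : ℝ → ℝ := @invFunOn _ _ ⟨A⟩ u (Icc A B) with hτ
  set F : Fin m → ℝ → ℝ≥0∞ := fun j s ↦ (minStretch f (α j (τ s)))⁻¹ * ρ (α j (τ s)) with hF
  have hsub : ∀ j, Ioo (u (a j)) (u (b j)) ⊆ Icc 0 (u B) := by
    intro j s hs
    exact ⟨huA ▸ (humono hAI (haI j) (hjA j)).trans hs.1.le,
      hs.2.le.trans (humono (hbI j) hBI (hjB j))⟩
  have hm0 : (m : ℝ≥0∞) ≠ 0 := by
    simp only [ne_eq, Nat.cast_eq_zero]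
    lia
  have key : (m : ℝ≥0∞) * c' ≤
      m * ∫⁻ s in Icc 0 (u B), g (naturalParameterization β (Icc A B) A s) := by
    calc (m : ℝ≥0∞) * c' = ∑ _j : Fin m, c' := by simp
      _ ≤ ∑ j, ∫⁻ s in Ioo (u (a j)) (u (b j)), F j s :=
          Finset.sum_le_sum fun j _ ↦ (hint j).le.trans
            (lintegral_naturalParameterization_lift_le hdisc (hD j) (hl j) hβ (hAC j) ρ (ha j)
              (hb j) (hab j) hA hB (hjA j) (hjB j))
      _ = ∑ j, ∫⁻ s in Icc 0 (u B), (Ioo (u (a j)) (u (b j))).indicator (F j) s := by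
          refine Finset.sum_congr rfl fun j _ ↦ ?_
          rw [lintegral_indicator measurableSet_Ioo, Measure.restrict_restrict measurableSet_Ioo,
            inter_eq_left.2 (hsub j)]
      _ ≤ ∫⁻ s in Icc 0 (u B), ∑ j, (Ioo (u (a j)) (u (b j))).indicator (F j) s :=
          sum_lintegral_le_lintegral_sum _ _ _
      _ ≤ ∫⁻ s in Icc 0 (u B), m * g (naturalParameterization β (Icc A B) A s) := by
          refine lintegral_mono_ae ((ae_restrict_iff' measurableSet_Icc).2 ?_)
          filter_upwards [hZ A hA B hB hAB] with s hsZ hs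
          have hsZ' := hsZ (huB ▸ hs)
          have hmem : s ∈ u '' Icc A B := huim ▸ hs
          have h1 : τ s ∈ Icc A B := invFunOn_mem hmem
          have h2 : u (τ s) = s := invFunOn_eq hmem
          -- Only the lifts whose chosen subcurve covers the parameter `s` contribute.
          have h3 := hg (τ s) (hABβ h1) hsZ'
            (Finset.univ.filter fun j ↦ s ∈ Ioo (u (a j)) (u (b j))) (by
              intro j hj
              have hj := (Finset.mem_filter.1 hj).2
              refine (α j).ordConnected_dom.out (ha j) (hb j) ⟨?_, ?_⟩
              · by_contra h
                have := humono h1 (haI j) (not_le.1 h).le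
                rw [h2] at this
                exact absurd hj.1 (not_lt.2 this)
              · by_contra h
                have := humono (hbI j) h1 (not_le.1 h).le
                rw [h2] at this
                exact absurd hj.2 (not_lt.2 this))
          refine le_trans (le_of_eq ?_) h3
          rw [Finset.sum_filter]
          exact Finset.sum_congr rfl fun j _ ↦ indicator_apply _ _ _
      _ = _ := lintegral_const_mul' _ _ (ENNReal.natCast_ne_top m)
  have key' := (ENNReal.mul_le_mul_iff_right hm0 (ENNReal.natCast_ne_top m)).1 key
  refine key'.trans ?_
  rw [huB]
  exact le_iSup₂_of_le A hA (le_iSup₂_of_le B hB (le_iSup_of_le hAB le_rfl))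

end LiftFamilies


/-! ### Gram determinants and the volume density in charts. -/

section Gram

variable {n : ℕ} {V : Type*} [NormedAddCommGroup V] [InnerProductSpace ℝ V]

/-- If `P` is the matrix of `T`, the Gram matrix `G` becomes `Pᵀ G P`. -/
theorem det_gram_comp (S : EuclideanSpace ℝ (Fin n) →ₗ[ℝ] V)
    (T : EuclideanSpace ℝ (Fin n) →ₗ[ℝ] EuclideanSpace ℝ (Fin n)) :
    Matrix.det (Matrix.gram ℝ fun i ↦ S (T (EuclideanSpace.single i (1 : ℝ)))) =
      LinearMap.det T ^ 2 *
        Matrix.det (Matrix.gram ℝ fun i ↦ S (EuclideanSpace.single i (1 : ℝ))) := by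
  set b := (EuclideanSpace.basisFun (Fin n) ℝ).toBasis with hb
  have hbi : ∀ i, b i = EuclideanSpace.single i (1 : ℝ) := fun i ↦ by simp [hb]
  set P := LinearMap.toMatrix b b T with hP
  have hT : ∀ i, T (EuclideanSpace.single i (1 : ℝ)) =
      ∑ k, P k i • EuclideanSpace.single k (1 : ℝ) := by
    intro i
    rw [← hbi, ← b.sum_repr (T (b i))]
    refine Finset.sum_congr rfl fun k _ ↦ ?_
    rw [hP, LinearMap.toMatrix_apply, hbi k]
  have hG : Matrix.gram ℝ (fun i ↦ S (T (EuclideanSpace.single i (1 : ℝ)))) =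
      P.transpose * Matrix.gram ℝ (fun i ↦ S (EuclideanSpace.single i (1 : ℝ))) * P := by
    ext i j
    simp only [Matrix.gram_apply, hT, map_sum, map_smul, sum_inner, inner_sum, inner_smul_left,
      inner_smul_right, Matrix.mul_apply, Matrix.transpose_apply, Finset.sum_mul]
    simp only [RCLike.conj_to_real]
    refine Finset.sum_congr rfl fun k _ ↦ ?_
    rw [Finset.mul_sum]
    refine Finset.sum_congr rfl fun l _ ↦ ?_
    rw [real_inner_comm]
    ring
  rw [hG, Matrix.det_mul, Matrix.det_mul, Matrix.det_transpose, hP, LinearMap.det_toMatrix]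
  ring

theorem det_gram_pos (S : EuclideanSpace ℝ (Fin n) →ₗ[ℝ] V) (hS : Injective S) :
    0 < Matrix.det (Matrix.gram ℝ fun i ↦ S (EuclideanSpace.single i (1 : ℝ))) := by
  have h := (EuclideanSpace.basisFun (Fin n) ℝ).toBasis.linearIndependent.map'
    S (LinearMap.ker_eq_bot.2 hS)
  have h2 := (Matrix.posDef_gram_of_linearIndependent (𝕜 := ℝ) h).det_pos
  have hfun : (fun i ↦ S (EuclideanSpace.single i (1 : ℝ))) =
      S ∘ (EuclideanSpace.basisFun (Fin n) ℝ).toBasis := by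
    funext i
    simp
  rw [hfun]
  exact h2

end Gram

section GramDet

variable {n : ℕ} {M : Type*} [TopologicalSpace M] [ChartedSpace (EuclideanSpace ℝ (Fin n)) M]
  [Bundle.RiemannianBundle (fun x : M ↦ TangentSpace (𝓡 n) x)]

/-- The Gram determinant of the images of the standard basis vectors under a linear map into a
tangent space. -/
def gramDet (x : M) (S : EuclideanSpace ℝ (Fin n) →L[ℝ] TangentSpace (𝓡 n) x) : ℝ :=
  Matrix.det (Matrix.gram ℝ fun i ↦ S (EuclideanSpace.single i (1 : ℝ)))

/-- All tangent spaces unfold to the model space while the inner product depends on the base point;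
stating this for maps of the model space avoids transport along `h`. -/
theorem gramDet_congr {x y : M} (h : x = y)
    {S S' : EuclideanSpace ℝ (Fin n) →L[ℝ] EuclideanSpace ℝ (Fin n)} (hS : S = S') :
    gramDet x S = gramDet y S' := by
  subst h hS; rfl

theorem gramDet_comp (x : M) (S : EuclideanSpace ℝ (Fin n) →L[ℝ] TangentSpace (𝓡 n) x)
    (T : EuclideanSpace ℝ (Fin n) →L[ℝ] EuclideanSpace ℝ (Fin n)) :
    gramDet x (S.comp T) = T.det ^ 2 * gramDet x S :=
  det_gram_comp (V := TangentSpace (𝓡 n) x) S.toLinearMap T.toLinearMap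

theorem volumeDensity_eq (x₀ : M) (u : EuclideanSpace ℝ (Fin n)) :
    volumeDensity n x₀ u = ENNReal.ofReal (Real.sqrt (gramDet ((extChartAt (𝓡 n) x₀).symm u)
      (mfderiv (𝓡 n) (𝓡 n) (extChartAt (𝓡 n) x₀).symm u))) := rfl

end GramDet

section Charts

variable {n : ℕ} {M : Type*} [TopologicalSpace M] [ChartedSpace (EuclideanSpace ℝ (Fin n)) M]
  [IsManifold (𝓡 n) ∞ M]

theorem mdifferentiableAt_extChartAt_symm {x₀ : M} {u : EuclideanSpace ℝ (Fin n)}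
    (hu : u ∈ (extChartAt (𝓡 n) x₀).target) :
    MDifferentiableAt (𝓡 n) (𝓡 n) (extChartAt (𝓡 n) x₀).symm u := by
  have := mdifferentiableWithinAt_extChartAt_symm (I := 𝓡 n) hu
  rwa [ModelWithCorners.range_eq_univ, mdifferentiableWithinAt_univ] at this

theorem mdifferentiableAt_extChartAt' {x₀ x : M} (hx : x ∈ (extChartAt (𝓡 n) x₀).source) :
    MDifferentiableAt (𝓡 n) (𝓡 n) (extChartAt (𝓡 n) x₀) x :=
  mdifferentiableAt_extChartAt (by rwa [extChartAt_source] at hx)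

theorem injective_mfderiv_extChartAt_symm {x₀ : M} {u : EuclideanSpace ℝ (Fin n)}
    (hu : u ∈ (extChartAt (𝓡 n) x₀).target) :
    Injective (mfderiv (𝓡 n) (𝓡 n) (extChartAt (𝓡 n) x₀).symm u) := by
  have := isInvertible_mfderivWithin_extChartAt_symm (I := 𝓡 n) hu
  rw [ModelWithCorners.range_eq_univ, mfderivWithin_univ] at this
  exact this.injective

theorem coordChange_hasFDerivAt {x₀ x₁ : M} {u : EuclideanSpace ℝ (Fin n)}
    (hu : u ∈ (extChartAt (𝓡 n) x₁).target)
    (hu₀ : (extChartAt (𝓡 n) x₁).symm u ∈ (extChartAt (𝓡 n) x₀).source) :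
    ∃ T : EuclideanSpace ℝ (Fin n) →L[ℝ] EuclideanSpace ℝ (Fin n),
      HasFDerivAt (extChartAt (𝓡 n) x₀ ∘ (extChartAt (𝓡 n) x₁).symm) T u ∧
      (mfderiv (𝓡 n) (𝓡 n) (extChartAt (𝓡 n) x₁).symm u :
        EuclideanSpace ℝ (Fin n) →L[ℝ] EuclideanSpace ℝ (Fin n)) =
      (mfderiv (𝓡 n) (𝓡 n) (extChartAt (𝓡 n) x₀).symm
        (extChartAt (𝓡 n) x₀ ((extChartAt (𝓡 n) x₁).symm u)) :
        EuclideanSpace ℝ (Fin n) →L[ℝ] EuclideanSpace ℝ (Fin n)).comp T := by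
  have h1 := mdifferentiableAt_extChartAt_symm hu
  have h2 := (mdifferentiableAt_extChartAt' hu₀).comp u h1
  refine ⟨mfderiv (𝓡 n) (𝓡 n) (extChartAt (𝓡 n) x₀ ∘ (extChartAt (𝓡 n) x₁).symm) u,
    h2.hasMFDerivAt.hasFDerivAt, ?_⟩
  have h3 : MDifferentiableAt (𝓡 n) (𝓡 n) (extChartAt (𝓡 n) x₀).symm
      ((extChartAt (𝓡 n) x₀ ∘ (extChartAt (𝓡 n) x₁).symm) u) :=
    mdifferentiableAt_extChartAt_symm ((extChartAt (𝓡 n) x₀).map_source hu₀)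
  have h4 := mfderiv_comp u h3 h2
  refine Eq.trans ?_ h4
  apply Filter.EventuallyEq.mfderiv_eq
  have h5 : (extChartAt (𝓡 n) x₁).symm ⁻¹' (extChartAt (𝓡 n) x₀).source ∈ 𝓝 u :=
    (continuousAt_extChartAt_symm'' hu).preimage_mem_nhds (extChartAt_source_mem_nhds' hu₀)
  filter_upwards [h5] with w hw
  exact ((extChartAt (𝓡 n) x₀).left_inv hw).symm

variable [Bundle.RiemannianBundle (fun x : M ↦ TangentSpace (𝓡 n) x)]

theorem volumeDensity_pos {x₀ : M} {u : EuclideanSpace ℝ (Fin n)}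
    (hu : u ∈ (extChartAt (𝓡 n) x₀).target) : 0 < volumeDensity n x₀ u := by
  rw [volumeDensity_eq, ENNReal.ofReal_pos, Real.sqrt_pos]
  exact det_gram_pos (V := TangentSpace (𝓡 n) ((extChartAt (𝓡 n) x₀).symm u))
    (mfderiv (𝓡 n) (𝓡 n) (extChartAt (𝓡 n) x₀).symm u).toLinearMap
    (injective_mfderiv_extChartAt_symm hu)

/-- By the chain rule the coordinate fields change by `T`, so the Gram determinant is multiplied by
`(det T)²` and its root by `|det T|`, the factor in the change of variables formula. -/
theorem volumeDensity_coordChange {x₀ x₁ : M} {u : EuclideanSpace ℝ (Fin n)}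
    (hu : u ∈ (extChartAt (𝓡 n) x₁).target)
    (hu₀ : (extChartAt (𝓡 n) x₁).symm u ∈ (extChartAt (𝓡 n) x₀).source) :
    ∃ T : EuclideanSpace ℝ (Fin n) →L[ℝ] EuclideanSpace ℝ (Fin n),
      HasFDerivAt (extChartAt (𝓡 n) x₀ ∘ (extChartAt (𝓡 n) x₁).symm) T u ∧
      volumeDensity n x₁ u = ENNReal.ofReal |T.det| *
        volumeDensity n x₀ (extChartAt (𝓡 n) x₀ ((extChartAt (𝓡 n) x₁).symm u)) := by
  obtain ⟨T, hT, hS⟩ := coordChange_hasFDerivAt hu hu₀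
  refine ⟨T, hT, ?_⟩
  have hpt : (extChartAt (𝓡 n) x₁).symm u = (extChartAt (𝓡 n) x₀).symm
      (extChartAt (𝓡 n) x₀ ((extChartAt (𝓡 n) x₁).symm u)) :=
    ((extChartAt (𝓡 n) x₀).left_inv hu₀).symm
  rw [volumeDensity_eq, volumeDensity_eq, gramDet_congr hpt hS,
    ← ENNReal.ofReal_mul (abs_nonneg _), ← Real.sqrt_sq_eq_abs,
    ← Real.sqrt_mul (sq_nonneg _)]
  congr 2
  exact gramDet_comp _ _ _

variable [IsContMDiffRiemannianBundle (𝓡 n) ∞ (EuclideanSpace ℝ (Fin n))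
      (fun x : M ↦ TangentSpace (𝓡 n) x)]

instance isContinuousRiemannianBundle_tangentSpace :
    IsContinuousRiemannianBundle (EuclideanSpace ℝ (Fin n))
      (fun x : M ↦ TangentSpace (𝓡 n) x) := by
  obtain ⟨g, hg, h⟩ := IsContMDiffRiemannianBundle.exists_contMDiff (IB := 𝓡 n) (n := ∞)
    (F := EuclideanSpace ℝ (Fin n)) (E := fun x : M ↦ TangentSpace (𝓡 n) x)
  exact ⟨g, hg.continuous, h⟩

/-- The coordinate fields are images of constant fields under the tangent map of the inverse chart,
hence continuous into the tangent bundle, and the metric is continuous. -/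
theorem continuousOn_volumeDensity (x₀ : M) :
    ContinuousOn (volumeDensity n x₀) (extChartAt (𝓡 n) x₀).target := by
  have hsm : ContMDiffOn (𝓡 n) (𝓡 n) ∞ (extChartAt (𝓡 n) x₀).symm (extChartAt (𝓡 n) x₀).target :=
    contMDiffOn_extChartAt_symm x₀
  have hopen : IsOpen (extChartAt (𝓡 n) x₀).target := isOpen_extChartAt_target x₀
  have hT := hsm.continuousOn_tangentMapWithin (by simp) hopen.uniqueMDiffOn
  have hvec : ∀ i : Fin n, ContinuousOn (fun u ↦ (⟨(extChartAt (𝓡 n) x₀).symm u,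
      coordVector n x₀ u i⟩ : Bundle.TotalSpace (EuclideanSpace ℝ (Fin n))
        (fun x : M ↦ TangentSpace (𝓡 n) x))) (extChartAt (𝓡 n) x₀).target := by
    intro i
    have hc : Continuous fun u : EuclideanSpace ℝ (Fin n) ↦
        (⟨u, EuclideanSpace.single i (1 : ℝ)⟩ : TangentBundle (𝓡 n) (EuclideanSpace ℝ (Fin n))) :=
      (tangentBundleModelSpaceHomeomorph (𝓡 n)).symm.continuous.comp
        (continuous_id.prodMk continuous_const)
    have := hT.comp hc.continuousOn (fun u hu ↦ hu)
    refine this.congr fun u hu ↦ ?_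
    simp only [coordVector, comp_apply, tangentMapWithin]
    rw [mfderivWithin_of_isOpen hopen hu]
  have : ContinuousOn (fun u ↦ Matrix.det (Matrix.of fun i j : Fin n ↦
    (inner ℝ (coordVector n x₀ u i) (coordVector n x₀ u j) : ℝ)))
      (extChartAt (𝓡 n) x₀).target := by
    refine continuousOn_iff_continuous_domRestrict.2 (Continuous.matrix_det ?_)
    exact continuous_matrix fun i j ↦
      continuousOn_iff_continuous_domRestrict.1 ((hvec i).inner_bundle (hvec j))
  exact ENNReal.continuous_ofReal.comp_continuousOn (Real.continuous_sqrt.comp_continuousOn this)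

end Charts


/-! ### The Riemannian volume computed in charts. -/

theorem _root_.ContinuousOn.measurableSet_inter_preimage {X Y : Type*} [TopologicalSpace X]
    [MeasurableSpace X] [OpensMeasurableSpace X] [TopologicalSpace Y] [MeasurableSpace Y]
    [BorelSpace Y] {f : X → Y} {s : Set X} {t : Set Y} (hf : ContinuousOn f s)
    (hs : MeasurableSet s) (ht : MeasurableSet t) : MeasurableSet (s ∩ f ⁻¹' t) := by
  have h1 : Measurable (s.domRestrict f) :=
    (continuousOn_iff_continuous_domRestrict.1 hf).measurable
  have h2 := (MeasurableEmbedding.subtype_coe hs).measurableSet_image.2 (h1 ht)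
  rwa [domRestrict_eq, preimage_comp, Subtype.image_preimage_coe] at h2

section ChartVolume

variable {n : ℕ} {M : Type*} [TopologicalSpace M] [ChartedSpace (EuclideanSpace ℝ (Fin n)) M]
  [IsManifold (𝓡 n) ∞ M] [Bundle.RiemannianBundle (fun x : M ↦ TangentSpace (𝓡 n) x)]
  [MeasurableSpace M] [BorelSpace M]

omit [IsManifold (𝓡 n) ∞ M] in
theorem chartVolume_apply (x₀ : M) {A : Set M} (hA : MeasurableSet A) :
    chartVolume n x₀ A = ∫⁻ u in (extChartAt (𝓡 n) x₀).target ∩ (extChartAt (𝓡 n) x₀).symm ⁻¹' A,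
      volumeDensity n x₀ u := by
  have hopen : IsOpen (extChartAt (𝓡 n) x₀).target := isOpen_extChartAt_target x₀
  have hae : AEMeasurable (extChartAt (𝓡 n) x₀).symm
      ((volume.restrict (extChartAt (𝓡 n) x₀).target).withDensity (volumeDensity n x₀)) :=
    ((continuousOn_extChartAt_symm x₀).aemeasurable hopen.measurableSet).mono_ac
      (withDensity_absolutelyContinuous _ _)
  have hm := (continuousOn_extChartAt_symm (I := 𝓡 n) x₀).measurableSet_inter_preimage
    hopen.measurableSet hA
  rw [chartVolume, Measure.map_apply_of_aemeasurable hae hA]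
  have h1 : ((volume.restrict (extChartAt (𝓡 n) x₀).target).withDensity (volumeDensity n x₀))
      ((extChartAt (𝓡 n) x₀).target)ᶜ = 0 := by
    apply withDensity_absolutelyContinuous
    rw [Measure.restrict_apply hopen.measurableSet.compl, compl_inter_self, measure_empty]
  rw [← measure_inter_conull' (t := (extChartAt (𝓡 n) x₀).target) (by
      exact measure_mono_null (fun u hu ↦ hu.2) h1), inter_comm,
    withDensity_apply _ hm, Measure.restrict_restrict hm]
  congr 2
  rw [inter_right_comm, inter_self]

omit [IsManifold (𝓡 n) ∞ M] in
theorem chartVolume_compl_source (x₀ : M) :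
    chartVolume n x₀ (extChartAt (𝓡 n) x₀).sourceᶜ = 0 := by
  rw [chartVolume_apply x₀ (isOpen_extChartAt_source x₀).measurableSet.compl]
  have : (extChartAt (𝓡 n) x₀).target ∩
      (extChartAt (𝓡 n) x₀).symm ⁻¹' (extChartAt (𝓡 n) x₀).sourceᶜ = ∅ := by
    ext u
    simp only [mem_inter_iff, mem_preimage, mem_compl_iff, mem_empty_iff_false, iff_false, not_and,
      not_not]
    exact fun hu ↦ (extChartAt (𝓡 n) x₀).map_target hu
  rw [this, setLIntegral_empty]

/-- The chart volumes agree on the overlaps of the charts. -/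
theorem chartVolume_eq_of_subset (x₀ x₁ : M) {A : Set M} (hA : MeasurableSet A)
    (h₀ : A ⊆ (extChartAt (𝓡 n) x₀).source) (h₁ : A ⊆ (extChartAt (𝓡 n) x₁).source) :
    chartVolume n x₁ A = chartVolume n x₀ A := by
  set φ₀ := extChartAt (𝓡 n) x₀ with hφ₀
  set φ₁ := extChartAt (𝓡 n) x₁ with hφ₁
  set B := φ₁.target ∩ φ₁.symm ⁻¹' A with hB
  have hBm : MeasurableSet B := (continuousOn_extChartAt_symm (I := 𝓡 n) x₁).measurableSet_inter_preimage
    (isOpen_extChartAt_target x₁).measurableSet hA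
  have key : ∀ u, ∃ T : EuclideanSpace ℝ (Fin n) →L[ℝ] EuclideanSpace ℝ (Fin n), u ∈ B →
      HasFDerivAt (φ₀ ∘ φ₁.symm) T u ∧ volumeDensity n x₁ u = ENNReal.ofReal |T.det| *
        volumeDensity n x₀ (φ₀ (φ₁.symm u)) := by
    intro u
    by_cases hu : u ∈ B
    · obtain ⟨T, hT⟩ := volumeDensity_coordChange hu.1 (h₀ hu.2)
      exact ⟨T, fun _ ↦ hT⟩
    · exact ⟨0, fun h ↦ absurd h hu⟩
  choose T hT using key
  have hinj : InjOn (φ₀ ∘ φ₁.symm) B := by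
    intro u hu v hv huv
    have := φ₀.injOn (h₀ hu.2) (h₀ hv.2) huv
    exact φ₁.symm.injOn hu.1 hv.1 this
  have him : (φ₀ ∘ φ₁.symm) '' B = φ₀.target ∩ φ₀.symm ⁻¹' A := by
    ext w
    constructor
    · rintro ⟨u, hu, rfl⟩
      refine ⟨φ₀.map_source (h₀ hu.2), ?_⟩
      rw [mem_preimage, comp_apply, φ₀.left_inv (h₀ hu.2)]
      exact hu.2
    · rintro ⟨hw, hwA⟩
      refine ⟨φ₁ (φ₀.symm w), ⟨φ₁.map_source (h₁ hwA), ?_⟩, ?_⟩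
      · rw [mem_preimage, φ₁.left_inv (h₁ hwA)]
        exact hwA
      · rw [comp_apply, φ₁.left_inv (h₁ hwA), φ₀.right_inv hw]
  rw [chartVolume_apply x₁ hA, chartVolume_apply x₀ hA, ← him,
    lintegral_image_eq_lintegral_abs_det_fderiv_mul volume hBm
      (fun u hu ↦ (hT u hu).1.hasFDerivWithinAt) hinj]
  exact setLIntegral_congr_fun hBm fun u hu ↦ (hT u hu).2

variable [SecondCountableTopology M]

/-- One inequality is the definition of a supremum. For the other, glue the chart volumes along a
countable partition subordinate to chart domains: since they agree on overlaps, the glued measure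
`ν` dominates every chart volume, hence their supremum, and equals the given one on `A`. -/
theorem riemVolume_eq_chartVolume (x₀ : M) {A : Set M} (hA : MeasurableSet A)
    (h₀ : A ⊆ (extChartAt (𝓡 n) x₀).source) :
    riemVolume n M A = chartVolume n x₀ A := by
  refine le_antisymm ?_ (Measure.le_iff.1 (le_iSup (fun x : M ↦ chartVolume n x) x₀) A hA)
  obtain ⟨s, hsc, hsu⟩ := TopologicalSpace.countable_cover_nhds
    (fun x : M ↦ extChartAt_source_mem_nhds (I := 𝓡 n) x)
  have hne : s.Nonempty := by
    by_contra h
    rw [not_nonempty_iff_eq_empty] at h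
    rw [h, biUnion_empty] at hsu
    exact (hsu ▸ mem_univ x₀ : x₀ ∈ (∅ : Set M))
  obtain ⟨c, rfl⟩ := hsc.exists_eq_range hne
  rw [biUnion_range] at hsu
  set S := disjointed fun k ↦ (extChartAt (𝓡 n) (c k)).source with hS
  have hSm : ∀ k, MeasurableSet (S k) := MeasurableSet.disjointed
    fun k ↦ (isOpen_extChartAt_source (c k)).measurableSet
  have hSsub : ∀ k, S k ⊆ (extChartAt (𝓡 n) (c k)).source := disjointed_subset _
  have hSu : ⋃ k, S k = univ := by rw [hS, iUnion_disjointed, hsu]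
  have hSd : Pairwise (Disjoint on S) := disjoint_disjointed _
  have hsplit : ∀ (μ : Measure M) {B : Set M}, MeasurableSet B → μ B = ∑' k, μ (B ∩ S k) := by
    intro μ B hB
    rw [← measure_iUnion (fun i j hij ↦ (hSd hij).mono inter_subset_right inter_subset_right)
      (fun k ↦ hB.inter (hSm k)), ← inter_iUnion, hSu, inter_univ]
  set ν : Measure M := Measure.sum fun k ↦ (chartVolume n (c k)).restrict (S k) with hν
  have hνapply : ∀ {B : Set M}, MeasurableSet B → ν B = ∑' k, chartVolume n (c k) (B ∩ S k) := by
    intro B hB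
    rw [hν, Measure.sum_apply _ hB]
    exact tsum_congr fun k ↦ Measure.restrict_apply hB
  have hle : riemVolume n M ≤ ν := by
    refine iSup_le fun x ↦ Measure.le_iff.2 fun B hB ↦ ?_
    rw [hsplit _ hB, hνapply hB]
    refine ENNReal.tsum_le_tsum fun k ↦ ?_
    have hsrc := (isOpen_extChartAt_source (I := 𝓡 n) x).measurableSet
    have h1 : chartVolume n x (B ∩ S k) =
        chartVolume n x (B ∩ S k ∩ (extChartAt (𝓡 n) x).source) :=
      (measure_inter_conull'
        (measure_mono_null (fun y hy ↦ hy.2) (chartVolume_compl_source x))).symm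
    rw [h1, chartVolume_eq_of_subset (c k) x ((hB.inter (hSm k)).inter hsrc)
      (fun y hy ↦ hSsub k hy.1.2) inter_subset_right]
    exact measure_mono inter_subset_left
  calc riemVolume n M A ≤ ν A := Measure.le_iff.1 hle A hA
    _ = ∑' k, chartVolume n x₀ (A ∩ S k) := by
        rw [hνapply hA]
        exact tsum_congr fun k ↦ (chartVolume_eq_of_subset _ _ (hA.inter (hSm k))
          (fun y hy ↦ h₀ hy.1) (fun y hy ↦ hSsub k hy.2))
    _ = chartVolume n x₀ A := (hsplit _ hA).symm

theorem riemVolume_apply (x₀ : M) {A : Set M} (hA : MeasurableSet A)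
    (h₀ : A ⊆ (extChartAt (𝓡 n) x₀).source) :
    riemVolume n M A = ∫⁻ u in (extChartAt (𝓡 n) x₀).target ∩ (extChartAt (𝓡 n) x₀).symm ⁻¹' A,
      volumeDensity n x₀ u := by
  rw [riemVolume_eq_chartVolume x₀ hA h₀, chartVolume_apply x₀ hA]

theorem riemVolume_eq_zero_of_image (x₀ : M) {S : Set M} (hS : S ⊆ (extChartAt (𝓡 n) x₀).source)
    (h : volume (extChartAt (𝓡 n) x₀ '' S) = 0) : riemVolume n M S = 0 := by
  set φ := extChartAt (𝓡 n) x₀ with hφ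
  set T := toMeasurable volume (φ '' S) with hT
  have hTm : MeasurableSet T := measurableSet_toMeasurable _ _
  set A := φ.source ∩ φ ⁻¹' T with hA
  have hAm : MeasurableSet A :=
    (continuousOn_extChartAt x₀).measurableSet_inter_preimage
      (isOpen_extChartAt_source (I := 𝓡 n) x₀).measurableSet hTm
  have hSA : S ⊆ A := fun x hx ↦ ⟨hS hx, subset_toMeasurable _ _ (mem_image_of_mem _ hx)⟩
  refine measure_mono_null hSA ?_
  rw [riemVolume_apply x₀ hAm inter_subset_left]
  refine setLIntegral_measure_zero _ _ (measure_mono_null (t := T) ?_ ?_)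
  · rintro u ⟨hu, hu1, hu2⟩
    rwa [mem_preimage, φ.right_inv hu] at hu2
  · rw [hT, measure_toMeasurable, h]

end ChartVolume


/-! ### Comparison of the Riemannian distance with chart distance. -/

section ChartDistance

open Manifold
open scoped NNReal

variable {n : ℕ} {M : Type*} [EMetricSpace M] [ChartedSpace (EuclideanSpace ℝ (Fin n)) M]
  [IsManifold (𝓡 n) ∞ M] [Bundle.RiemannianBundle (fun x : M ↦ TangentSpace (𝓡 n) x)]
  [IsContMDiffRiemannianBundle (𝓡 n) ∞ (EuclideanSpace ℝ (Fin n))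
      (fun x : M ↦ TangentSpace (𝓡 n) x)]
  [IsRiemannianManifold (𝓡 n) M]

theorem eventually_edist_le_edist_extChartAt (x : M) :
    ∃ C > (0 : ℝ≥0), ∀ᶠ y in 𝓝 x,
      edist x y ≤ C * edist (extChartAt (𝓡 n) x x) (extChartAt (𝓡 n) x y) := by
  have : IsManifold (𝓡 n) 1 M := IsManifold.of_le (n := ∞) (by simp)
  obtain ⟨C, hC, h⟩ := eventually_riemannianEDist_le_edist_extChartAt (𝓡 n) x
  refine ⟨C, hC, ?_⟩
  filter_upwards [h] with y hy
  rwa [IsRiemannianManifold.out (I := 𝓡 n)]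

attribute [local instance] normedAddCommGroupTangentSpaceVectorSpace
attribute [local instance] normedSpaceTangentSpaceVectorSpace

/-- The derivative of the chart is bounded near `x`. A path from `x` whose length is little more
than the distance to `y` stays in that neighbourhood, and integrating the bound along it controls
the chart distance. -/
theorem eventually_edist_extChartAt_le_edist (x : M) :
    ∃ C > (0 : ℝ≥0), ∀ᶠ y in 𝓝 x,
      edist (extChartAt (𝓡 n) x x) (extChartAt (𝓡 n) x y) ≤ C * edist x y := by
  have : IsManifold (𝓡 n) 1 M := IsManifold.of_le (n := ∞) (by simp)
  obtain ⟨C, C_pos, hC₀⟩ := eventually_enorm_mfderiv_extChartAt_lt (𝓡 n) x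
  have hC : ∀ᶠ y in 𝓝 x, ∀ v : TangentSpace (𝓡 n) y,
      ‖(mfderiv (𝓡 n) (𝓡 n) (extChartAt (𝓡 n) x) y v : EuclideanSpace ℝ (Fin n))‖ₑ
        ≤ C * ‖v‖ₑ := by
    filter_upwards [hC₀] with y hy v
    exact (ContinuousLinearMap.le_opENorm _ _).trans (mul_le_mul_left hy.le _)
  refine ⟨C, C_pos, ?_⟩
  obtain ⟨c, hc, hcs⟩ := setOfPred_riemannianEDist_lt_subset_nhds' (𝓡 n)
    (inter_mem hC (extChartAt_source_mem_nhds (I := 𝓡 n) x))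
  have hnear : ∀ᶠ y in 𝓝 x, edist x y < c := by
    filter_upwards [Metric.eball_mem_nhds x hc] with y hy
    rwa [edist_comm]
  filter_upwards [hnear] with y hy
  have hC0 : (C : ℝ≥0∞) ≠ 0 := by exact_mod_cast C_pos.ne'
  rw [mul_comm, ← ENNReal.div_le_iff_le_mul (Or.inl hC0) (Or.inl ENNReal.coe_ne_top)]
  refine le_of_forall_gt fun r hr ↦ ?_
  -- Below `c` the path cannot leave the set where the derivative bound holds; below `r` the
  -- estimate is sharp enough.
  obtain ⟨r', hr', hr'2⟩ := exists_between (lt_min hr hy)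
  rw [lt_min_iff] at hr'2
  rw [IsRiemannianManifold.out (I := 𝓡 n)] at hr'
  refine lt_of_le_of_lt ?_ hr'2.1
  rw [ENNReal.div_le_iff_le_mul (Or.inl hC0) (Or.inl ENNReal.coe_ne_top), mul_comm]
  obtain ⟨γ, hγx, hγy, γ_smooth, hγ⟩ := exists_lt_of_riemannianEDist_lt hr'
  have hmem : ∀ t ∈ Icc (0 : ℝ) 1, γ t ∈ {y | ∀ v : TangentSpace (𝓡 n) y,
      ‖(mfderiv (𝓡 n) (𝓡 n) (extChartAt (𝓡 n) x) y v : EuclideanSpace ℝ (Fin n))‖ₑ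
        ≤ C * ‖v‖ₑ} ∩ (extChartAt (𝓡 n) x).source := by
    intro t ht
    refine hcs (lt_of_le_of_lt ?_ (hγ.trans hr'2.2))
    exact (riemannianEDist_le_pathELength (γ_smooth.mono (Icc_subset_Icc le_rfl ht.2)) hγx rfl
      ht.1).trans (pathELength_mono le_rfl ht.2)
  have hsrc : ∀ t ∈ Icc (0 : ℝ) 1, γ t ∈ (chartAt (EuclideanSpace ℝ (Fin n)) x).source := by
    intro t ht
    have := (hmem t ht).2
    rwa [extChartAt_source] at this
  let γ' := extChartAt (𝓡 n) x ∘ γ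
  have hC' : ContMDiffOn 𝓘(ℝ, ℝ) (𝓡 n) 1 γ' (Icc 0 1) :=
    contMDiffOn_extChartAt.comp (I' := 𝓡 n)
      (t := (chartAt (EuclideanSpace ℝ (Fin n)) x).source) γ_smooth hsrc
  have hend : edist (extChartAt (𝓡 n) x x) (extChartAt (𝓡 n) x y) = ‖γ' 1 - γ' 0‖ₑ := by
    rw [edist_comm, edist_eq_enorm_sub]
    simp only [γ', comp_apply, hγx, hγy]
  rw [hend]
  calc
    ‖γ' 1 - γ' 0‖ₑ
    _ ≤ ∫⁻ t' in Icc 0 1, ‖derivWithin γ' (Icc 0 1) t'‖ₑ := by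
      apply enorm_sub_le_lintegral_derivWithin_Icc_of_contDiffOn_Icc _ zero_le_one
      rwa [← contMDiffOn_iff_contDiffOn]
    _ ≤ ∫⁻ t' in Icc 0 1, C * ‖mfderivWithin 𝓘(ℝ, ℝ) (𝓡 n) γ (Icc 0 1) t' 1‖ₑ := by
      apply setLIntegral_mono' measurableSet_Icc (fun t' ht' ↦ ?_)
      have : mfderivWithin 𝓘(ℝ, ℝ) (𝓡 n) γ' (Icc 0 1) t' =
          (mfderiv (𝓡 n) (𝓡 n) (extChartAt (𝓡 n) x) (γ t')) ∘L (mfderivWithin 𝓘(ℝ, ℝ) (𝓡 n) γ (Icc 0 1) t') := by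
        apply mfderiv_comp_mfderivWithin
        · exact mdifferentiableAt_extChartAt (hsrc t' ht')
        · exact γ_smooth.mdifferentiableOn one_ne_zero _ ht'
        · rw [uniqueMDiffWithinAt_iff_uniqueDiffWithinAt]
          exact uniqueDiffOn_Icc zero_lt_one _ ht'
      have h1 : derivWithin γ' (Icc 0 1) t' = (mfderiv (𝓡 n) (𝓡 n) (extChartAt (𝓡 n) x) (γ t'))
          (mfderivWithin 𝓘(ℝ, ℝ) (𝓡 n) γ (Icc 0 1) t' 1) := by
        rw [← fderivWithin_derivWithin, ← mfderivWithin_eq_fderivWithin]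
        exact DFunLike.congr_fun this (1 : ℝ)
      rw [h1]
      exact (hmem t' ht').1 _
    _ = C * pathELength (𝓡 n) γ 0 1 := by
      rw [lintegral_const_mul' _ _ ENNReal.coe_ne_top,
          pathELength_eq_lintegral_mfderivWithin_Icc]
    _ ≤ C * r' := by
      gcongr

end ChartDistance

/-! ### Local doubling of the volume. -/

section Doubling

open scoped NNReal

variable {n : ℕ} {M : Type*} [EMetricSpace M] [SecondCountableTopology M]
  [ChartedSpace (EuclideanSpace ℝ (Fin n)) M]
  [IsManifold (𝓡 n) ∞ M] [Bundle.RiemannianBundle (fun x : M ↦ TangentSpace (𝓡 n) x)]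
  [IsContMDiffRiemannianBundle (𝓡 n) ∞ (EuclideanSpace ℝ (Fin n))
      (fun x : M ↦ TangentSpace (𝓡 n) x)]
  [IsRiemannianManifold (𝓡 n) M] [MeasurableSpace M] [BorelSpace M]

/-- The Riemannian volume is doubling at each point, for small radii. -/
theorem riemVolume_doubling (x : M) : ∃ C : ℝ≥0, ∃ R > (0 : ℝ), ∀ r, 0 < r → r < R →
    riemVolume n M (Metric.closedEBall x (ENNReal.ofReal (3 * r))) ≤
      C * riemVolume n M (Metric.closedEBall x (ENNReal.ofReal r)) ∧
    riemVolume n M (Metric.closedEBall x (ENNReal.ofReal (3 * r))) ≠ ⊤ := by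
  obtain ⟨C₁, hC₁, h₁⟩ := eventually_edist_le_edist_extChartAt (n := n) x
  obtain ⟨C₂, hC₂, h₂⟩ := eventually_edist_extChartAt_le_edist (n := n) x
  set φ := extChartAt (𝓡 n) x with hφ
  set a := φ x with ha
  have hxs : x ∈ φ.source := mem_extChartAt_source x
  have hat : a ∈ φ.target := φ.map_source hxs
  set d := volumeDensity n x a with hd
  have hd0 : 0 < d := volumeDensity_pos hat
  have hdtop : d ≠ ⊤ := ENNReal.ofReal_ne_top
  have hcont : ContinuousAt (volumeDensity n x) a :=
    (continuousOn_volumeDensity x).continuousAt ((isOpen_extChartAt_target x).mem_nhds hat)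
  have hup : ∀ᶠ u in 𝓝 a, volumeDensity n x u < 2 * d := by
    refine hcont.eventually_lt_const ?_
    rw [two_mul]
    exact ENNReal.lt_add_right hdtop hd0.ne'
  have hlow : ∀ᶠ u in 𝓝 a, d / 2 < volumeDensity n x u :=
    hcont.eventually_const_lt (ENNReal.half_lt_self hd0.ne' hdtop)
  have hsymm : Tendsto φ.symm (𝓝 a) (𝓝 x) := by
    have := continuousAt_extChartAt_symm (I := 𝓡 n) x
    rwa [ContinuousAt, extChartAt_to_inv] at this
  have hnear : ∀ᶠ u in 𝓝 a, (u ∈ φ.target ∧ volumeDensity n x u < 2 * d ∧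
      d / 2 < volumeDensity n x u ∧ edist x (φ.symm u) ≤ C₁ * edist a (φ (φ.symm u))) :=
    (show ∀ᶠ u in 𝓝 a, u ∈ φ.target from (isOpen_extChartAt_target x).mem_nhds hat).and
      (hup.and (hlow.and (hsymm.eventually h₁)))
  obtain ⟨δ, hδ, hδs⟩ := Metric.eventually_nhds_iff.1 hnear
  obtain ⟨R₀, hR₀, hR₀s⟩ := EMetric.mem_nhds_iff.1
    (inter_mem h₂ (extChartAt_source_mem_nhds (I := 𝓡 n) x))
  obtain ⟨R₁, hR₁, hR₁₀⟩ : ∃ R₁ : ℝ, 0 < R₁ ∧ ENNReal.ofReal R₁ ≤ R₀ := by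
    obtain ⟨q, hq0, hq⟩ := ENNReal.lt_iff_exists_nnreal_btwn.1 hR₀
    exact ⟨q, by exact_mod_cast hq0, by rw [ENNReal.ofReal_coe_nnreal]; exact hq.le⟩
  have hC₁' : (0 : ℝ) < C₁ := hC₁
  have hC₂' : (0 : ℝ) < C₂ := hC₂
  set R := min (R₁ / 3) (min (δ / (3 * C₂)) (δ * C₁)) with hR
  have hRpos : 0 < R := by positivity
  set N := Module.finrank ℝ (EuclideanSpace ℝ (Fin n)) with hN
  -- In the chart the large ball lies in a Euclidean ball of radius `3 C₂ r` and the small one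
  -- contains a Euclidean ball of radius `r / C₁`, whence the power; the factor 4 is the ratio of
  -- the density bounds `2d` and `d/2`.
  set Q : ℝ≥0 := 4 * (3 * C₁ * C₂) ^ N with hQ
  refine ⟨Q, R, hRpos, fun r hr hrR ↦ ?_⟩
  have hr1 : 3 * r < R₁ := by
    have := hrR.trans_le (min_le_left _ _)
    linarith
  have hr2 : 3 * C₂ * r < δ := by
    have := hrR.trans_le ((min_le_right _ _).trans (min_le_left _ _))
    rw [lt_div_iff₀ (by positivity)] at this
    linarith
  have hr3 : r / C₁ < δ := by
    have := hrR.trans_le ((min_le_right _ _).trans (min_le_right _ _))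
    rwa [div_lt_iff₀ hC₁']
  have hsub : ∀ ρ ≤ 3 * r, Metric.closedEBall x (ENNReal.ofReal ρ) ⊆
      {y | edist (φ x) (φ y) ≤ C₂ * edist x y} ∩ φ.source := by
    intro ρ hρ y hy
    refine hR₀s (lt_of_lt_of_le (lt_of_le_of_lt hy ?_) hR₁₀)
    exact (ENNReal.ofReal_lt_ofReal_iff hR₁).2 (hρ.trans_lt hr1)
  have hmeas : ∀ ρ : ℝ, MeasurableSet (Metric.closedEBall x (ENNReal.ofReal ρ)) :=
    fun ρ ↦ Metric.isClosed_closedEBall.measurableSet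
  have hupper : riemVolume n M (Metric.closedEBall x (ENNReal.ofReal (3 * r))) ≤
      2 * d * volume (Metric.closedBall a (3 * C₂ * r)) := by
    rw [riemVolume_apply x (hmeas _) fun y hy ↦ (hsub _ le_rfl hy).2]
    have hin : φ.target ∩ φ.symm ⁻¹' Metric.closedEBall x (ENNReal.ofReal (3 * r)) ⊆
        Metric.closedBall a (3 * C₂ * r) := by
      rintro u ⟨hu, huB⟩
      have h := (hsub _ le_rfl huB).1
      rw [mem_ofPred_eq, φ.right_inv hu] at h
      have h' : edist x (φ.symm u) ≤ ENNReal.ofReal (3 * r) := by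
        rw [edist_comm]; exact huB
      rw [Metric.mem_closedBall, dist_comm, ← edist_le_ofReal (by positivity)]
      calc edist a u ≤ C₂ * edist x (φ.symm u) := h
        _ ≤ C₂ * ENNReal.ofReal (3 * r) := by gcongr
        _ = ENNReal.ofReal (3 * C₂ * r) := by
          rw [← ENNReal.ofReal_coe_nnreal, ← ENNReal.ofReal_mul hC₂'.le]
          congr 1; ring
    calc _ ≤ ∫⁻ u in Metric.closedBall a (3 * C₂ * r), volumeDensity n x u :=
          lintegral_mono_set hin
      _ ≤ ∫⁻ _ in Metric.closedBall a (3 * C₂ * r), 2 * d := by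
          refine setLIntegral_mono' Metric.isClosed_closedBall.measurableSet fun u hu ↦ ?_
          exact (hδs (lt_of_le_of_lt hu hr2)).2.1.le
      _ = _ := setLIntegral_const _ _
  have hlower : d / 2 * volume (Metric.closedBall a (r / C₁)) ≤
      riemVolume n M (Metric.closedEBall x (ENNReal.ofReal r)) := by
    rw [riemVolume_apply x (hmeas _) fun y hy ↦ (hsub r (by linarith) hy).2]
    have hin : Metric.closedBall a (r / C₁) ⊆
        φ.target ∩ φ.symm ⁻¹' Metric.closedEBall x (ENNReal.ofReal r) := by
      intro u hu
      obtain ⟨h1, -, -, h2⟩ := hδs (lt_of_le_of_lt hu hr3)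
      refine ⟨h1, ?_⟩
      rw [φ.right_inv h1] at h2
      rw [mem_preimage, Metric.mem_closedEBall, edist_comm]
      have h3 : edist a u ≤ ENNReal.ofReal (r / C₁) := by
        rw [edist_le_ofReal (by positivity), dist_comm]
        exact hu
      calc edist x (φ.symm u) ≤ C₁ * ENNReal.ofReal (r / C₁) := h2.trans (by gcongr)
        _ = ENNReal.ofReal r := by
          rw [← ENNReal.ofReal_coe_nnreal, ← ENNReal.ofReal_mul hC₁'.le]
          congr 1; field_simp
    calc _ = ∫⁻ _ in Metric.closedBall a (r / C₁), d / 2 := (setLIntegral_const _ _).symm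
      _ ≤ ∫⁻ u in Metric.closedBall a (r / C₁), volumeDensity n x u := by
          refine setLIntegral_mono' Metric.isClosed_closedBall.measurableSet fun u hu ↦ ?_
          exact (hδs (lt_of_le_of_lt hu hr3)).2.2.1.le
      _ ≤ _ := lintegral_mono_set hin
  have hvol : volume (Metric.closedBall a (3 * C₂ * r)) =
      ENNReal.ofReal ((3 * C₁ * C₂) ^ N) * volume (Metric.closedBall a (r / C₁)) := by
    rw [Measure.addHaar_closedBall _ _ (by positivity), Measure.addHaar_closedBall _ _
      (by positivity), ← mul_assoc, ← ENNReal.ofReal_mul (by positivity), ← mul_pow]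
    congr 3
    field_simp
  constructor
  · calc _ ≤ 2 * d * volume (Metric.closedBall a (3 * C₂ * r)) := hupper
      _ = Q * (d / 2 * volume (Metric.closedBall a (r / C₁))) := by
          have hQ' : (Q : ℝ≥0∞) = 4 * ENNReal.ofReal ((3 * C₁ * C₂) ^ N) := by
            rw [hQ, ENNReal.coe_mul]
            congr 1
            rw [← ENNReal.ofReal_coe_nnreal]
            push_cast
            rfl
          have h2d : 2 * d = 4 * (d / 2) := by
            rw [show (4 : ℝ≥0∞) = 2 * 2 by norm_num, mul_assoc,
              ENNReal.mul_div_cancel two_ne_zero ENNReal.ofNat_ne_top]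
          rw [hvol, hQ', h2d]
          ring
      _ ≤ _ := by gcongr
  · refine ne_top_of_le_ne_top ?_ hupper
    exact ENNReal.mul_ne_top (ENNReal.mul_ne_top ENNReal.ofNat_ne_top hdtop)
      (isCompact_closedBall _ _).measure_ne_top

instance isLocallyFiniteMeasure_riemVolume : IsLocallyFiniteMeasure (riemVolume n M) where
  finiteAtNhds x := by
    obtain ⟨C, R, hR, h⟩ := riemVolume_doubling (n := n) x
    refine ⟨_, Metric.closedEBall_mem_nhds x ?_, ((h (R / 2) (by positivity) (by linarith)).2).lt_top⟩
    exact ENNReal.ofReal_pos.2 (by positivity)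

end Doubling


/-! ### Vitali coverings for extended distances. -/

section Vitali

/-- The pseudometric `min (edist x y) 1`, compatible with the topology of `X`. -/
abbrev truncatedPseudoMetricSpace (X : Type*) [EMetricSpace X] : PseudoMetricSpace X :=
  PseudoMetricSpace.ofDistTopology (fun x y : X ↦ (min (edist x y) 1).toReal)
    (fun x ↦ by simp) (fun x y ↦ by rw [edist_comm])
    (fun x y z ↦ by
      have hne : ∀ a : ℝ≥0∞, min a 1 ≠ ⊤ := fun a ↦ ne_top_of_le_ne_top ENNReal.one_ne_top
        (min_le_right _ _)
      rw [← ENNReal.toReal_add (hne _) (hne _),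
        ENNReal.toReal_le_toReal (hne _) (ENNReal.add_ne_top.2 ⟨hne _, hne _⟩)]
      rcases le_total (edist x y) 1 with h1 | h1
      · rcases le_total (edist y z) 1 with h2 | h2
        · rw [min_eq_left h1, min_eq_left h2]
          exact (min_le_left _ _).trans (edist_triangle _ _ _)
        · rw [min_eq_right h2]
          exact (min_le_right _ _).trans le_add_self
      · rw [min_eq_right h1]
        exact (min_le_right _ _).trans le_self_add)
    (fun s ↦ by
      rw [EMetric.isOpen_iff]
      refine forall₂_congr fun x _ ↦ ⟨?_, ?_⟩
      · rintro ⟨ε, hε, h⟩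
        have hpos : 0 < min ε 1 := lt_min hε one_pos
        have hne : min ε 1 ≠ ⊤ := ne_top_of_le_ne_top ENNReal.one_ne_top (min_le_right _ _)
        refine ⟨(min ε 1).toReal, ENNReal.toReal_pos hpos.ne' hne, fun y hy ↦ h ?_⟩
        rw [ENNReal.toReal_lt_toReal (ne_top_of_le_ne_top ENNReal.one_ne_top (min_le_right _ _))
          hne] at hy
        rw [Metric.mem_eball, edist_comm]
        by_contra hcon
        exact absurd hy (not_lt.2 (min_le_min_right _ (not_lt.1 hcon)))
      · rintro ⟨ε, hε, h⟩
        refine ⟨ENNReal.ofReal ε, ENNReal.ofReal_pos.2 hε, fun y hy ↦ h y ?_⟩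
        rw [Metric.mem_eball, edist_comm] at hy
        rw [← ENNReal.toReal_ofReal hε.le]
        rw [ENNReal.toReal_lt_toReal (ne_top_of_le_ne_top ENNReal.one_ne_top (min_le_right _ _))
          ENNReal.ofReal_ne_top]
        exact (min_le_left _ _).trans_lt hy)

theorem closedBall_truncatedPseudoMetricSpace {X : Type*} [EMetricSpace X] (x : X) {r : ℝ}
    (h0 : 0 ≤ r) (h1 : r < 1) :
    @Metric.closedBall X (truncatedPseudoMetricSpace X) x r
      = Metric.closedEBall x (ENNReal.ofReal r) := by
  ext y
  change (min (edist y x) 1).toReal ≤ r ↔ edist y x ≤ ENNReal.ofReal r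
  rw [← ENNReal.le_ofReal_iff_toReal_le
    (ne_top_of_le_ne_top ENNReal.one_ne_top (min_le_right _ _)) h0, min_le_iff, or_iff_left]
  rw [not_le, ← ENNReal.ofReal_one]
  exact (ENNReal.ofReal_lt_ofReal_iff one_pos).2 h1

variable {X : Type*} [EMetricSpace X] [SecondCountableTopology X] [MeasurableSpace X]
  [BorelSpace X]

/-- The covering theorem is applied to a finite pseudometric, whereas the distance may be infinite
between components. Truncation at 1 keeps the topology and all closed balls of radius less than 1.
-/
theorem exists_disjoint_closedEBall_covering_ae (μ : Measure X) [IsLocallyFiniteMeasure μ]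
    (s : Set X) (C : NNReal) (P : X → ℝ → Prop)
    (hP : ∀ x ∈ s, ∀ r, 0 < r → P x r → μ (Metric.closedEBall x (ENNReal.ofReal (3 * r))) ≤
      C * μ (Metric.closedEBall x (ENNReal.ofReal r)))
    (hf : ∀ x ∈ s, ∃ᶠ r in 𝓝[>] (0 : ℝ), P x r) :
    ∃ u : Set (X × ℝ), u.Countable ∧ (∀ a ∈ u, a.1 ∈ s ∧ 0 < a.2 ∧ P a.1 a.2) ∧
      u.PairwiseDisjoint (fun a ↦ Metric.closedEBall a.1 (ENNReal.ofReal a.2)) ∧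
      μ (s \ ⋃ a ∈ u, Metric.closedEBall a.1 (ENNReal.ofReal a.2)) = 0 := by
  -- Radii stay below `1/3` so that tripled balls are still unaffected by the truncation.
  have key := @Vitali.exists_disjoint_covering_ae X (X × ℝ) (truncatedPseudoMetricSpace X)
    _ inferInstance ‹SecondCountableTopology X› μ ‹_› s
    {a | a.1 ∈ s ∧ 0 < a.2 ∧ a.2 < 1 / 3 ∧ P a.1 a.2} C (fun a ↦ a.2) (fun a ↦ a.1)
    (fun a ↦ Metric.closedEBall a.1 (ENNReal.ofReal a.2)) ?_ ?_ ?_ ?_ ?_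
  · obtain ⟨u, hut, huc, hud, hu0⟩ := key
    exact ⟨u, huc, fun a ha ↦ ⟨(hut ha).1, (hut ha).2.1, (hut ha).2.2.2⟩, hud, hu0⟩
  · rintro ⟨x, r⟩ ⟨-, hr0, hr1, -⟩
    exact (closedBall_truncatedPseudoMetricSpace x hr0.le (by simp only at hr1; linarith)).ge
  · rintro ⟨x, r⟩ ⟨hx, hr0, hr1, hPr⟩
    simp only at hx hr0 hr1 hPr ⊢
    rw [closedBall_truncatedPseudoMetricSpace x (by linarith) (by linarith)]
    exact hP x hx r hr0 hPr
  · rintro ⟨x, r⟩ ⟨hx, hr0, hr1, hPr⟩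
    refine ⟨x, mem_interior_iff_mem_nhds.2 ?_⟩
    exact Metric.closedEBall_mem_nhds x (ENNReal.ofReal_pos.2 hr0)
  · rintro ⟨x, r⟩ -
    exact Metric.isClosed_closedEBall
  · intro x hx ε hε
    have h1 : ∀ᶠ r in 𝓝[>] (0 : ℝ), 0 < r ∧ r < min ε (1 / 3) := by
      exact Ioo_mem_nhdsGT (lt_min hε (by norm_num))
    obtain ⟨r, hPr, hr0, hr1⟩ := ((hf x hx).and_eventually h1).exists
    exact ⟨(x, r), ⟨hx, hr0, hr1.trans_le (min_le_right _ _), hPr⟩,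
      (hr1.trans_le (min_le_left _ _)).le, rfl⟩

end Vitali

/-! ### The volume derivative `J` controls the volume of images. -/

section Jacobian

variable {X Y : Type*} [EMetricSpace X] [SecondCountableTopology X] [MeasurableSpace X]
  [BorelSpace X] [MeasurableSpace Y] {v : Measure X} {w : Measure Y}
  [IsLocallyFiniteMeasure v] {f : X → Y} {D : Set X}

omit [SecondCountableTopology X] in
-- `J` is defined through open balls, the covering uses closed ones. A closed ball lies in the open
-- balls of slightly larger radius, whose volumes are bounded by those of closed balls decreasing to
-- the original one. Property `N` handles balls of volume zero, where the quotient carries no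
-- information.
theorem eventually_measure_image_closedEBall_le (hDo : IsOpen D) (hN : LuzinN v w f D) {x : X}
    (hx : x ∈ D) {q : ℝ≥0∞} (hq : q ≠ ⊤) (hJ : jacobian v w f x < q) :
    ∀ᶠ r in 𝓝[>] (0 : ℝ), w (f '' Metric.closedEBall x (ENNReal.ofReal r)) ≤
      q * v (Metric.closedEBall x (ENNReal.ofReal r)) := by
  have h1 := eventually_lt_of_limsup_lt hJ
  obtain ⟨U, hUx, hUt⟩ := v.finiteAt_nhds x
  obtain ⟨ε, hε, hεU⟩ := EMetric.mem_nhds_iff.1 (inter_mem hUx (hDo.mem_nhds hx))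
  obtain ⟨η, hη, hηε⟩ : ∃ η : ℝ, 0 < η ∧ ENNReal.ofReal η ≤ ε := by
    obtain ⟨δ, hδ, hδε⟩ := ENNReal.lt_iff_exists_nnreal_btwn.1 hε
    exact ⟨δ, by exact_mod_cast hδ, by simpa using hδε.le⟩
  obtain ⟨R, hR, hR'⟩ := (mem_nhdsGT_iff_exists_Ioo_subset).1 h1
  simp only [mem_Ioi] at hR
  filter_upwards [Ioo_mem_nhdsGT (lt_min hR hη)] with r hr
  have hrR : r < R := hr.2.trans_le (min_le_left _ _)
  have hrη : r < η := hr.2.trans_le (min_le_right _ _)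
  have hfin : ∀ r', r' < η → v (Metric.closedEBall x (ENNReal.ofReal r')) ≠ ⊤ := by
    intro r' hr'
    refine ne_top_of_le_ne_top hUt.ne (measure_mono fun y hy ↦ (hεU ?_).1)
    exact Metric.mem_eball.2 (lt_of_le_of_lt (Metric.mem_closedEBall.1 hy)
      (((ENNReal.ofReal_lt_ofReal_iff hη).2 hr').trans_le hηε))
  have hlim : Tendsto (fun r' : ℝ ↦ q * v (Metric.closedEBall x (ENNReal.ofReal r')))
      (𝓝[>] r) (𝓝 (q * v (Metric.closedEBall x (ENNReal.ofReal r)))) := by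
    refine ENNReal.Tendsto.const_mul ?_ (Or.inr hq)
    have h2 := tendsto_measure_biInter_gt (μ := v) (a := r)
      (s := fun r' : ℝ ↦ Metric.closedEBall x (ENNReal.ofReal r'))
      (fun i _ ↦ Metric.isClosed_closedEBall.measurableSet.nullMeasurableSet)
      (fun i j _ hij ↦ Metric.closedEBall_subset_closedEBall (ENNReal.ofReal_le_ofReal hij))
      ⟨(r + η) / 2, by linarith, hfin _ (by linarith)⟩
    have hset : Metric.closedEBall x (ENNReal.ofReal r)
        = ⋂ r' > r, Metric.closedEBall x (ENNReal.ofReal r') := by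
      ext y
      simp only [Metric.mem_closedEBall, mem_iInter]
      refine ⟨fun h i hi ↦ h.trans (ENNReal.ofReal_le_ofReal hi.le), fun h ↦ ?_⟩
      have hc : Tendsto (fun i : ℝ ↦ ENNReal.ofReal i) (𝓝[>] r) (𝓝 (ENNReal.ofReal r)) :=
        (ENNReal.continuous_ofReal.tendsto r).mono_left nhdsWithin_le_nhds
      exact ge_of_tendsto hc (by filter_upwards [self_mem_nhdsWithin] with i hi using h i hi)
    rw [hset]
    exact h2
  refine ge_of_tendsto hlim ?_
  filter_upwards [Ioo_mem_nhdsGT (lt_min hrR hrη)] with r' hr'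
  have hr'0 : 0 < r' := hr.1.trans hr'.1
  have h3 : w (f '' Metric.eball x (ENNReal.ofReal r')) /
      v (Metric.eball x (ENNReal.ofReal r')) ≤ q :=
    le_of_lt (hR' ⟨hr'0, hr'.2.trans_le (min_le_left _ _)⟩)
  have hsub : Metric.eball x (ENNReal.ofReal r') ⊆ Metric.closedEBall x (ENNReal.ofReal r') :=
    Metric.eball_subset_closedEBall
  have h4 : w (f '' Metric.eball x (ENNReal.ofReal r')) ≤
      q * v (Metric.eball x (ENNReal.ofReal r')) := by
    rcases eq_or_ne (v (Metric.eball x (ENNReal.ofReal r'))) 0 with h0 | h0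
    · rw [hN _ (fun y hy ↦ (hεU (Metric.eball_subset_eball ?_ hy)).2) h0]
      · exact zero_le
      · exact (ENNReal.ofReal_le_ofReal (hr'.2.trans_le (min_le_right _ _)).le).trans hηε
    · refine (ENNReal.div_le_iff_le_mul (Or.inl h0) (Or.inl (ne_top_of_le_ne_top
        (hfin r' (hr'.2.trans_le (min_le_right _ _))) (measure_mono hsub)))).1 h3
  refine (measure_mono (image_mono ?_)).trans (h4.trans (by gcongr))
  intro y hy
  exact Metric.mem_eball.2 (lt_of_le_of_lt (Metric.mem_closedEBall.1 hy)
    ((ENNReal.ofReal_lt_ofReal_iff hr'0).2 hr'.1))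

/-- Inside an open `U ⊇ S`, cover almost all of `S` by disjoint closed balls on which the image
estimate holds; the uncovered null set has null image by property `N`. Sum up and shrink `U` to `S`.
-/
theorem measure_image_le_of_jacobian_lt (hDo : IsOpen D) (hN : LuzinN v w f D)
    (hdbl : ∀ x : X, ∃ C : NNReal, ∃ R > (0 : ℝ), ∀ r, 0 < r → r < R →
      v (Metric.closedEBall x (ENNReal.ofReal (3 * r))) ≤
        C * v (Metric.closedEBall x (ENNReal.ofReal r)))
    {S : Set X} (hS : S ⊆ D) {q : ℝ≥0∞} (hq : q ≠ ⊤) (hJ : ∀ x ∈ S, jacobian v w f x < q) :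
    w (f '' S) ≤ q * v S := by
  -- The doubling constant and scale depend on the point, so `S` is exhausted by sets where they are
  -- uniform. Continuity of outer measure along increasing unions requires no measurability of them.
  let T : ℕ → Set X := fun k ↦ {x | x ∈ S ∧ ∀ r, 0 < r → r < 1 / ((k : ℝ) + 1) →
      v (Metric.closedEBall x (ENNReal.ofReal (3 * r))) ≤
        ((k : NNReal) : ℝ≥0∞) * v (Metric.closedEBall x (ENNReal.ofReal r))}
  have hTS : ⋃ k, T k = S := by
    refine subset_antisymm (iUnion_subset fun k x hx ↦ hx.1) fun x hx ↦ ?_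
    obtain ⟨C, R, hR, h⟩ := hdbl x
    obtain ⟨k₁, hk₁⟩ := exists_nat_ge C
    obtain ⟨k₂, hk₂⟩ := exists_nat_one_div_lt hR
    refine mem_iUnion.2 ⟨max k₁ k₂, hx, fun r hr hr' ↦ (h r hr ?_).trans ?_⟩
    · refine hr'.trans (lt_of_le_of_lt ?_ hk₂)
      apply one_div_le_one_div_of_le (by positivity)
      gcongr
      exact le_max_right _ _
    · gcongr
      refine hk₁.trans ?_
      exact_mod_cast le_max_left _ _
  have hTm : Monotone T := by
    intro k l hkl x hx
    refine ⟨hx.1, fun r hr hr' ↦ (hx.2 r hr (hr'.trans_le ?_)).trans ?_⟩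
    · apply one_div_le_one_div_of_le (by positivity)
      gcongr
    · gcongr
  have hTm' : Monotone fun k ↦ f '' T k := fun k l h ↦ image_mono (hTm h)
  rw [← hTS, image_iUnion, hTm'.measure_iUnion]
  refine iSup_le fun k ↦ ?_
  refine le_trans ?_ (mul_le_mul_right (measure_mono (subset_iUnion T k)) q)
  rcases (T k).eq_empty_or_nonempty with he | ⟨x₁, hx₁⟩
  · simp [he]
  have hq0 : q ≠ 0 := (lt_of_le_of_lt zero_le (hJ x₁ hx₁.1)).ne'
  have hopen : ∀ U, IsOpen U → T k ⊆ U → w (f '' T k) ≤ q * v U := by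
    intro U hU hTU
    obtain ⟨u, huc, hu, hud, hu0⟩ := exists_disjoint_closedEBall_covering_ae v (T k) (k : NNReal)
      (fun x r ↦ r < 1 / ((k : ℝ) + 1) ∧ Metric.closedEBall x (ENNReal.ofReal r) ⊆ U ∧
        w (f '' Metric.closedEBall x (ENNReal.ofReal r)) ≤
          q * v (Metric.closedEBall x (ENNReal.ofReal r)))
      (fun x hx r hr hP ↦ hx.2 r hr hP.1) (fun x hx ↦ by
        refine Eventually.frequently ?_
        refine Eventually.and ?_ (Eventually.and ?_
          (eventually_measure_image_closedEBall_le hDo hN (hS hx.1) hq (hJ x hx.1)))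
        · filter_upwards [Ioo_mem_nhdsGT (show (0 : ℝ) < 1 / ((k : ℝ) + 1) by positivity)]
            with r hr using hr.2
        · obtain ⟨ε, hε, hεU⟩ := EMetric.mem_nhds_iff.1 (hU.mem_nhds (hTU hx))
          have hc : Tendsto (fun i : ℝ ↦ ENNReal.ofReal i) (𝓝[>] 0) (𝓝 (ENNReal.ofReal 0)) :=
            (ENNReal.continuous_ofReal.tendsto 0).mono_left nhdsWithin_le_nhds
          rw [ENNReal.ofReal_zero] at hc
          filter_upwards [hc.eventually (gt_mem_nhds hε)] with r hr y hy
          exact hεU (Metric.mem_eball.2 (lt_of_le_of_lt (Metric.mem_closedEBall.1 hy) hr)))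
    have := huc.to_subtype
    have h1 : w (f '' (T k \ ⋃ a ∈ u, Metric.closedEBall a.1 (ENNReal.ofReal a.2))) = 0 :=
      hN _ (sdiff_subset.trans fun x hx ↦ hS hx.1) hu0
    calc w (f '' T k)
        ≤ w (f '' (T k \ ⋃ a ∈ u, Metric.closedEBall a.1 (ENNReal.ofReal a.2)) ∪
            ⋃ a ∈ u, f '' Metric.closedEBall a.1 (ENNReal.ofReal a.2)) := by
          refine measure_mono ?_
          rintro _ ⟨x, hx, rfl⟩
          by_cases hxu : x ∈ ⋃ a ∈ u, Metric.closedEBall a.1 (ENNReal.ofReal a.2)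
          · right
            obtain ⟨a, ha, hxa⟩ := mem_iUnion₂.1 hxu
            exact mem_iUnion₂.2 ⟨a, ha, mem_image_of_mem _ hxa⟩
          · exact Or.inl ⟨x, ⟨hx, hxu⟩, rfl⟩
      _ ≤ 0 + ∑' a : u, w (f '' Metric.closedEBall a.1.1 (ENNReal.ofReal a.1.2)) := by
          refine (measure_union_le _ _).trans ?_
          rw [h1]
          gcongr
          exact measure_biUnion_le w huc _
      _ ≤ ∑' a : u, q * v (Metric.closedEBall a.1.1 (ENNReal.ofReal a.1.2)) := by
          rw [zero_add]
          exact ENNReal.tsum_le_tsum fun a ↦ (hu a.1 a.2).2.2.2.2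
      _ = q * v (⋃ a ∈ u, Metric.closedEBall a.1 (ENNReal.ofReal a.2)) := by
          rw [ENNReal.tsum_mul_left, measure_biUnion huc hud
            (fun a _ ↦ Metric.isClosed_closedEBall.measurableSet)]
      _ ≤ q * v U := by
          gcongr
          exact iUnion₂_subset fun a ha ↦ (hu a ha).2.2.2.1
  rw [mul_comm, ← ENNReal.div_le_iff_le_mul (Or.inl hq0) (Or.inl hq)]
  refine le_of_forall_gt_imp_ge_of_dense fun r hr ↦ ?_
  obtain ⟨U, hTU, hU, hUr⟩ := Set.exists_isOpen_lt_of_lt (T k) r hr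
  rw [ENNReal.div_le_iff_le_mul (Or.inl hq0) (Or.inl hq), mul_comm]
  exact (hopen U hU hTU).trans (by gcongr)

/-- The pullback `ν(A) = w(f(E ∩ A))` is absolutely continuous by property `N`. Its density exceeds
`J` only on a null set, since `J < a < b < g` on `S` would give `b v(S) ≤ a v(S)`. -/
theorem lintegral_extend_le (hDo : IsOpen D) (hN : LuzinN v w f D)
    (hdbl : ∀ x : X, ∃ C : NNReal, ∃ R > (0 : ℝ), ∀ r, 0 < r → r < R →
      v (Metric.closedEBall x (ENNReal.ofReal (3 * r))) ≤
        C * v (Metric.closedEBall x (ENNReal.ofReal r)))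
    {E : Set X} (hE : MeasurableSet E) (hED : E ⊆ D) (hvE : v E ≠ ⊤) (hwE : w (f '' E) ≠ ⊤)
    (he : MeasurableEmbedding (fun x : E ↦ f x)) {h : X → ℝ≥0∞} (hh : Measurable h) :
    ∫⁻ y, extend (fun x : E ↦ f x) (fun x : E ↦ h x) 0 y ∂w ≤
      ∫⁻ x in E, h x * jacobian v w f x ∂v := by
  set e : E → Y := fun x ↦ f x with hedef
  set ν : Measure X := (Measure.comap e w).map Subtype.val with hν
  have hval : MeasurableEmbedding (Subtype.val : E → X) := MeasurableEmbedding.subtype_coe hE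
  have hνA : ∀ A, ν A = w (f '' (E ∩ A)) := by
    intro A
    rw [hν, hval.map_apply, he.comap_apply]
    congr 1
    ext y
    simp only [mem_image, mem_preimage, Subtype.exists, mem_inter_iff, hedef]
    constructor
    · rintro ⟨x, hx, hxA, rfl⟩
      exact ⟨x, ⟨hx, hxA⟩, rfl⟩
    · rintro ⟨x, ⟨hx, hxA⟩, rfl⟩
      exact ⟨x, hx, hxA, rfl⟩
  have : IsFiniteMeasure ν := ⟨by rw [hνA, inter_univ]; exact hwE.lt_top⟩
  have : IsFiniteMeasure (v.restrict E) :=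
    ⟨by rw [Measure.restrict_apply_univ]; exact hvE.lt_top⟩
  have hac : ν ≪ v.restrict E := by
    intro A hA
    rw [Measure.restrict_apply' hE] at hA
    rw [hνA]
    exact hN _ (inter_subset_left.trans hED) (by rwa [inter_comm])
  set g := ν.rnDeriv (v.restrict E) with hg
  have hgm : Measurable g := Measure.measurable_rnDeriv _ _
  have hwd : (v.restrict E).withDensity g = ν := Measure.withDensity_rnDeriv_eq _ _ hac
  have hgJ : ∀ᵐ x ∂v.restrict E, g x ≤ jacobian v w f x := by
    have hnull : ∀ a b : NNReal, a < b →
        v {x | x ∈ E ∧ jacobian v w f x < a ∧ (b : ℝ≥0∞) < g x} = 0 := by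
      intro a b hab
      set S := {x | x ∈ E ∧ jacobian v w f x < a ∧ (b : ℝ≥0∞) < g x} with hS
      have hSE : S ⊆ E := fun x hx ↦ hx.1
      have h1 : w (f '' S) ≤ a * v S :=
        measure_image_le_of_jacobian_lt hDo hN hdbl (hSE.trans hED) ENNReal.coe_ne_top
          (fun x hx ↦ hx.2.1)
      -- `J` is not known to be measurable, so `S` is enlarged to the measurable set `S'` on which
      -- still `g > b` and whose image stays within a hull of `f '' S` of equal measure.
      set T := toMeasurable w (f '' S) with hT
      set S' := {x | (b : ℝ≥0∞) < g x} ∩ Subtype.val '' (e ⁻¹' T) with hS'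
      have hS'm : MeasurableSet S' := (measurableSet_lt measurable_const hgm).inter
        (hval.measurableSet_image.2 (he.measurable (measurableSet_toMeasurable _ _)))
      have hSS' : S ⊆ S' := fun x hx ↦ ⟨hx.2.2, ⟨x, hx.1⟩,
        subset_toMeasurable _ _ (mem_image_of_mem f hx), rfl⟩
      have hS'E : S' ⊆ E := by
        rintro x ⟨-, x', -, rfl⟩
        exact x'.2
      have h2 : b * v S' ≤ ν S' := by
        rw [← hwd, withDensity_apply _ hS'm, Measure.restrict_restrict hS'm,
          inter_eq_left.2 hS'E, ← setLIntegral_const]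
        exact setLIntegral_mono hgm fun x hx ↦ le_of_lt hx.1
      have h3 : ν S' ≤ w (f '' S) := by
        rw [hνA, ← measure_toMeasurable (f '' S)]
        refine measure_mono ?_
        rintro _ ⟨x, ⟨-, -, x', hx', rfl⟩, rfl⟩
        exact hx'
      have h4 : b * v S ≤ a * v S := calc
        b * v S ≤ b * v S' := by gcongr
        _ ≤ a * v S := h2.trans (h3.trans h1)
      by_contra hne
      have hfin : v S ≠ ⊤ := ne_top_of_le_ne_top hvE (measure_mono hSE)
      rw [mul_comm _ (v S), mul_comm _ (v S), ENNReal.mul_le_mul_iff_right hne hfin] at h4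
      exact absurd (ENNReal.coe_le_coe.1 h4) (not_le.2 hab)
    rw [ae_restrict_iff' hE, ae_iff]
    have hcount : v (⋃ q : ℚ × ℚ, {x | x ∈ E ∧ (Real.toNNReal q.1 < Real.toNNReal q.2) ∧
        jacobian v w f x < Real.toNNReal q.1 ∧ ((Real.toNNReal q.2 : NNReal) : ℝ≥0∞) < g x})
        = 0 := by
      refine measure_iUnion_null fun q ↦ ?_
      by_cases hq : Real.toNNReal q.1 < Real.toNNReal q.2
      · refine measure_mono_null ?_ (hnull _ _ hq)
        rintro x ⟨h1, -, h2⟩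
        exact ⟨h1, h2⟩
      · simp [hq]
    refine measure_mono_null (fun x hx ↦ ?_) hcount
    simp only [mem_ofPred_eq, Classical.not_imp, not_le] at hx
    obtain ⟨q₁, -, h1, h2⟩ := ENNReal.lt_iff_exists_rat_btwn.1 hx.2
    obtain ⟨q₂, -, h3, h4⟩ := ENNReal.lt_iff_exists_rat_btwn.1 h2
    exact mem_iUnion.2 ⟨(q₁, q₂), hx.1, ENNReal.coe_lt_coe.1 h3, h1, h4⟩
  calc ∫⁻ y, extend e (fun x : E ↦ h x) 0 y ∂w
      = ∫⁻ y in range e, extend e (fun x : E ↦ h x) 0 y ∂w := by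
        refine (setLIntegral_eq_of_support_subset ?_).symm
        intro y hy
        by_contra hcon
        exact hy (extend_apply' _ _ _ hcon)
    _ = ∫⁻ x : E, h x ∂(Measure.comap e w) := by
        rw [← he.map_comap, he.lintegral_map]
        exact lintegral_congr fun x ↦ he.injective.extend_apply _ _ _
    _ = ∫⁻ x, h x ∂ν := (hval.lintegral_map _).symm
    _ = ∫⁻ x in E, g x * h x ∂v := by
        rw [← hwd, lintegral_withDensity_eq_lintegral_mul _ hgm hh]
        rfl
    _ ≤ ∫⁻ x in E, h x * jacobian v w f x ∂v := by
        refine lintegral_mono_ae ?_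
        filter_upwards [hgJ] with x hx
        rw [mul_comm]
        gcongr

end Jacobian


/-! ### Regular and singular points of `f`. -/

section ChartExpression

theorem _root_.ContinuousLinearMap.exists_mul_norm_le {E F : Type*} [NormedAddCommGroup E]
    [NormedSpace ℝ E] [FiniteDimensional ℝ E] [NormedAddCommGroup F] [NormedSpace ℝ F]
    (A : E →L[ℝ] F) (hA : Injective A) : ∃ c > 0, ∀ x, c * ‖x‖ ≤ ‖A x‖ := by
  obtain ⟨K, hK, h⟩ := (LinearMap.injective_iff_antilipschitz (A : E →ₗ[ℝ] F)).1 hA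
  have hK' : (0 : ℝ) < K := hK
  refine ⟨(K : ℝ)⁻¹, by positivity, fun x ↦ ?_⟩
  have h1 := h.le_mul_dist x 0
  simp only [dist_zero_right, map_zero, ContinuousLinearMap.coe_coe] at h1
  rw [inv_mul_le_iff₀ hK']
  exact h1

variable {n : ℕ} {M : Type*} [TopologicalSpace M] [ChartedSpace (EuclideanSpace ℝ (Fin n)) M]
  [IsManifold (𝓡 n) ∞ M] {N : Type*} [TopologicalSpace N]
  [ChartedSpace (EuclideanSpace ℝ (Fin n)) N] [IsManifold (𝓡 n) ∞ N]

theorem bijective_mfderiv_extChartAt {x₀ x : M} (hx : x ∈ (extChartAt (𝓡 n) x₀).source) :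
    Bijective (mfderiv (𝓡 n) (𝓡 n) (extChartAt (𝓡 n) x₀) x) :=
  (isInvertible_mfderiv_extChartAt (I := 𝓡 n) hx).bijective

theorem bijective_mfderiv_extChartAt_symm {x₀ : M} {u : EuclideanSpace ℝ (Fin n)}
    (hu : u ∈ (extChartAt (𝓡 n) x₀).target) :
    Bijective (mfderiv (𝓡 n) (𝓡 n) (extChartAt (𝓡 n) x₀).symm u) := by
  have := isInvertible_mfderivWithin_extChartAt_symm (I := 𝓡 n) hu
  rw [ModelWithCorners.range_eq_univ, mfderivWithin_univ] at this
  exact this.bijective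

theorem exists_hasFDerivAt_chart {f : M → N} {x₀ x : M} {y₀ : N}
    (hx : x ∈ (extChartAt (𝓡 n) x₀).source) (hy : f x ∈ (extChartAt (𝓡 n) y₀).source)
    (hf : MDifferentiableAt (𝓡 n) (𝓡 n) f x) :
    ∃ A : EuclideanSpace ℝ (Fin n) →L[ℝ] EuclideanSpace ℝ (Fin n),
      HasFDerivAt (fun u ↦ extChartAt (𝓡 n) y₀ (f ((extChartAt (𝓡 n) x₀).symm u))) A
        (extChartAt (𝓡 n) x₀ x) ∧
      (Bijective A ↔ Bijective (mfderiv (𝓡 n) (𝓡 n) f x)) := by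
  have hu := (extChartAt (𝓡 n) x₀).map_source hx
  have hxu := (extChartAt (𝓡 n) x₀).left_inv hx
  have h1 := (mdifferentiableAt_extChartAt_symm hu).hasMFDerivAt
  have h2 := hf.hasMFDerivAt
  have h3 := (mdifferentiableAt_extChartAt' hy).hasMFDerivAt
  rw [← hxu] at h2 h3
  have h4 := HasMFDerivAt.comp (f := f ∘ (extChartAt (𝓡 n) x₀).symm) (extChartAt (𝓡 n) x₀ x)
    h3 (h2.comp _ h1)
  refine ⟨_, h4.hasFDerivAt, ?_⟩
  have hb1 := bijective_mfderiv_extChartAt_symm hu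
  have hb3 := bijective_mfderiv_extChartAt hy
  rw [← hxu] at hb3
  have e1 : Bijective (mfderiv (𝓡 n) (𝓡 n) f x) ↔ Bijective (mfderiv (𝓡 n) (𝓡 n) f
      ((extChartAt (𝓡 n) x₀).symm (extChartAt (𝓡 n) x₀ x))) := by rw [hxu]
  rw [e1]
  exact (Bijective.of_comp_iff' hb3 _).trans (Bijective.of_comp_iff _ hb1)

end ChartExpression

section Singular

variable {n : ℕ} {M : Type*} [TopologicalSpace M] [SecondCountableTopology M]
  [ChartedSpace (EuclideanSpace ℝ (Fin n)) M]
  [IsManifold (𝓡 n) ∞ M] {N : Type*} [EMetricSpace N] [SecondCountableTopology N]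
  [ChartedSpace (EuclideanSpace ℝ (Fin n)) N] [IsManifold (𝓡 n) ∞ N]
  [Bundle.RiemannianBundle (fun x : N ↦ TangentSpace (𝓡 n) x)]
  [MeasurableSpace N] [BorelSpace N]

/-- In equal dimensions the easy case of Sard's theorem needs only differentiability at the points
concerned: images of sets where the determinant vanishes are null. Countably many charts suffice. -/
theorem riemVolume_image_singular {D : Set M} (hDo : IsOpen D) {f : M → N}
    (hcont : ContinuousOn f D) :
    riemVolume n N (f '' {x | x ∈ D ∧ MDifferentiableAt (𝓡 n) (𝓡 n) f x ∧
      ¬ Bijective (mfderiv (𝓡 n) (𝓡 n) f x)}) = 0 := by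
  set S := {x | x ∈ D ∧ MDifferentiableAt (𝓡 n) (𝓡 n) f x ∧
      ¬ Bijective (mfderiv (𝓡 n) (𝓡 n) f x)} with hS
  let W : M → Set M := fun x ↦ (extChartAt (𝓡 n) x).source ∩
    f ⁻¹' (extChartAt (𝓡 n) (f x)).source
  obtain ⟨t, htD, htc, ht⟩ := TopologicalSpace.countable_cover_nhdsWithin (f := W) (s := D) (fun x hx ↦
    mem_nhdsWithin_of_mem_nhds (inter_mem (extChartAt_source_mem_nhds x)
      ((hcont.continuousAt (hDo.mem_nhds hx)).preimage_mem_nhds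
        (extChartAt_source_mem_nhds (f x)))))
  have hsub : f '' S ⊆ ⋃ x ∈ t, f '' (S ∩ W x) := by
    rintro _ ⟨x, hx, rfl⟩
    obtain ⟨x₀, hx₀, hxW⟩ := mem_iUnion₂.1 (ht hx.1)
    exact mem_iUnion₂.2 ⟨x₀, hx₀, mem_image_of_mem f ⟨hx, hxW⟩⟩
  refine measure_mono_null hsub ((measure_biUnion_null_iff htc).2 fun x₀ hx₀ ↦ ?_)
  refine riemVolume_eq_zero_of_image (f x₀) ?_ ?_
  · rintro _ ⟨x, hx, rfl⟩
    exact hx.2.2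
  · have hkey : ∀ u ∈ extChartAt (𝓡 n) x₀ '' (S ∩ W x₀),
        ∃ A : EuclideanSpace ℝ (Fin n) →L[ℝ] EuclideanSpace ℝ (Fin n),
        HasFDerivAt (fun u ↦ extChartAt (𝓡 n) (f x₀) (f ((extChartAt (𝓡 n) x₀).symm u))) A u ∧
        A.det = 0 := by
      rintro _ ⟨x, ⟨⟨-, hxd, hxb⟩, hxs, hxs'⟩, rfl⟩
      obtain ⟨A, hA, hAb⟩ := exists_hasFDerivAt_chart hxs hxs' hxd
      refine ⟨A, hA, ?_⟩
      by_contra hdet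
      refine hxb (hAb.1 ?_)
      have hunit : IsUnit (LinearMap.det (A : EuclideanSpace ℝ (Fin n) →ₗ[ℝ] _)) :=
        isUnit_iff_ne_zero.2 hdet
      exact (LinearEquiv.ofIsUnitDet (v := (EuclideanSpace.basisFun (Fin n) ℝ).toBasis)
        (v' := (EuclideanSpace.basisFun (Fin n) ℝ).toBasis)
        (f := (A : EuclideanSpace ℝ (Fin n) →ₗ[ℝ] EuclideanSpace ℝ (Fin n)))
        (by rwa [LinearMap.det_toMatrix])).bijective
    choose! A hA hdet using hkey
    have h0 := addHaar_image_eq_zero_of_det_fderivWithin_eq_zero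
      (volume : Measure (EuclideanSpace ℝ (Fin n)))
      (fun u hu ↦ (hA u hu).hasFDerivWithinAt) hdet
    rw [image_image] at h0
    rw [image_image]
    convert h0 using 2
    refine image_congr fun x hx ↦ ?_
    rw [(extChartAt (𝓡 n) x₀).left_inv hx.2.1]

end Singular

section Stretch

open scoped NNReal

variable {n : ℕ} {M : Type*} [EMetricSpace M] [ChartedSpace (EuclideanSpace ℝ (Fin n)) M]
  [IsManifold (𝓡 n) ∞ M] [Bundle.RiemannianBundle (fun x : M ↦ TangentSpace (𝓡 n) x)]
  [IsContMDiffRiemannianBundle (𝓡 n) ∞ (EuclideanSpace ℝ (Fin n))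
      (fun x : M ↦ TangentSpace (𝓡 n) x)]
  [IsRiemannianManifold (𝓡 n) M]
  {N : Type*} [EMetricSpace N] [ChartedSpace (EuclideanSpace ℝ (Fin n)) N]
  [IsManifold (𝓡 n) ∞ N] [Bundle.RiemannianBundle (fun x : N ↦ TangentSpace (𝓡 n) x)]
  [IsContMDiffRiemannianBundle (𝓡 n) ∞ (EuclideanSpace ℝ (Fin n))
      (fun x : N ↦ TangentSpace (𝓡 n) x)]
  [IsRiemannianManifold (𝓡 n) N]

/-- In charts the derivative expands by at least `c` and the remainder is at most `c/2` times the
displacement, so `f` expands by at least `c/2`; `C₁` and `C₂` convert chart distances. -/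
theorem minStretch_pos {f : M → N} {x : M} (hf : MDifferentiableAt (𝓡 n) (𝓡 n) f x)
    (hbij : Bijective (mfderiv (𝓡 n) (𝓡 n) f x)) : 0 < minStretch f x := by
  obtain ⟨C₁, hC₁, h₁⟩ := eventually_edist_le_edist_extChartAt (n := n) x
  obtain ⟨C₂, hC₂, h₂⟩ := eventually_edist_extChartAt_le_edist (n := n) (f x)
  obtain ⟨A, hA, hAb⟩ := exists_hasFDerivAt_chart (mem_extChartAt_source (I := 𝓡 n) x)
    (mem_extChartAt_source (I := 𝓡 n) (f x)) hf
  obtain ⟨c, hc, hcA⟩ := A.exists_mul_norm_le (hAb.2 hbij).1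
  have h3 := hA.isLittleO.def (half_pos hc)
  have hK : (0 : ℝ) < C₁ * (2 / c) * C₂ := by
    have : (0 : ℝ) < C₁ := hC₁
    have : (0 : ℝ) < C₂ := hC₂
    positivity
  set K : ℝ≥0 := ⟨C₁ * (2 / c) * C₂, hK.le⟩ with hKdef
  have hev : ∀ᶠ y in 𝓝[≠] x, (K : ℝ≥0∞)⁻¹ ≤ edist (f x) (f y) / edist x y := by
    have h2' := hf.continuousAt.eventually h₂
    have h3' := (continuousAt_extChartAt (I := 𝓡 n) x).eventually h3
    have hs := extChartAt_source_mem_nhds (I := 𝓡 n) x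
    filter_upwards [mem_nhdsWithin_of_mem_nhds h₁, mem_nhdsWithin_of_mem_nhds h2',
      mem_nhdsWithin_of_mem_nhds h3', mem_nhdsWithin_of_mem_nhds hs, self_mem_nhdsWithin]
      with y hy1 hy2 hy3 hys hyx
    have h0 : edist x y ≠ 0 := fun h ↦ hyx (edist_eq_zero.1 h).symm
    have hxl := (extChartAt (𝓡 n) x).left_inv hys
    have hxl' := (extChartAt (𝓡 n) x).left_inv (mem_extChartAt_source (I := 𝓡 n) x)
    rw [hxl, hxl'] at hy3
    set u := extChartAt (𝓡 n) x y
    set u₀ := extChartAt (𝓡 n) x x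
    set z := extChartAt (𝓡 n) (f x) (f y)
    set z₀ := extChartAt (𝓡 n) (f x) (f x)
    have h5 : ‖u - u₀‖ ≤ 2 / c * ‖z - z₀‖ := by
      have h6 := hcA (u - u₀)
      have h7 : ‖A (u - u₀)‖ ≤ ‖z - z₀‖ + ‖z - z₀ - A (u - u₀)‖ := by
        have := norm_sub_le (z - z₀) (z - z₀ - A (u - u₀))
        rwa [sub_sub_cancel] at this
      rw [div_mul_eq_mul_div, le_div_iff₀ hc]
      linarith
    have h6 : edist u₀ u ≤ ENNReal.ofReal (2 / c) * edist z₀ z := by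
      rw [edist_comm u₀, edist_comm z₀, edist_dist, edist_dist, dist_eq_norm, dist_eq_norm,
        ← ENNReal.ofReal_mul (by positivity)]
      exact ENNReal.ofReal_le_ofReal h5
    have h7 : edist x y ≤ K * edist (f x) (f y) := calc
      edist x y ≤ C₁ * (ENNReal.ofReal (2 / c) * (C₂ * edist (f x) (f y))) := by
        refine hy1.trans ?_
        gcongr
        refine h6.trans ?_
        gcongr
      _ = K * edist (f x) (f y) := by
        have : (K : ℝ≥0∞) = C₁ * ENNReal.ofReal (2 / c) * C₂ := by
          rw [ENNReal.coe_nnreal_eq K, hKdef]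
          change ENNReal.ofReal (C₁ * (2 / c) * C₂) = _
          rw [ENNReal.ofReal_mul (by positivity), ENNReal.ofReal_mul (by positivity),
            ENNReal.ofReal_coe_nnreal, ENNReal.ofReal_coe_nnreal]
        rw [this]
        ring
    have hKe : (K : ℝ≥0∞) ≠ 0 := by
      simpa using (show (0 : ℝ≥0) < K from hK).ne'
    by_cases ht : edist x y = ⊤
    · have hu : edist u₀ u ≠ ⊤ := edist_ne_top _ _
      rw [ht] at hy1
      exact absurd (top_le_iff.1 hy1) (ENNReal.mul_ne_top ENNReal.coe_ne_top hu)
    · rw [ENNReal.le_div_iff_mul_le (Or.inl h0) (Or.inl ht)]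
      rw [ENNReal.inv_mul_le_iff hKe ENNReal.coe_ne_top]
      exact h7
  refine lt_of_lt_of_le (ENNReal.inv_pos.2 ENNReal.coe_ne_top) (le_liminf_of_le ?_ hev)
  isBoundedDefault

end Stretch

/-! ### Local index at regular points. -/

section Index

variable {n : ℕ} {M : Type*} [TopologicalSpace M] [T2Space M]
  [ChartedSpace (EuclideanSpace ℝ (Fin n)) M] [IsManifold (𝓡 n) ∞ M]
  {N : Type*} [TopologicalSpace N] [ChartedSpace (EuclideanSpace ℝ (Fin n)) N]
  [IsManifold (𝓡 n) ∞ N]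

/-- Near `x` the segment homotopy, in the target chart, from `f` to its affine approximation takes
the value `f x` only at `x`. So the degree is the sign of an invertible derivative, and preservation
of sense rules out `-1`. -/
theorem hasLocalIndex_one {o : OrientationField n M} {o' : OrientationField n N} {f : M → N}
    {D : Set M} (hDo : IsOpen D) (hcont : ContinuousOn f D)
    (hsense : SensePreserving o o' f D) {x : M} (hx : x ∈ D)
    (hf : MDifferentiableAt (𝓡 n) (𝓡 n) f x)
    (hbij : Bijective (mfderiv (𝓡 n) (𝓡 n) f x)) : HasLocalIndex o o' f D x 1 := by
  obtain ⟨A, hA, hAb⟩ := exists_hasFDerivAt_chart (mem_extChartAt_source (I := 𝓡 n) x)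
    (mem_extChartAt_source (I := 𝓡 n) (f x)) hf
  obtain ⟨c, hc, hcA⟩ := A.exists_mul_norm_le (hAb.2 hbij).1
  have h3 := hA.isLittleO.def (half_pos hc)
  have hFc := hA.continuousAt
  have hxs := mem_extChartAt_source (I := 𝓡 n) x
  have hys := mem_extChartAt_source (I := 𝓡 n) (f x)
  have hAbij := hAb.2 hbij
  have hφt : (extChartAt (𝓡 n) x).target ∈ 𝓝 (extChartAt (𝓡 n) x x) :=
    extChartAt_target_mem_nhds x
  have hψt : (extChartAt (𝓡 n) (f x)).target ∈ 𝓝 (extChartAt (𝓡 n) (f x) (f x)) :=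
    extChartAt_target_mem_nhds (f x)
  have hφo : IsOpen (extChartAt (𝓡 n) x).target := isOpen_extChartAt_target x
  have hψsm : ContMDiffOn (𝓡 n) (𝓡 n) ∞ (extChartAt (𝓡 n) (f x)).symm
      (extChartAt (𝓡 n) (f x)).target := contMDiffOn_extChartAt_symm (f x)
  have hφsm : ContMDiffOn (𝓡 n) (𝓡 n) ∞ (extChartAt (𝓡 n) x) (extChartAt (𝓡 n) x).source := by
    rw [extChartAt_source]
    exact contMDiffOn_extChartAt
  have hφsc : ContinuousOn (extChartAt (𝓡 n) x).symm (extChartAt (𝓡 n) x).target :=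
    continuousOn_extChartAt_symm x
  have hφc : ContinuousOn (extChartAt (𝓡 n) x) (extChartAt (𝓡 n) x).source :=
    continuousOn_extChartAt x
  have hψc : ContinuousOn (extChartAt (𝓡 n) (f x)) (extChartAt (𝓡 n) (f x)).source :=
    continuousOn_extChartAt (f x)
  have hφso : IsOpen (extChartAt (𝓡 n) x).source := isOpen_extChartAt_source x
  have hψd : MDifferentiableAt (𝓡 n) (𝓡 n) (extChartAt (𝓡 n) (f x)).symm
      (extChartAt (𝓡 n) (f x) (f x)) :=
    mdifferentiableAt_extChartAt_symm ((extChartAt (𝓡 n) (f x)).map_source hys)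
  have hψb := bijective_mfderiv_extChartAt_symm ((extChartAt (𝓡 n) (f x)).map_source hys)
  have hφd := mdifferentiableAt_extChartAt' (n := n) hxs
  have hφb := bijective_mfderiv_extChartAt hxs
  have hpre : (extChartAt (𝓡 n) x).symm ⁻¹' (D ∩ f ⁻¹' (extChartAt (𝓡 n) (f x)).source) ∈
      𝓝 (extChartAt (𝓡 n) x x) := by
    refine (continuousAt_extChartAt_symm (I := 𝓡 n) x).preimage_mem_nhds ?_
    rw [extChartAt_to_inv]
    exact inter_mem (hDo.mem_nhds hx) ((hcont.continuousAt (hDo.mem_nhds hx)).preimage_mem_nhds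
      (extChartAt_source_mem_nhds (f x)))
  have hinv : (extChartAt (𝓡 n) x).symm (extChartAt (𝓡 n) x x) = x := extChartAt_to_inv x
  set φ := extChartAt (𝓡 n) x with hφ
  set ψ := extChartAt (𝓡 n) (f x) with hψ
  set u₀ := φ x with hu₀
  set w₀ := ψ (f x) with hw₀
  obtain ⟨R, hR, hRψ⟩ := Metric.mem_nhds_iff.1 hψt
  have hAc : ContinuousAt (fun u ↦ w₀ + A (u - u₀)) u₀ := by fun_prop
  have hb1 : ∀ᶠ u in 𝓝 u₀, w₀ + A (u - u₀) ∈ Metric.ball w₀ R :=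
    hAc.eventually_mem (by
      rw [sub_self, map_zero, add_zero]
      exact Metric.ball_mem_nhds w₀ hR)
  have hb2 : ∀ᶠ u in 𝓝 u₀, ψ (f (φ.symm u)) ∈ Metric.ball w₀ R :=
    hFc.eventually_mem (by
      rw [hinv]
      exact Metric.ball_mem_nhds w₀ hR)
  -- On this ball both ends of the homotopy stay in `ball w₀ R`, whose convexity keeps the segments
  -- inside the target chart, and the linearization error is at most `c/2` times the displacement.
  obtain ⟨r, hr, hrsub⟩ := Metric.nhds_basis_closedBall.mem_iff.1
    (inter_mem (inter_mem hφt hpre) (inter_mem (inter_mem hb1 hb2) h3))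
  have hball : Metric.ball u₀ r ⊆ φ.target :=
    Metric.ball_subset_closedBall.trans fun u hu ↦ (hrsub hu).1.1
  set K := φ.symm '' Metric.closedBall u₀ r with hK
  set G := φ.symm '' Metric.ball u₀ r with hG
  have hGeq : G = φ.source ∩ φ ⁻¹' Metric.ball u₀ r := by
    rw [hG, φ.symm_image_eq_source_inter_preimage hball]
  have hGo : IsOpen G := by
    rw [hGeq]
    exact hφc.isOpen_inter_preimage hφso Metric.isOpen_ball
  have hKc : IsCompact K := (isCompact_closedBall u₀ r).image_of_continuousOn
    (hφsc.mono fun u hu ↦ (hrsub hu).1.1)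
  have hGK : G ⊆ K := image_mono Metric.ball_subset_closedBall
  have hclK : closure G ⊆ K := closure_minimal hGK hKc.isClosed
  have hKprop : ∀ y ∈ K, y ∈ φ.source ∧ y ∈ D ∧ f y ∈ ψ.source ∧
      w₀ + A (φ y - u₀) ∈ Metric.ball w₀ R ∧ ψ (f y) ∈ Metric.ball w₀ R ∧
      ‖ψ (f y) - w₀ - A (φ y - u₀)‖ ≤ c / 2 * ‖φ y - u₀‖ := by
    rintro _ ⟨u, hu, rfl⟩
    obtain ⟨⟨h1, h2⟩, ⟨h4, h5⟩, h6⟩ := hrsub hu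
    simp only [mem_ofPred_eq] at h6
    rw [hinv] at h6
    rw [φ.right_inv h1]
    exact ⟨φ.map_target h1, h2.1, h2.2, h4, h5, h6⟩
  have hxG : x ∈ G := ⟨u₀, Metric.mem_ball_self hr, hinv⟩
  set h : ℝ → M → EuclideanSpace ℝ (Fin n) := fun t y ↦
    (1 - t) • ψ (f y) + t • (w₀ + A (φ y - u₀)) with hh
  have hmem : ∀ t ∈ Icc (0 : ℝ) 1, ∀ y ∈ K, h t y ∈ ψ.target := by
    intro t ht y hy
    obtain ⟨-, -, -, h4, h5, -⟩ := hKprop y hy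
    exact hRψ (convex_ball w₀ R h5 h4 (by linarith [ht.2]) ht.1 (by ring))
  have huniq : ∀ t ∈ Icc (0 : ℝ) 1, ∀ y ∈ K, ψ.symm (h t y) = f x → y = x := by
    intro t ht y hy heq
    obtain ⟨h1, -, -, -, -, h6⟩ := hKprop y hy
    have h7 : h t y = w₀ := by
      rw [hw₀, ← heq, ψ.right_inv (hmem t ht y hy)]
    have h8 : A (φ y - u₀) = -((1 - t) • (ψ (f y) - w₀ - A (φ y - u₀))) := by
      have h9 : (1 - t) • (ψ (f y) - w₀ - A (φ y - u₀)) + A (φ y - u₀) = h t y - w₀ := by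
        simp only [hh]
        module
      rw [h7, sub_self] at h9
      exact eq_neg_of_add_eq_zero_right h9
    -- At a point over `f x` the linear part must cancel a fraction `1 - t` of the error, which is
    -- too small unless the displacement is zero.
    have h10 : c * ‖φ y - u₀‖ ≤ c / 2 * ‖φ y - u₀‖ := by
      refine (hcA _).trans ?_
      rw [h8, norm_neg, norm_smul, Real.norm_eq_abs, abs_of_nonneg (by linarith [ht.2])]
      refine le_trans (mul_le_of_le_one_left (norm_nonneg _) (by linarith [ht.1])) h6
    have h11 : ‖φ y - u₀‖ ≤ 0 := by
      by_contra hcon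
      nlinarith
    have h12 : φ y = φ x := sub_eq_zero.1 (norm_le_zero_iff.1 h11)
    exact φ.injOn h1 hxs h12
  have hH0 : ∀ y ∈ K, ψ.symm (h 0 y) = f y := by
    intro y hy
    simp only [hh, sub_zero, one_smul, zero_smul, add_zero]
    exact ψ.left_inv (hKprop y hy).2.2.1
  have hfr : ∀ y ∈ frontier G, y ∈ K ∧ y ≠ x := by
    intro y hy
    refine ⟨hclK hy.1, ?_⟩
    rintro rfl
    rw [hGo.frontier_eq] at hy
    exact hy.2 hxG
  have hdom : IsCompactSubdomain G D := by
    refine ⟨hGo, ?_, hKc.of_isClosed_subset isClosed_closure hclK,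
      fun y hy ↦ (hKprop y (hclK hy)).2.1⟩
    exact ((convex_ball u₀ r).isConnected (Metric.nonempty_ball.2 hr)).image _ (hφsc.mono hball)
  have hfib : closure G ∩ f ⁻¹' {f x} = {x} := by
    refine subset_antisymm ?_ ?_
    · rintro y ⟨hy, hyx⟩
      exact huniq 0 (by simp) y (hclK hy) ((hH0 y (hclK hy)).trans hyx)
    · rintro y rfl
      exact ⟨subset_closure hxG, rfl⟩
  have h1eq : ∀ y, h 1 y = w₀ + A (φ y - u₀) := fun y ↦ by simp [hh]
  have hAsm : ContMDiff (𝓡 n) (𝓡 n) ∞ fun u ↦ w₀ + A (u - u₀) := by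
    refine ContDiff.contMDiff ?_
    fun_prop
  have hH1 : (fun y ↦ ψ.symm (h 1 y)) = fun y ↦ ψ.symm (w₀ + A (φ y - u₀)) := by
    funext y
    rw [h1eq]
  have hderiv : Bijective (mfderiv (𝓡 n) (𝓡 n) (fun y ↦ ψ.symm (h 1 y)) x) := by
    rw [hH1]
    have haff : HasMFDerivAt (𝓡 n) (𝓡 n) (fun u ↦ w₀ + A (u - u₀)) (φ x) A := by
      refine HasFDerivAt.hasMFDerivAt ?_
      have := A.hasFDerivAt.comp u₀ ((hasFDerivAt_id u₀).sub_const u₀)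
      rw [ContinuousLinearMap.comp_id] at this
      exact this.const_add w₀
    have hw : w₀ + A (φ x - u₀) = w₀ := by simp [hu₀]
    have hψd' : HasMFDerivAt (𝓡 n) (𝓡 n) ψ.symm (w₀ + A (φ x - u₀))
        (mfderiv (𝓡 n) (𝓡 n) ψ.symm (w₀ + A (φ x - u₀))) := by
      rw [hw]
      exact hψd.hasMFDerivAt
    have hψb' : Bijective (mfderiv (𝓡 n) (𝓡 n) ψ.symm (w₀ + A (φ x - u₀))) := by
      rw [hw]
      exact hψb
    have hcomp := HasMFDerivAt.comp (f := (fun u ↦ w₀ + A (u - u₀)) ∘ φ) x hψd'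
      (haff.comp x hφd.hasMFDerivAt)
    have := hcomp.mfderiv
    change Bijective (mfderiv (𝓡 n) (𝓡 n) (ψ.symm ∘ (fun u ↦ w₀ + A (u - u₀)) ∘ φ) x)
    rw [this]
    exact hψb'.comp (hAbij.comp hφb)
  have hdeg : HasDegree o o' f G (f x) (derivSign o o' (fun y ↦ ψ.symm (h 1 y)) x) := by
    refine ⟨fun t y ↦ ψ.symm (h t y), ?_, fun y hy ↦ hH0 y (hclK hy), ?_, ?_, ?_, ?_⟩
    · refine hψsm.continuousOn.comp (t := ψ.target) ?_ fun q hq ↦ hmem q.1 hq.1 q.2 (hclK hq.2)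
      have hs1 : ContinuousOn (fun q : ℝ × M ↦ ψ (f q.2)) (Icc (0 : ℝ) 1 ×ˢ closure G) := by
        refine hψc.comp (t := ψ.source) (hcont.comp continuousOn_snd fun q hq ↦
          (hKprop _ (hclK hq.2)).2.1) fun q hq ↦ (hKprop _ (hclK hq.2)).2.2.1
      have hs2 : ContinuousOn (fun q : ℝ × M ↦ φ q.2) (Icc (0 : ℝ) 1 ×ˢ closure G) :=
        hφc.comp continuousOn_snd fun q hq ↦ (hKprop _ (hclK hq.2)).1
      have hs3 : ContinuousOn (fun q : ℝ × M ↦ A (φ q.2 - u₀)) (Icc (0 : ℝ) 1 ×ˢ closure G) :=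
        A.continuous.comp_continuousOn (hs2.sub continuousOn_const)
      exact ((continuousOn_const.sub continuousOn_fst).smul hs1).add
        (continuousOn_fst.smul (continuousOn_const.add hs3))
    · intro t ht y hy heq
      exact (hfr y hy).2 (huniq t ht y (hfr y hy).1 heq)
    · change ContMDiffOn (𝓡 n) (𝓡 n) ∞ (fun y ↦ ψ.symm (h 1 y)) G
      rw [hH1]
      refine hψsm.comp (hAsm.comp_contMDiffOn (hφsm.mono fun y hy ↦ (hKprop y (hGK hy)).1)) ?_
      intro y hy
      have := hmem 1 (by simp) y (hGK hy)
      rwa [h1eq] at this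
    · intro y hy heq
      obtain rfl := huniq 1 (by simp) y (hGK hy) heq
      exact hderiv
    · have hset : G ∩ (fun y ↦ ψ.symm (h 1 y)) ⁻¹' {f x} = {x} := by
        refine subset_antisymm (fun y hy ↦ huniq 1 (by simp) y (hGK hy.1) hy.2) ?_
        rintro y rfl
        refine ⟨hxG, ?_⟩
        rw [mem_preimage, h1eq, mem_singleton_iff, sub_self, map_zero, add_zero]
        exact ψ.left_inv hys
      rw [hset, finsum_mem_singleton]
  have hpos := hsense G hdom (f x) ⟨mem_image_of_mem f hxG, by
    rintro ⟨y, hy, hyx⟩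
    exact (hfr y hy).2 (huniq 0 (by simp) y (hfr y hy).1 ((hH0 y (hfr y hy).1).trans hyx))⟩ _ hdeg
  have hone : derivSign o o' (fun y ↦ ψ.symm (h 1 y)) x = 1 := by
    unfold derivSign at hpos ⊢
    split_ifs with hc
    · rfl
    · rw [if_neg hc] at hpos
      omega
  rw [hone] at hdeg
  exact ⟨G, hdom, hfib, hdeg⟩

end Index


/-! ### Curves that meet a null set in positive length. -/

section ExceptionalCurves

variable {Y : Type*} [EMetricSpace Y]

theorem Curve.continuousOn_naturalParameterization {β : Curve Y} (hβ : β.LocallyRectifiable)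
    {a b : ℝ} (ha : a ∈ β.dom) (hb : b ∈ β.dom) (hab : a ≤ b) :
    ContinuousOn (naturalParameterization β (Icc a b) a)
      (Icc 0 (eVariationOn β (Icc a b)).toReal) := by
  have hsub : Icc a b ⊆ β.dom := β.ordConnected_dom.out ha hb
  have hloc : LocallyBoundedVariationOn β (Icc a b) := locallyBoundedVariationOn_mono hβ hsub
  have haI : a ∈ Icc a b := ⟨le_rfl, hab⟩
  have hbI : b ∈ Icc a b := ⟨hab, le_rfl⟩
  have hbv : BoundedVariationOn β (Icc a b) := by
    simpa only [BoundedVariationOn, inter_self] using hloc a b haI hbI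
  have hmono := variationOnFromTo.monotoneOn hloc haI
  have him : variationOnFromTo β (Icc a b) a '' Icc a b
      = Icc 0 (eVariationOn β (Icc a b)).toReal := by
    rw [(continuousOn_variationOnFromTo (β.continuousOn_toFun.mono hsub) hbv).image_Icc hab,
      hmono.sInf_image_Icc hab, hmono.sSup_image_Icc hab, variationOnFromTo.self,
      variationOnFromTo.eq_of_le _ _ hab, inter_self]
  have hspeed := has_unit_speed_naturalParameterization β hloc haI
  rw [him] at hspeed
  set L := (eVariationOn β (Icc a b)).toReal
  have hlip : LipschitzOnWith 1 (naturalParameterization β (Icc a b) a) (Icc 0 L) := by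
    intro s hs s' hs'
    wlog h : s ≤ s' generalizing s s'
    · rw [edist_comm, edist_comm s]
      exact this hs' hs (not_le.1 h).le
    have h1 := hspeed hs hs'
    have h2 := eVariationOn.edist_le (naturalParameterization β (Icc a b) a)
      (s := Icc 0 L ∩ Icc s s') ⟨hs, le_rfl, h⟩ ⟨hs', h, le_rfl⟩
    rw [h1] at h2
    refine h2.trans (le_of_eq ?_)
    rw [edist_comm, edist_dist, Real.dist_eq, abs_of_nonneg (sub_nonneg.2 h)]
    simp
  exact hlip.continuousOn

/-- An infinite density on a set met in positive length has infinite line integral. If `B` is null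
such a density has zero energy, so these curves cost nothing. -/
theorem Curve.one_le_lineIntegral_indicator_top [MeasurableSpace Y] [BorelSpace Y] {β : Curve Y}
    (hβ : β.LocallyRectifiable) {B : Set Y} (hB : MeasurableSet B) {a b : ℝ} (ha : a ∈ β.dom)
    (hb : b ∈ β.dom) (hab : a ≤ b)
    (h : ¬ ∀ᵐ s, s ∈ Icc 0 (eVariationOn β (Icc a b)).toReal →
      naturalParameterization β (Icc a b) a s ∉ B) :
    1 ≤ β.lineIntegral (B.indicator fun _ ↦ ⊤) := by
  set L := (eVariationOn β (Icc a b)).toReal with hL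
  set c := naturalParameterization β (Icc a b) a with hc
  have hm : MeasurableSet (Icc 0 L ∩ c ⁻¹' B) :=
    (Curve.continuousOn_naturalParameterization hβ ha hb hab).measurableSet_inter_preimage
      measurableSet_Icc hB
  have hvol : volume (Icc 0 L ∩ c ⁻¹' B) ≠ 0 := by
    intro h0
    refine h ?_
    rw [ae_iff]
    refine measure_mono_null ?_ h0
    intro s hs
    simpa [and_assoc] using hs
  have h1 : (1 : ℝ≥0∞) ≤ ∫⁻ s in Icc 0 L, B.indicator (fun _ ↦ ⊤) (c s) := calc
    (1 : ℝ≥0∞) ≤ ∫⁻ _s in Icc 0 L ∩ c ⁻¹' B, ⊤ := by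
      rw [setLIntegral_const, ENNReal.top_mul hvol]
      exact le_top
    _ = ∫⁻ s in Icc 0 L ∩ c ⁻¹' B, B.indicator (fun _ ↦ ⊤) (c s) := by
      refine setLIntegral_congr_fun hm fun s hs ↦ ?_
      rw [indicator_of_mem (show c s ∈ B from hs.2)]
    _ ≤ _ := lintegral_mono_set inter_subset_left
  exact h1.trans (le_iSup₂_of_le a ha (le_iSup₂_of_le b hb (le_iSup_of_le hab le_rfl)))

end ExceptionalCurves

/-! ### Measurability of `l` and injective pieces. -/

section Measurability

variable {X Y : Type*} [EMetricSpace X] [EMetricSpace Y]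

/-- The infimum of the difference quotients of `f` at `x` over the points of `D` at distance less
than `1 / k` from `x`. -/
def minStretchAtScale (f : X → Y) (D : Set X) (k : ℕ) (x : X) : ℝ≥0∞ :=
  ⨅ (y : X) (_ : y ∈ D ∧ y ≠ x ∧ edist x y < (k : ℝ≥0∞)⁻¹), edist (f x) (f y) / edist x y

theorem minStretch_eq_iSup {f : X → Y} {D : Set X} (hDo : IsOpen D) {x : X} (hx : x ∈ D) :
    minStretch f x = ⨆ k, minStretchAtScale f D k x := by
  have hb : (𝓝[≠] x).HasBasis (fun _ : ℕ ↦ True)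
      (fun k ↦ {y | y ∈ D ∧ y ≠ x ∧ edist x y < (k : ℝ≥0∞)⁻¹}) := by
    refine ⟨fun t ↦ ⟨fun ht ↦ ?_, ?_⟩⟩
    · rw [mem_nhdsWithin_iff_exists_mem_nhds_inter] at ht
      obtain ⟨u, hu, hut⟩ := ht
      obtain ⟨ε, hε, hεu⟩ := EMetric.mem_nhds_iff.1 hu
      obtain ⟨k, hk⟩ := ENNReal.exists_inv_nat_lt hε.ne'
      refine ⟨k, trivial, fun y hy ↦ hut ⟨hεu ?_, hy.2.1⟩⟩
      rw [Metric.mem_eball, edist_comm]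
      exact hy.2.2.trans hk
    · rintro ⟨k, -, hk⟩
      refine mem_of_superset ?_ hk
      have h1 : Metric.eball x (k : ℝ≥0∞)⁻¹ ∈ 𝓝 x :=
        Metric.eball_mem_nhds x (ENNReal.inv_pos.2 (ENNReal.natCast_ne_top k))
      filter_upwards [mem_nhdsWithin_of_mem_nhds h1,
        mem_nhdsWithin_of_mem_nhds (hDo.mem_nhds hx), self_mem_nhdsWithin] with y h2 h3 h4
      rw [Metric.mem_eball, edist_comm] at h2
      exact ⟨h3, h4, h2⟩
  rw [minStretch, hb.liminf_eq_iSup_iInf]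
  simp only [iSup_true]
  rfl

/-- A competitor `y` for the infimum at `x` stays a competitor at nearby points, and its difference
quotient varies continuously. -/
theorem isOpen_setOf_minStretchAtScale_lt {f : X → Y} {D : Set X} (hDo : IsOpen D)
    (hcont : ContinuousOn f D) (k : ℕ) (c : ℝ≥0∞) :
    IsOpen {x | x ∈ D ∧ minStretchAtScale f D k x < c} := by
  rw [isOpen_iff_mem_nhds]
  rintro x ⟨hx, hxc⟩
  obtain ⟨y, hy⟩ := iInf_lt_iff.1 hxc
  obtain ⟨⟨hyD, hyx, hyk⟩, hyc⟩ := iInf_lt_iff.1 hy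
  have hne : edist x y ≠ 0 := fun h ↦ hyx (edist_eq_zero.1 h).symm
  have hfc := hcont.continuousAt (hDo.mem_nhds hx)
  have h1 : Tendsto (fun x' ↦ edist x' y) (𝓝 x) (𝓝 (edist x y)) :=
    (continuous_id.edist continuous_const).tendsto x
  have h2 : Tendsto (fun x' ↦ edist (f x') (f y) / edist x' y) (𝓝 x)
      (𝓝 (edist (f x) (f y) / edist x y)) :=
    ENNReal.Tendsto.div (hfc.edist continuousAt_const) (Or.inr hne) h1
      (Or.inl hyk.ne_top)
  filter_upwards [hDo.mem_nhds hx, h1.eventually (gt_mem_nhds hyk),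
    h2.eventually (gt_mem_nhds hyc), isOpen_ne.mem_nhds hyx.symm] with x' h3 h4 h5 h6
  exact ⟨h3, (iInf₂_le y ⟨hyD, Ne.symm h6, h4⟩).trans_lt h5⟩

variable [MeasurableSpace X] [BorelSpace X]

theorem measurable_indicator_minStretchAtScale {f : X → Y} {D : Set X} (hDo : IsOpen D)
    (hcont : ContinuousOn f D) (k : ℕ) : Measurable (D.indicator (minStretchAtScale f D k)) := by
  refine measurable_of_Iio fun c ↦ ?_
  have heq : D.indicator (minStretchAtScale f D k) ⁻¹' Iio c =
      {x | x ∈ D ∧ minStretchAtScale f D k x < c} ∪ (Dᶜ ∩ {_x | 0 < c}) := by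
    ext x
    by_cases hx : x ∈ D <;> simp [hx]
  rw [heq]
  exact (isOpen_setOf_minStretchAtScale_lt hDo hcont k c).measurableSet.union
    (hDo.measurableSet.compl.inter (.const _))

theorem measurable_indicator_minStretch {f : X → Y} {D : Set X} (hDo : IsOpen D)
    (hcont : ContinuousOn f D) : Measurable (D.indicator (minStretch f)) := by
  have heq : D.indicator (minStretch f) = fun x ↦ ⨆ k, D.indicator (minStretchAtScale f D k) x := by
    funext x
    by_cases hx : x ∈ D
    · simp only [hx, indicator_of_mem]
      exact minStretch_eq_iSup hDo hx
    · simp [hx]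
  rw [heq]
  exact .iSup fun k ↦ measurable_indicator_minStretchAtScale hDo hcont k

/-- The Lusin–Souslin theorem: injective continuous images of Borel subsets of a Polish space are
Borel. It is used locally, in a Polish neighbourhood `U`. -/
theorem measurableEmbedding_of_subset_polish [MeasurableSpace Y] [BorelSpace Y]
    {f : X → Y} {E U : Set X} [PolishSpace U] (hE : MeasurableSet E)
    (hEU : E ⊆ U) (hcont : ContinuousOn f E) (hinj : InjOn f E) :
    MeasurableEmbedding (fun x : E ↦ f x) where
  injective := injOn_iff_injective.1 hinj
  measurable := (continuousOn_iff_continuous_domRestrict.1 hcont).measurable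
  measurableSet_image' := by
    intro A hA
    have hA' : MeasurableSet (Subtype.val '' A) :=
      (MeasurableEmbedding.subtype_coe hE).measurableSet_image.2 hA
    have hAE : (Subtype.val '' A : Set X) ⊆ E := Subtype.coe_image_subset _ _
    have h1 : MeasurableSet ((fun x : U ↦ f x) '' (Subtype.val ⁻¹' (Subtype.val '' A))) := by
      refine (measurable_subtype_coe hA').image_of_continuousOn_injOn ?_ ?_
      · exact hcont.comp continuous_subtype_val.continuousOn fun x hx ↦ hAE hx
      · intro x hx y hy hxy
        exact Subtype.ext (hinj (hAE hx) (hAE hy) hxy)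
    convert h1 using 1
    ext y
    constructor
    · rintro ⟨x, hx, rfl⟩
      exact ⟨⟨x, hEU x.2⟩, ⟨x, hx, rfl⟩, rfl⟩
    · rintro ⟨x, ⟨x', hx', hxx'⟩, rfl⟩
      exact ⟨x', hx', congrArg f hxx'⟩

/-- Where the difference quotients up to scale `1/k` are bounded below by a positive number, `f`
separates points at distance less than `1/k`. Intersecting with balls of radius `1/(2k)` gives
injective pieces; countably many suffice and are then made disjoint. -/
theorem exists_disjoint_measurableEmbedding_pieces [SecondCountableTopology X]
    [MeasurableSpace Y] [BorelSpace Y] {v : Measure X} {w : Measure Y}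
    [IsLocallyFiniteMeasure v] [IsLocallyFiniteMeasure w]
    (hpol : ∀ x : X, ∃ U : Set X, IsOpen U ∧ x ∈ U ∧ PolishSpace U)
    {f : X → Y} {D : Set X} (hDo : IsOpen D) (hcont : ContinuousOn f D) :
    ∃ E : ℕ → Set X, (∀ k, MeasurableSet (E k) ∧ E k ⊆ D ∧ v (E k) ≠ ⊤ ∧ w (f '' E k) ≠ ⊤ ∧
      MeasurableEmbedding (fun x : E k ↦ f x)) ∧ Pairwise (Disjoint on E) ∧
      ∀ x ∈ D, 0 < minStretch f x → x ∈ ⋃ k, E k := by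
  let good : Set X → Prop := fun E ↦ E ⊆ D ∧ v E ≠ ⊤ ∧ w (f '' E) ≠ ⊤ ∧ InjOn f E ∧
    ∃ U : Set X, E ⊆ U ∧ PolishSpace U
  have hsubgood : ∀ E E' : Set X, good E → E' ⊆ E → good E' := by
    rintro E E' ⟨h1, h2, h3, h4, U, h6, h7⟩ h
    exact ⟨h.trans h1, ne_top_of_le_ne_top h2 (measure_mono h),
      ne_top_of_le_ne_top h3 (measure_mono (image_mono h)), h4.mono h, U, h.trans h6, h7⟩
  have hA : ∀ k : ℕ, ∃ C : Set (Set X), C.Countable ∧ (∀ E ∈ C, MeasurableSet E ∧ good E) ∧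
      ∀ x ∈ D, 0 < minStretchAtScale f D k x → x ∈ ⋃₀ C := by
    intro k
    have hloc : ∀ x ∈ D, ∃ V : Set X, IsOpen V ∧ x ∈ V ∧ V ⊆ D ∧ v V ≠ ⊤ ∧ w (f '' V) ≠ ⊤ ∧
        V ⊆ Metric.eball x ((k : ℝ≥0∞)⁻¹ / 2) ∧
        ∃ U : Set X, V ⊆ U ∧ PolishSpace U := by
      intro x hx
      obtain ⟨U, hUo, hxU, hU⟩ := hpol x
      obtain ⟨V₁, hV₁, hV₁f⟩ := v.finiteAt_nhds x
      obtain ⟨V₂, hV₂, hV₂f⟩ := w.finiteAt_nhds (f x)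
      have hV₃ := (hcont.continuousAt (hDo.mem_nhds hx)).preimage_mem_nhds hV₂
      have hball : Metric.eball x ((k : ℝ≥0∞)⁻¹ / 2) ∈ 𝓝 x := Metric.eball_mem_nhds x
        (ENNReal.half_pos (ENNReal.inv_ne_zero.2 (ENNReal.natCast_ne_top k)))
      obtain ⟨V, hV, hVo, hxV⟩ := mem_nhds_iff.1 (inter_mem (inter_mem (hDo.mem_nhds hx)
        (hUo.mem_nhds hxU)) (inter_mem (inter_mem hV₁ hV₃) hball))
      refine ⟨V, hVo, hxV, fun y hy ↦ (hV hy).1.1, ?_, ?_, fun y hy ↦ (hV hy).2.2, U,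
        fun y hy ↦ (hV hy).1.2, hU⟩
      · exact ne_top_of_le_ne_top hV₁f.ne (measure_mono fun y hy ↦ (hV hy).2.1.1)
      · refine ne_top_of_le_ne_top hV₂f.ne (measure_mono ?_)
        rintro _ ⟨y, hy, rfl⟩
        exact (hV hy).2.1.2
    choose! V hVo hxV hVD hvV hwV hVb hVU using hloc
    obtain ⟨t, htD, htc, ht⟩ := TopologicalSpace.countable_cover_nhdsWithin (f := V) (s := D)
      (fun x hx ↦ mem_nhdsWithin_of_mem_nhds ((hVo x hx).mem_nhds (hxV x hx)))
    have hpos : MeasurableSet {x | 0 < D.indicator (minStretchAtScale f D k) x} :=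
      measurableSet_lt measurable_const (measurable_indicator_minStretchAtScale hDo hcont k)
    refine ⟨(fun x ↦ V x ∩ {x | 0 < D.indicator (minStretchAtScale f D k) x}) '' t,
      htc.image _, ?_, ?_⟩
    · rintro _ ⟨x, hx, rfl⟩
      have hx := htD hx
      refine ⟨(hVo x hx).measurableSet.inter hpos, inter_subset_left.trans (hVD x hx),
        ne_top_of_le_ne_top (hvV x hx) (measure_mono inter_subset_left),
        ne_top_of_le_ne_top (hwV x hx) (measure_mono (image_mono inter_subset_left)), ?_, ?_⟩
      · rintro y ⟨hyV, hy⟩ z ⟨hzV, -⟩ hyz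
        by_contra hne
        have hyD := hVD x hx hyV
        rw [mem_ofPred_eq, indicator_of_mem hyD] at hy
        have hdist : edist y z < (k : ℝ≥0∞)⁻¹ := by
          have h1 := hVb x hx hyV
          have h2 := hVb x hx hzV
          rw [Metric.mem_eball] at h1 h2
          calc edist y z ≤ edist y x + edist z x := edist_triangle_right _ _ _
            _ < (k : ℝ≥0∞)⁻¹ / 2 + (k : ℝ≥0∞)⁻¹ / 2 := ENNReal.add_lt_add h1 h2
            _ = _ := ENNReal.add_halves _
        have h3 : minStretchAtScale f D k y ≤ edist (f y) (f z) / edist y z :=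
          iInf₂_le z ⟨hVD x hx hzV, Ne.symm hne, hdist⟩
        rw [hyz, edist_self, ENNReal.zero_div] at h3
        exact absurd hy (not_lt.2 h3)
      · obtain ⟨U, h2, h3⟩ := hVU x hx
        exact ⟨U, inter_subset_left.trans h2, h3⟩
    · intro x hx hpx
      obtain ⟨x₀, hx₀, hxx₀⟩ := mem_iUnion₂.1 (ht hx)
      refine ⟨_, mem_image_of_mem _ hx₀, hxx₀, ?_⟩
      rwa [mem_ofPred_eq, indicator_of_mem hx]
  choose C hCc hCg hCcov using hA
  have hne : (⋃ k, C k ∪ {∅}).Nonempty := ⟨∅, mem_iUnion.2 ⟨0, Or.inr rfl⟩⟩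
  obtain ⟨F, hF⟩ := (countable_iUnion fun k ↦ (hCc k).union (countable_singleton ∅)).exists_eq_range
    hne
  rcases D.eq_empty_or_nonempty with rfl | ⟨x₁, hx₁⟩
  · refine ⟨fun _ ↦ ∅, fun k ↦ ⟨.empty, le_rfl, by simp, by simp, ?_⟩, fun i j _ ↦ by simp,
      fun x hx ↦ hx.elim⟩
    exact ⟨fun x ↦ x.2.elim, measurable_of_empty _, fun A _ ↦ by
      rw [eq_empty_of_isEmpty A, image_empty]
      exact .empty⟩
  have hFg : ∀ k, MeasurableSet (F k) ∧ good (F k) := by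
    intro k
    have : F k ∈ ⋃ k, C k ∪ {∅} := hF ▸ mem_range_self k
    obtain ⟨l, hl | hl⟩ := mem_iUnion.1 this
    · exact hCg l _ hl
    · rw [mem_singleton_iff.1 hl]
      obtain ⟨U, -, -, hU⟩ := hpol x₁
      exact ⟨.empty, empty_subset _, by simp, by simp, injOn_empty _, U, empty_subset _, hU⟩
  refine ⟨disjointed F, fun k ↦ ?_, disjoint_disjointed F, fun x hx hpx ↦ ?_⟩
  · have hm : MeasurableSet (disjointed F k) := MeasurableSet.disjointed (fun i ↦ (hFg i).1) k
    obtain ⟨h1, h2, h3, h4, U, h6, h7⟩ :=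
      hsubgood _ _ (hFg k).2 (disjointed_subset F k)
    exact ⟨hm, h1, h2, h3, measurableEmbedding_of_subset_polish hm h6 (hcont.mono h1) h4⟩
  · rw [iUnion_disjointed]
    rw [minStretch_eq_iSup hDo hx] at hpx
    obtain ⟨k, hk⟩ := lt_iSup_iff.1 hpx
    obtain ⟨E, hE, hxE⟩ := hCcov k x hx hk
    have : E ∈ range F := hF ▸ mem_iUnion.2 ⟨k, Or.inl hE⟩
    obtain ⟨l, rfl⟩ := this
    exact mem_iUnion.2 ⟨l, hxE⟩

end Measurability

section Polish

theorem exists_isOpen_polishSpace {H M : Type*} [TopologicalSpace H] [PolishSpace H]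
    [TopologicalSpace M] [ChartedSpace H M] (x : M) :
    ∃ U : Set M, IsOpen U ∧ x ∈ U ∧ PolishSpace U := by
  refine ⟨(chartAt H x).source, (chartAt H x).open_source, mem_chart_source H x, ?_⟩
  have := (chartAt H x).open_target.polishSpace
  exact (chartAt H x).toHomeomorphSourceTarget.isClosedEmbedding.polishSpace

end Polish


/-! ### The mean over fibres and its energy. -/

/-- The power mean inequality: after taking `p`-th powers the factor `m^p / m = m^(p-1)` is the
Hölder constant for at most `m` terms. -/
theorem sum_le_mul_rpow_tsum {ι : Type*} {m : ℕ} (hm : 1 ≤ m) {p : ℝ} (hp : 1 ≤ p)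
    (J : Finset ι) (hJ : J.card ≤ m) (a : ι → ℝ≥0∞) (g : ℕ → ℝ≥0∞) (k : ι → ℕ)
    (hk : InjOn k J) (hak : ∀ j ∈ J, a j = g (k j)) :
    ∑ j ∈ J, a j ≤ m * ((m : ℝ≥0∞)⁻¹ * ∑' i, g i ^ p) ^ (1 / p) := by
  classical
  have hp0 : 0 < p := by linarith
  have hm0 : (m : ℝ≥0∞) ≠ 0 := by
    simp only [ne_eq, Nat.cast_eq_zero]
    lia
  have hmt : (m : ℝ≥0∞) ≠ ⊤ := ENNReal.natCast_ne_top m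
  rw [← ENNReal.rpow_le_rpow_iff hp0, ENNReal.mul_rpow_of_nonneg _ _ hp0.le, ← ENNReal.rpow_mul,
    one_div_mul_cancel hp0.ne', ENNReal.rpow_one, ← mul_assoc, ← ENNReal.rpow_neg_one,
    ← ENNReal.rpow_add _ _ hm0 hmt, ← sub_eq_add_neg]
  calc (∑ j ∈ J, a j) ^ p ≤ (J.card : ℝ≥0∞) ^ (p - 1) * ∑ j ∈ J, a j ^ p :=
        ENNReal.rpow_sum_le_const_mul_sum_rpow J a hp
    _ ≤ (m : ℝ≥0∞) ^ (p - 1) * ∑' i, g i ^ p := by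
        gcongr
        calc ∑ j ∈ J, a j ^ p = ∑ j ∈ J, g (k j) ^ p :=
              Finset.sum_congr rfl fun j hj ↦ by rw [hak j hj]
          _ = ∑ i ∈ J.image k, g i ^ p := (Finset.sum_image (f := fun i ↦ g i ^ p) hk).symm
          _ ≤ _ := ENNReal.sum_le_tsum _

section PushForward

variable {X Y : Type*} [EMetricSpace X] [SecondCountableTopology X] [MeasurableSpace X]
  [BorelSpace X] [EMetricSpace Y] [MeasurableSpace Y] [BorelSpace Y]
  {v : Measure X} {w : Measure Y} [IsLocallyFiniteMeasure v] [IsLocallyFiniteMeasure w]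

/-- The function `((1 / m) ∑ (ρ / l( · , f))^p)^(1/p)`, where the sum is over the preimages of the
given point in a large part of `D`. -/
theorem exists_mean_pushforward
    (hpol : ∀ x : X, ∃ U : Set X, IsOpen U ∧ x ∈ U ∧ PolishSpace U)
    (hdbl : ∀ x : X, ∃ C : NNReal, ∃ R > (0 : ℝ), ∀ r, 0 < r → r < R →
      v (Metric.closedEBall x (ENNReal.ofReal (3 * r))) ≤
        C * v (Metric.closedEBall x (ENNReal.ofReal r)))
    {f : X → Y} {D : Set X} (hDo : IsOpen D) (hcont : ContinuousOn f D) (hN : LuzinN v w f D)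
    {m : ℕ} (hm : 1 ≤ m) {p : ℝ} (hp : 1 ≤ p) {ρ : X → ℝ≥0∞} (hρ : Measurable ρ) :
    ∃ g : Y → ℝ≥0∞, Measurable g ∧
      (∫⁻ y, g y ^ p ∂w ≤ (m : ℝ≥0∞)⁻¹ *
        ∫⁻ x in D, ((minStretch f x)⁻¹ * ρ x) ^ p * jacobian v w f x ∂v) ∧
      ∀ (y : Y) (J : Finset (Fin m)) (x : Fin m → X), InjOn x J →
        (∀ j ∈ J, x j ∈ D ∧ f (x j) = y ∧ 0 < minStretch f (x j)) →
        ∑ j ∈ J, (minStretch f (x j))⁻¹ * ρ (x j) ≤ m * g y := by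
  have hp0 : 0 < p := by linarith
  obtain ⟨E, hE, hEd, hEcov⟩ := exists_disjoint_measurableEmbedding_pieces (v := v) (w := w)
    hpol hDo hcont
  set h : X → ℝ≥0∞ := D.indicator fun x ↦ (minStretch f x)⁻¹ * ρ x with hh
  have hhm : Measurable h := by
    have : h = D.indicator fun x ↦ (D.indicator (minStretch f) x)⁻¹ * ρ x := by
      refine indicator_congr fun x hx ↦ ?_
      rw [indicator_of_mem hx]
    rw [this]
    exact ((measurable_indicator_minStretch hDo hcont).inv.mul hρ).indicator hDo.measurableSet
  -- `h` carried from the piece `E k` to its image; summing over `k` is summing over the fibre.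
  set g : ℕ → Y → ℝ≥0∞ := fun k ↦ extend (fun x : E k ↦ f x) (fun x : E k ↦ h x) 0 with hg
  have hgm : ∀ k, Measurable (g k) := fun k ↦
    (hE k).2.2.2.2.measurable_extend (hhm.comp measurable_subtype_coe) measurable_const
  have hgp : ∀ k, ∫⁻ y, g k y ^ p ∂w ≤ ∫⁻ x in E k, h x ^ p * jacobian v w f x ∂v := by
    intro k
    refine le_trans (le_of_eq ?_) (lintegral_extend_le hDo hN hdbl (hE k).1 (hE k).2.1
      (hE k).2.2.1 (hE k).2.2.2.1 (hE k).2.2.2.2 (hhm.pow_const p))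
    refine lintegral_congr fun y ↦ ?_
    by_cases hy : ∃ x : E k, f x = y
    · obtain ⟨x, rfl⟩ := hy
      have hinj := (hE k).2.2.2.2.injective
      exact ((congrArg (· ^ p) (hinj.extend_apply _ _ x)).trans
        (hinj.extend_apply (fun x : E k ↦ h x ^ p) _ x).symm)
    · rw [hg]
      simp only
      rw [extend_apply' _ _ _ hy, extend_apply' _ _ _ hy]
      simp [hp0]
  refine ⟨fun y ↦ ((m : ℝ≥0∞)⁻¹ * ∑' k, g k y ^ p) ^ (1 / p), ?_, ?_, ?_⟩
  · exact (((Measurable.tsum fun k ↦ (hgm k).pow_const p).const_mul _).pow_const _)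
  · calc ∫⁻ y, (((m : ℝ≥0∞)⁻¹ * ∑' k, g k y ^ p) ^ (1 / p)) ^ p ∂w
        = ∫⁻ y, (m : ℝ≥0∞)⁻¹ * ∑' k, g k y ^ p ∂w := by
          refine lintegral_congr fun y ↦ ?_
          rw [← ENNReal.rpow_mul, one_div_mul_cancel hp0.ne', ENNReal.rpow_one]
      _ = (m : ℝ≥0∞)⁻¹ * ∑' k, ∫⁻ y, g k y ^ p ∂w := by
          rw [lintegral_const_mul _ (Measurable.tsum fun k ↦ (hgm k).pow_const p),
            lintegral_tsum fun k ↦ ((hgm k).pow_const p).aemeasurable]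
      _ ≤ (m : ℝ≥0∞)⁻¹ * ∑' k, ∫⁻ x in E k, h x ^ p * jacobian v w f x ∂v := by
          gcongr with k
          exact hgp k
      _ = (m : ℝ≥0∞)⁻¹ * ∫⁻ x in ⋃ k, E k, h x ^ p * jacobian v w f x ∂v := by
          rw [lintegral_iUnion (fun k ↦ (hE k).1) hEd]
      _ ≤ (m : ℝ≥0∞)⁻¹ * ∫⁻ x in D, h x ^ p * jacobian v w f x ∂v := by
          gcongr
          exact iUnion_subset fun k ↦ (hE k).2.1
      _ = _ := by
          congr 1
          refine setLIntegral_congr_fun hDo.measurableSet fun x hx ↦ ?_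
          rw [hh, indicator_of_mem hx]
  · intro y J x hxJ hx
    have hex : ∀ j ∈ J, ∃ k, x j ∈ E k := fun j hj ↦
      mem_iUnion.1 (hEcov (x j) (hx j hj).1 (hx j hj).2.2)
    choose! k hk using hex
    refine sum_le_mul_rpow_tsum hm hp J ((Finset.card_le_univ J).trans (by simp)) _
      (fun i ↦ g i y) k ?_ ?_
    -- Distinct points of a fibre lie in different pieces because `f` is injective on each.
    · intro i hi j hj hij
      refine hxJ hi hj ?_
      have hi' := hk i hi
      have hj' := hk j hj
      rw [hij] at hi'
      have := (hE (k j)).2.2.2.2.injective (a₁ := ⟨x i, hi'⟩) (a₂ := ⟨x j, hj'⟩)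
        ((hx i hi).2.1.trans (hx j hj).2.1.symm)
      exact congrArg Subtype.val this
    · intro j hj
      have h1 := (hE (k j)).2.2.2.2.injective.extend_apply
        (fun x : E (k j) ↦ h x) 0 ⟨x j, hk j hj⟩
      simp only [(hx j hj).2.1] at h1
      change _ = extend (fun x : E (k j) ↦ f x) (fun x : E (k j) ↦ h x) 0 y
      rw [h1, hh, indicator_of_mem (hx j hj).1]

end PushForward

section Dilatation

variable {n : ℕ} {M N : Type*}
  [EMetricSpace M] [ChartedSpace (EuclideanSpace ℝ (Fin n)) M]
  [Bundle.RiemannianBundle (fun x : M ↦ TangentSpace (𝓡 n) x)] [MeasurableSpace M]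
  [EMetricSpace N] [ChartedSpace (EuclideanSpace ℝ (Fin n)) N]
  [Bundle.RiemannianBundle (fun x : N ↦ TangentSpace (𝓡 n) x)] [MeasurableSpace N]

/-- When `J = 0` the left side vanishes even if `l = 0`, by the convention `∞ · 0 = 0`; otherwise
both sides agree. -/
theorem stretch_rpow_mul_jacobian_le {p : ℝ} (hp : 0 < p) (f : M → N) (x : M) (r : ℝ≥0∞) :
    ((minStretch f x)⁻¹ * r) ^ p * jacobian (riemVolume n M) (riemVolume n N) f x ≤
      innerDilatation n p f x * r ^ p := by
  by_cases hJ : jacobian (riemVolume n M) (riemVolume n N) f x = 0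
  · simp [hJ]
  · rw [innerDilatation, if_pos hJ, ENNReal.mul_rpow_of_nonneg _ _ hp.le, ENNReal.inv_rpow,
      ENNReal.div_eq_inv_mul, mul_right_comm]

end Dilatation

/-! ### Exceptional points and the modulus inequality. -/

section Inequality

theorem lintegral_max_rpow_le {Y : Type*} [MeasurableSpace Y] (w : Measure Y) {p : ℝ}
    {g₁ g₂ : Y → ℝ≥0∞} (h₁ : Measurable g₁) :
    ∫⁻ y, (max (g₁ y) (g₂ y)) ^ p ∂w ≤ ∫⁻ y, g₁ y ^ p ∂w + ∫⁻ y, g₂ y ^ p ∂w := by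
  rw [← lintegral_add_left (h₁.pow_const p)]
  refine lintegral_mono fun y ↦ ?_
  rcases max_choice (g₁ y) (g₂ y) with h | h
  · rw [h]
    exact le_self_add
  · rw [h]
    exact le_add_self

variable {n : ℕ}
    {M : Type*} [EMetricSpace M] [SecondCountableTopology M]
    [ChartedSpace (EuclideanSpace ℝ (Fin n)) M] [IsManifold (𝓡 n) ∞ M]
    [Bundle.RiemannianBundle (fun x : M ↦ TangentSpace (𝓡 n) x)]
    [IsContMDiffRiemannianBundle (𝓡 n) ∞ (EuclideanSpace ℝ (Fin n))
      (fun x : M ↦ TangentSpace (𝓡 n) x)]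
    [IsRiemannianManifold (𝓡 n) M] [MeasurableSpace M] [BorelSpace M]
    {N : Type*} [EMetricSpace N] [SecondCountableTopology N]
    [ChartedSpace (EuclideanSpace ℝ (Fin n)) N] [IsManifold (𝓡 n) ∞ N]
    [Bundle.RiemannianBundle (fun x : N ↦ TangentSpace (𝓡 n) x)]
    [IsContMDiffRiemannianBundle (𝓡 n) ∞ (EuclideanSpace ℝ (Fin n))
      (fun x : N ↦ TangentSpace (𝓡 n) x)]
    [IsRiemannianManifold (𝓡 n) N] [MeasurableSpace N] [BorelSpace N]

/-- Almost every point of `D` has index one and positive minimal stretching. -/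
theorem riemVolume_image_compl_hasLocalIndex_one {D : Set M} (hDo : IsOpen D) {f : M → N}
    {o : OrientationField n M} {o' : OrientationField n N} (hcont : ContinuousOn f D)
    (hsense : SensePreserving o o' f D)
    (hdiff : ∀ᵐ x ∂(riemVolume n M).restrict D, MDifferentiableAt (𝓡 n) (𝓡 n) f x)
    (hN : LuzinN (riemVolume n M) (riemVolume n N) f D) :
    riemVolume n N (f '' {x | x ∈ D ∧ ¬ (HasLocalIndex o o' f D x 1 ∧ 0 < minStretch f x)})
      = 0 := by
  rw [ae_restrict_iff' hDo.measurableSet, ae_iff] at hdiff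
  have h1 : riemVolume n N (f '' {x | x ∈ D ∧ ¬ MDifferentiableAt (𝓡 n) (𝓡 n) f x}) = 0 := by
    refine hN _ (fun x hx ↦ hx.1) ?_
    simpa only [Classical.not_imp] using hdiff
  refine measure_mono_null ?_ (measure_union_null h1 (riemVolume_image_singular hDo hcont))
  rw [← image_union]
  refine image_mono ?_
  rintro x ⟨hx, hxg⟩
  by_cases hd : MDifferentiableAt (𝓡 n) (𝓡 n) f x
  · refine Or.inr ⟨hx, hd, fun hb ↦ hxg ?_⟩
    exact ⟨hasLocalIndex_one hDo hcont hsense hx hd hb, minStretch_pos hd hb⟩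
  · exact Or.inl ⟨hx, hd⟩

end Inequality

end RiemModulus

end

theorem mainTheorem5 {n : ℕ} (hn : 2 ≤ n)
    {M : Type*} [EMetricSpace M] [SecondCountableTopology M]
    [ChartedSpace (EuclideanSpace ℝ (Fin n)) M] [IsManifold (𝓡 n) ∞ M]
    [Bundle.RiemannianBundle (fun x : M ↦ TangentSpace (𝓡 n) x)]
    [IsContMDiffRiemannianBundle (𝓡 n) ∞ (EuclideanSpace ℝ (Fin n))
      (fun x : M ↦ TangentSpace (𝓡 n) x)]
    [IsRiemannianManifold (𝓡 n) M] [MeasurableSpace M] [BorelSpace M]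
    {N : Type*} [EMetricSpace N] [SecondCountableTopology N]
    [ChartedSpace (EuclideanSpace ℝ (Fin n)) N] [IsManifold (𝓡 n) ∞ N]
    [Bundle.RiemannianBundle (fun x : N ↦ TangentSpace (𝓡 n) x)]
    [IsContMDiffRiemannianBundle (𝓡 n) ∞ (EuclideanSpace ℝ (Fin n))
      (fun x : N ↦ TangentSpace (𝓡 n) x)]
    [IsRiemannianManifold (𝓡 n) N] [MeasurableSpace N] [BorelSpace N]
    (D : Set M) (hDo : IsOpen D) (hDc : IsConnected D)
    (p : ℝ) (hp : 1 ≤ p) (f : M → N)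
    (o : OrientationField n M) (o' : OrientationField n N)
    (ho : IsOrientationOn n o D) (ho' : IsOrientationOn n o' (f '' D))
    (hcont : ContinuousOn f D) (hopen : IsOpenMapOn f D) (hdisc : IsDiscreteMapOn f D)
    (hsense : SensePreserving o o' f D)
    (hdiff : ∀ᵐ x ∂(riemVolume n M).restrict D, MDifferentiableAt (𝓡 n) (𝓡 n) f x)
    (hACP : ACPInv (riemVolume n N) p f D)
    (hN : LuzinN (riemVolume n M) (riemVolume n N) f D)
    (hNinv : LuzinNInv (riemVolume n M) (riemVolume n N) f D)
    (Γ : Set (Curve M)) (hΓ : ∀ γ ∈ Γ, γ.LiesIn D) (Γ' : Set (Curve N))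
    (m : ℕ) (hm : 1 ≤ m)
    (hlift : ∀ β ∈ Γ', ∃ α : Fin m → Curve M,
      (∀ j, α j ∈ Γ) ∧ (∀ j, (α j).LiftsSubcurve f β) ∧
      ∀ x ∈ D, ∀ t ∈ β.dom, ∀ k : ℤ, HasLocalIndex o o' f D x k →
        (({j | t ∈ (α j).dom ∧ α j t = x} : Set (Fin m)).ncard : ℤ) ≤ k)
    (ρ : M → ℝ≥0∞) (hρ : Admissible Γ ρ) :
    modulus (riemVolume n N) p Γ' ≤
      (1 / (m : ℝ≥0∞)) * ∫⁻ x in D, innerDilatation n p f x * ρ x ^ p ∂(riemVolume n M) := by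
  have hp0 : 0 < p := by linarith
  have hdbl : ∀ x : M, ∃ C : NNReal, ∃ R > (0 : ℝ), ∀ r, 0 < r → r < R →
      riemVolume n M (Metric.closedEBall x (ENNReal.ofReal (3 * r))) ≤
        C * riemVolume n M (Metric.closedEBall x (ENNReal.ofReal r)) := by
    intro x
    obtain ⟨C, R, hR, h⟩ := riemVolume_doubling (n := n) x
    exact ⟨C, R, hR, fun r h0 h1 ↦ (h r h0 h1).1⟩
  obtain ⟨g, hgm, hgint, hg⟩ := exists_mean_pushforward (v := riemVolume n M)
    (w := riemVolume n N) (exists_isOpen_polishSpace (H := EuclideanSpace ℝ (Fin n))) hdbl hDo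
    hcont hN hm hp hρ.1
  set bad := {x | x ∈ D ∧ ¬ (HasLocalIndex o o' f D x 1 ∧ 0 < minStretch f x)} with hbad
  have hbad0 := riemVolume_image_compl_hasLocalIndex_one hDo hcont hsense hdiff hN
  rw [← hbad] at hbad0
  -- A Borel null set containing every value of `f` at a point of `D` that may lack index one or
  -- positive minimal stretching.
  set B := toMeasurable (riemVolume n N) (f '' bad) with hB
  have hBm : MeasurableSet B := measurableSet_toMeasurable _ _
  have hB0 : riemVolume n N B = 0 := (measure_toMeasurable _).trans hbad0
  have hgK : ∫⁻ y, g y ^ p ∂riemVolume n N ≤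
      (1 / (m : ℝ≥0∞)) * ∫⁻ x in D, innerDilatation n p f x * ρ x ^ p ∂riemVolume n M := by
    rw [one_div]
    refine hgint.trans ?_
    exact mul_le_mul_right (lintegral_mono fun x ↦
      stretch_rpow_mul_jacobian_le (n := n) hp0 f x (ρ x)) _
  refine ENNReal.le_of_forall_pos_le_add fun ε hε _ ↦ ?_
  have hACP' : modulus (riemVolume n N) p {β | β.LiesIn (f '' D) ∧ β.LocallyRectifiable ∧
      ¬ HasACLifts f D β} < ε := by
    rw [show modulus (riemVolume n N) p _ = 0 from hACP]
    exact_mod_cast hε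
  obtain ⟨σ, hσ⟩ := iInf_lt_iff.1 hACP'
  obtain ⟨hσadm, hσint⟩ := iInf_lt_iff.1 hσ
  set i : N → ℝ≥0∞ := B.indicator fun _ ↦ ⊤ with hi
  have him : Measurable i := measurable_const.indicator hBm
  have hi0 : ∫⁻ y, i y ^ p ∂riemVolume n N = 0 := by
    rw [lintegral_eq_zero_iff (him.pow_const p)]
    filter_upwards [measure_eq_zero_iff_ae_notMem.1 hB0] with y hy
    simp [hi, hy, hp0]
  -- Each `β` is handled by one of the three functions: `σ` if a lifted subcurve violates the
  -- absolute continuity condition, `i` if `β` spends positive length in `B`, and `g` otherwise.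
  have hadm : Admissible Γ' fun y ↦ max (g y) (max (σ y) (i y)) := by
    refine ⟨hgm.max (hσadm.1.max him), fun β hβ hβr ↦ ?_⟩
    obtain ⟨α, hαΓ, hαl, hαi⟩ := hlift β hβ
    have hαD : ∀ j, (α j).LiesIn D := fun j ↦ hΓ _ (hαΓ j)
    by_cases hAC : ∀ j, HasACLifts f D
      (β.restrict (α j).dom (α j).ordConnected_dom (α j).nonempty_dom (hαl j).1)
    swap
    · push Not at hAC
      obtain ⟨j, hj⟩ := hAC
      have hr : (β.restrict (α j).dom (α j).ordConnected_dom (α j).nonempty_dom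
          (hαl j).1).LocallyRectifiable := locallyBoundedVariationOn_mono hβr (hαl j).1
      have hmem : (β.restrict (α j).dom (α j).ordConnected_dom (α j).nonempty_dom
          (hαl j).1).LiesIn (f '' D) := fun t ht ↦ ⟨α j t, hαD j t ht, (hαl j).2 t ht⟩
      -- The exceptional curve is the restriction of `β` to the interval of the lift; it lies in `f
      -- '' D` although `β` need not, and its line integrals are bounded by those of `β`.
      refine (hσadm.2 _ ⟨hmem, hr, hj⟩ hr).trans ?_
      refine (Curve.lineIntegral_restrict_le _ _ _ _ _ _).trans (Curve.lineIntegral_mono ?_)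
      exact fun y ↦ (le_max_left _ _).trans (le_max_right _ _)
    by_cases hZ : ∀ a ∈ β.dom, ∀ b ∈ β.dom, a ≤ b → ∀ᵐ s,
        s ∈ Icc 0 (eVariationOn β (Icc a b)).toReal →
          naturalParameterization β (Icc a b) a s ∉ B
    swap
    · push Not at hZ
      obtain ⟨a, ha, b, hb, hab, h⟩ := hZ
      refine (Curve.one_le_lineIntegral_indicator_top hβr hBm ha hb hab ?_).trans
        (Curve.lineIntegral_mono fun y ↦ (le_max_right (σ y) (i y)).trans (le_max_right _ _))
      simpa only [not_eventually, Classical.not_imp, not_not] using h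
    refine Curve.one_le_lineIntegral_of_lifts hdisc hm hαD hαl hβr hAC
      (fun j ↦ hρ.2 _ (hαΓ j) (hAC j (α j) (hαD j) ⟨rfl, fun t ht ↦ (hαl j).2 t ht⟩).1) hZ ?_
    intro t ht htB J hJ
    have hgood : ∀ j ∈ J, HasLocalIndex o o' f D (α j t) 1 ∧ 0 < minStretch f (α j t) := by
      intro j hj
      by_contra hcon
      refine htB (subset_toMeasurable _ _ ⟨α j t, ⟨hαD j t (hJ j hj), hcon⟩, ?_⟩)
      exact (hαl j).2 t (hJ j hj)
    refine (hg (β t) J (fun j ↦ α j t) ?_ fun j hj ↦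
      ⟨hαD j t (hJ j hj), (hαl j).2 t (hJ j hj), (hgood j hj).2⟩).trans ?_
    -- Index one at `α a t` allows a single lift through that point at time `t`, so the points are
    -- distinct.
    · intro a ha b hb hab
      have h1 := hαi (α a t) (hαD a t (hJ a ha)) t ht 1 (hgood a ha).1
      have h2 : ({j | t ∈ (α j).dom ∧ α j t = α a t} : Set (Fin m)).ncard ≤ 1 := by
        exact_mod_cast h1
      exact (Set.ncard_le_one (toFinite _)).1 h2 a ⟨hJ a ha, rfl⟩ b ⟨hJ b hb, hab.symm⟩
    · gcongr
      exact le_max_left _ _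
  calc modulus (riemVolume n N) p Γ'
      ≤ ∫⁻ y, (max (g y) (max (σ y) (i y))) ^ p ∂riemVolume n N := iInf₂_le _ hadm
    _ ≤ ∫⁻ y, g y ^ p ∂riemVolume n N + (∫⁻ y, σ y ^ p ∂riemVolume n N +
          ∫⁻ y, i y ^ p ∂riemVolume n N) :=
        (lintegral_max_rpow_le _ hgm).trans (by
          gcongr
          exact lintegral_max_rpow_le _ hσadm.1)
    _ ≤ _ := by
        rw [hi0, add_zero]
        exact add_le_add hgK hσint.le
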